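/- Work in the complex-analytic category. Let $U\subset\mathbb{C}$ be a nonempty connected open set with an analytic branch $r(u)=u^{1/2}$ on $U$ (so $r(u)^2=u$), and put $u^{k/2}=r(u)^k$ for $k\in\mathbb{Z}$. Consider the Harry-Dym type equation $$u_t=u^{5/2}u_5,\qquad u\in U,\quad u_k=\partial^k u/\partial x^k .\qquad(1)$$ Definitions. A Miura type transformation (MT) over (1) is a pair $u=S(x,t,v,v_1,\dots,v_n)$, $v_t=R(x,t,v,v_1,\dots,v_q)$, with $S,R$ analytic on a connected open set of jets of $v$ and $S$ having values in $U$, such that $u=S$ satisfies (1) by virtue of $v_t=R$, i.e. $D_tS=S^{5/2}D^5S$ identically, where $D=\partial_x+\sum_j v_{j+1}\partial_{v_j}$ and $D_t=\partial_t+\sum_j D^j(R)\,\partial_{v_j}$. Its order is the largest $n$ such that $S$ depends nontrivially on $v_n$. A (translation-invariant) zero-curvature representation of (1) with values in a complex Lie algebra $L$, over a connected nonempty open set $\Omega$ of points $(u,u_1,\dots,u_4)$ with $u\in U$, is a pair of analytic $L$-valued functions $A(u)$, $B(u,\dots,u_4)$ with $D_xB-D_tA+[A,B]=0$ modulo (1).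 The Wahlquist-Estabrook algebra $\mathfrak{we}$ of (1) over $\Omega$ exists if there are fixed linearly independent analytic functions $f_i(u)$, $g_j(u,\dots,u_4)$, finite in number, and a set of Lie relations in letters $F_i,G_j$ such that for every $L$ each zero-curvature representation has the form $A=\sum f_iF_i$, $B=\sum g_jG_j$ with $F_i,G_j\in L$, and functions of this form are a zero-curvature representation if and only if the relations hold; then $\mathfrak{we}$ is the free Lie algebra on $F_i,G_j$ modulo these relations, with its universal $A(u)=\sum f_i(u)F_i$. Let $\mathfrak{we}^0=0$, let $\mathfrak{we}^1$ be the subalgebra generated by all $A(u)-A(u')$, let $\mathfrak{we}^{k+1}$ be the subalgebra generated by $\mathfrak{we}^k$ and all $[\mathfrak{we}^k,A(u)]$, and let $\widetilde{\mathfrak{we}}=\bigcup_k\mathfrak{we}^k$. Let $\mathfrak{g}\subset\mathfrak{sl}_3(\mathbb{C})\otimes\mathbb{C}[\lambda]$ be the Lie subalgebra generated by $X_1=\lambda E_{21}$ and $X_2=E_{13}+E_{32}$. Then: 1. For every such $\Omega$ the algebra $\mathfrak{we}$ of (1) exists and is isomorphic to $\mathbb{C}^2\oplus\mathfrak{g}$,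 with $\mathbb{C}^2=\langle C_1,C_2\rangle$ commutative, by an isomorphism that takes the universal $A(u)$ to $C_1u^{-1/2}+X_1u^{-3/2}+X_2$. Moreover $\mathfrak{we}^5=\widetilde{\mathfrak{we}}$. 2. $\mathfrak{g}$ is isomorphic to the positive part of the affine algebra $A_2^{(2)}$ (with Cartan matrix $\begin{pmatrix}2&-1\\-4&2\end{pmatrix}$), i.e. to its subalgebra generated by the Chevalley generators $E_1,E_2$, by an isomorphism taking $E_i$ to $X_i$. 3. Every (not necessarily translation-invariant) MT over (1) has order at most $5$. 4. The formula $$u=S=\left(\frac{v}{v_3}\right)^{2/3}$$ is an MT of order $3$ over (1), with modified equation $$v_t=-\frac32\,v\,D^2(S)+\frac92\,v_1D(S)-9\,v_2\,S .$$ Precisely, this holds for every analytic $S$ on a connected nonempty open set of jets $(x,t,v,\dots,v_5)$ with $v_3\ne0$, $S\in U$ and $S^{3/2}=v/v_3$; every analytic solution $v(x,t)$ of the modified equation with jets in this set gives a solution $u=S$ of (1); and near every jet with $v_3\neq0$ and $v/v_3=u_0^{3/2}$, $u_0\in U$, there is such an $S$ with value $u_0$ at this jet. -/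

import Mathlib

open scoped BigOperators Polynomial

universe w

attribute [local instance 100] LieRing.ofAssociativeRing

noncomputable section

namespace Miura

/-! ### Jets and total derivatives -/

/-- A point `(x, t, v, v₁, v₂, …)` of the infinite jet space of one dependent variable. -/
@[ext] structure Jet where
  x : ℂ
  t : ℂ
  v : ℕ → ℂ

/-- The space of jets of order `m`, with coordinates `(x, t, (v, v₁, …, v_m))`. -/
abbrev JetSpace (m : ℕ) : Type := ℂ × ℂ × (Fin (m + 1) → ℂ)

/-- The jet of order `m` underlying an infinite jet. -/
def Jet.trunc (m : ℕ) (J : Jet) : JetSpace m := (J.x, J.t, fun i => J.v i)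

/-- The coordinates `(v, v₁, …, v_{p-1})` of a jet. -/
def Jet.head (p : ℕ) (J : Jet) : Fin p → ℂ := fun i => J.v i

/-- `f` is, over the open set `Ω` of jets of order `m`, an analytic function of
`x, t, v, …, v_m` only. Its values at jets that do not lie over `Ω` are irrelevant. -/
def IsDiffFun (m : ℕ) (Ω : Set (JetSpace m)) (f : Jet → ℂ) : Prop :=
  ∃ F : JetSpace m → ℂ, AnalyticOnNhd ℂ F Ω ∧ ∀ J : Jet, J.trunc m ∈ Ω → f J = F (J.trunc m)

/-- `∂f/∂x` -/
def pdX (f : Jet → ℂ) (J : Jet) : ℂ := deriv (fun s => f ⟨s, J.t, J.v⟩) J.x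

/-- `∂f/∂t` -/
def pdT (f : Jet → ℂ) (J : Jet) : ℂ := deriv (fun s => f ⟨J.x, s, J.v⟩) J.t

/-- `∂f/∂v_j` -/
def pdV (j : ℕ) (f : Jet → ℂ) (J : Jet) : ℂ :=
  deriv (fun s => f ⟨J.x, J.t, Function.update J.v j s⟩) (J.v j)

/-- The total `x`-derivative `D_x = ∂/∂x + ∑_j v_{j+1} ∂/∂v_j`; the sum has finitely many nonzero
terms on functions of finite order. -/
def totalDx (f : Jet → ℂ) (J : Jet) : ℂ := pdX f J + ∑ᶠ j : ℕ, J.v (j + 1) * pdV j f J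

/-- The total `t`-derivative `D_t = ∂/∂t + ∑_j D_x^j(R) ∂/∂v_j` along the equation `v_t = R`. -/
def totalDt (R f : Jet → ℂ) (J : Jet) : ℂ :=
  pdT f J + ∑ᶠ j : ℕ, (totalDx^[j] R) J * pdV j f J

/-- The jet `(x, t, S, D_x S, D_x² S, …)` of the function `u = S(x, t, v, v₁, …)`. -/
def prolong (S : Jet → ℂ) (J : Jet) : Jet := ⟨J.x, J.t, fun k => (totalDx^[k] S) J⟩

/-! ### Miura type transformations -/

/-- `u = S` with the equation `v_t = R` is a Miura type transformation over the evolution equation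
`u_t = P(x, t, u, u₁, …)`, where `P` is considered over the set `Δ` of jets of `u`: `R` and `S` are
analytic on a domain `Ω` of jets of `v` of some finite order `m`, and `u = S` satisfies `u_t = P`
by virtue of `v_t = R` and its differential consequences, i.e. `D_t S = P(x, t, S, D_x S, …)`. -/
structure IsMiura (P : Jet → ℂ) (Δ : Set Jet) (m : ℕ) (Ω : Set (JetSpace m)) (R S : Jet → ℂ) :
    Prop where
  isOpen : IsOpen Ω
  isConnected : IsConnected Ω
  diffR : IsDiffFun m Ω R
  diffS : IsDiffFun m Ω S
  maps : ∀ J : Jet, J.trunc m ∈ Ω → prolong S J ∈ Δ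
  eqn : ∀ J : Jet, J.trunc m ∈ Ω → totalDt R S J = P (prolong S J)

/-- The transformation `u = S` has order `n`: `n` is the maximal integer such that `S` depends
nontrivially on `v_n`. -/
def HasOrder (m : ℕ) (Ω : Set (JetSpace m)) (S : Jet → ℂ) (n : ℕ) : Prop :=
  IsGreatest {k : ℕ | ∃ J : Jet, J.trunc m ∈ Ω ∧ pdV k S J ≠ 0} n

/-- The jet at the point `q = (x, t)` of a function `v(x, t)`. -/
def jetOf (v : ℂ × ℂ → ℂ) (q : ℂ × ℂ) : Jet :=
  ⟨q.1, q.2, fun k => iteratedDeriv k (fun s => v (s, q.2)) q.1⟩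

/-- `v` is an analytic solution on the open set `D` of the `(x, t)`-plane of the equation `v_t = P`,
with jets in the set `Δ` over which `P` is considered. -/
structure IsSolution (P : Jet → ℂ) (Δ : Set Jet) (D : Set (ℂ × ℂ)) (v : ℂ × ℂ → ℂ) : Prop where
  isOpen : IsOpen D
  analytic : AnalyticOnNhd ℂ v D
  jet_mem : ∀ q ∈ D, jetOf v q ∈ Δ
  eqn : ∀ q ∈ D, deriv (fun s => v (q.1, s)) q.2 = P (jetOf v q)

/-! ### Zero-curvature representations and the Wahlquist-Estabrook algebra -/

/-- The functions `A(u)` and `B(u, u₁, …, u_{p-1})`, analytic with values in the complex Lie algebra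
`L` for `(u, …, u_{p-1}) ∈ Ω`, form a translation-invariant zero-curvature representation of
`u_t = P`: `D_x B - D_t A + [A, B] = 0`. As `L` may have infinite dimension and carries no
topology, analyticity and the equation are expressed by means of all linear functionals on `L`
(which separate the points of `L`). -/
structure IsZCR (p : ℕ) [NeZero p] (Ω : Set (Fin p → ℂ)) (P : Jet → ℂ)
    {L : Type*} [LieRing L] [LieAlgebra ℂ L] (A : ℂ → L) (B : (Fin p → ℂ) → L) : Prop where
  analyticA : ∀ l : L →ₗ[ℂ] ℂ, ∀ z ∈ Ω, AnalyticAt ℂ (fun u => l (A u)) (z 0)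
  analyticB : ∀ l : L →ₗ[ℂ] ℂ, AnalyticOnNhd ℂ (fun z => l (B z)) Ω
  eqn : ∀ l : L →ₗ[ℂ] ℂ, ∀ J : Jet, J.head p ∈ Ω →
    totalDx (fun K => l (B (K.head p))) J - totalDt P (fun K => l (A (K.v 0))) J
      + l ⁅A (J.v 0), B (J.head p)⁆ = 0

/-- The data defining the Wahlquist-Estabrook algebra of the translation-invariant equation
`u_t = P(u, …, u_p)` over the domain `Ω` of the variables `u, …, u_{p-1}`: fixed linearly
independent scalar functions `f_i(u)`, `g_i(u, …, u_{p-1})` and a set of elements (relations) of the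
free Lie algebra on letters `F_i`, `G_i` such that, for every Lie algebra, each zero-curvature
representation has the form `A = ∑ f_i F_i`, `B = ∑ g_i G_i`, and functions of this form are a
zero-curvature representation if and only if the relations hold between the `F_i`, `G_i`. -/
structure WEData (p : ℕ) [NeZero p] (Ω : Set (Fin p → ℂ)) (P : Jet → ℂ) where
  k₁ : ℕ
  k₂ : ℕ
  f : Fin k₁ → ℂ → ℂ
  g : Fin k₂ → (Fin p → ℂ) → ℂ
  rel : Set (FreeLieAlgebra ℂ (Fin k₁ ⊕ Fin k₂))
  analytic_f : ∀ i, ∀ z ∈ Ω, AnalyticAt ℂ (f i) (z 0)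
  analytic_g : ∀ i, AnalyticOnNhd ℂ (g i) Ω
  indep_f : ∀ c : Fin k₁ → ℂ, (∀ z ∈ Ω, ∑ i, c i * f i (z 0) = 0) → c = 0
  indep_g : ∀ c : Fin k₂ → ℂ, (∀ z ∈ Ω, ∑ i, c i * g i z = 0) → c = 0
  form : ∀ (L : Type w) [LieRing L] [LieAlgebra ℂ L] (A : ℂ → L) (B : (Fin p → ℂ) → L),
    IsZCR p Ω P A B → ∃ (F : Fin k₁ → L) (G : Fin k₂ → L),
      ∀ z ∈ Ω, A (z 0) = ∑ i, f i (z 0) • F i ∧ B z = ∑ i, g i z • G i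
  isZCR_iff : ∀ (L : Type w) [LieRing L] [LieAlgebra ℂ L] (F : Fin k₁ → L) (G : Fin k₂ → L),
    IsZCR p Ω P (fun u => ∑ i, f i u • F i) (fun z => ∑ i, g i z • G i) ↔
      ∀ a ∈ rel, FreeLieAlgebra.lift ℂ (Sum.elim F G) a = 0

namespace WEData

variable {p : ℕ} [NeZero p] {Ω : Set (Fin p → ℂ)} {P : Jet → ℂ}

/-- The Wahlquist-Estabrook algebra: the free Lie algebra on the letters `F_i`, `G_i` modulo the
ideal generated by the relations. -/
abbrev Algebra (W : WEData.{w} p Ω P) : Type :=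
  FreeLieAlgebra ℂ (Fin W.k₁ ⊕ Fin W.k₂) ⧸
    (LieSubmodule.lieSpan ℂ (FreeLieAlgebra ℂ (Fin W.k₁ ⊕ Fin W.k₂)) W.rel :
      LieIdeal ℂ (FreeLieAlgebra ℂ (Fin W.k₁ ⊕ Fin W.k₂)))

/-- The class of a letter in the Wahlquist-Estabrook algebra. -/
def letter (W : WEData.{w} p Ω P) (i : Fin W.k₁ ⊕ Fin W.k₂) : W.Algebra :=
  LieSubmodule.Quotient.mk (FreeLieAlgebra.of ℂ i)

/-- The `x`-part `A = ∑ f_i F_i` of the universal zero-curvature representation. -/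
def A (W : WEData.{w} p Ω P) (u : ℂ) : W.Algebra := ∑ i, W.f i u • W.letter (Sum.inl i)

/-- The `t`-part `B = ∑ g_i G_i` of the universal zero-curvature representation. -/
def B (W : WEData.{w} p Ω P) (z : Fin p → ℂ) : W.Algebra := ∑ i, W.g i z • W.letter (Sum.inr i)

end WEData

/-- The subalgebras `L⁰ ⊆ L¹ ⊆ L² ⊆ …` defined by the `x`-part `M` of a zero-curvature
representation, `ι` being the set of admissible values of the variables: `L⁰ = 0`, `L¹` is generated
by the differences `M a - M b`, and `L^{k+1}` is generated by `L^k` and all `[L^k, M a]`. -/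
def chain {ι L : Type*} [LieRing L] [LieAlgebra ℂ L] (M : ι → L) : ℕ → LieSubalgebra ℂ L
  | 0 => ⊥
  | 1 => LieSubalgebra.lieSpan ℂ L {y | ∃ a b, y = M a - M b}
  | k + 2 => LieSubalgebra.lieSpan ℂ L
      ((chain M (k + 1) : Set L) ∪ {y | ∃ c ∈ chain M (k + 1), ∃ a, y = ⁅c, M a⁆})

/-! ### The positive part of the twisted affine algebra of type `A₂⁽²⁾` -/

/-- `X₁`, as a `3 × 3` matrix with entries in `ℂ[λ]`; traceless matrices of this kind form
`sl₃(ℂ) ⊗ ℂ[λ]`. -/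
def X₁ : Matrix (Fin 3) (Fin 3) ℂ[X] := !![0, 0, 0; Polynomial.X, 0, 0; 0, 0, 0]

/-- `X₂`, as a `3 × 3` matrix with entries in `ℂ[λ]`. -/
def X₂ : Matrix (Fin 3) (Fin 3) ℂ[X] := !![0, 0, 1; 0, 0, 0; 0, 1, 0]

/-- The complex Lie algebra of matrices generated by `X₁` and `X₂`. -/
def gAlg : LieSubalgebra ℂ (Matrix (Fin 3) (Fin 3) ℂ[X]) := LieSubalgebra.lieSpan ℂ _ {X₁, X₂}

/-- `X₁` as an element of `gAlg` -/
def x₁ : gAlg := ⟨X₁, LieSubalgebra.subset_lieSpan (by simp)⟩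

/-- `X₂` as an element of `gAlg` -/
def x₂ : gAlg := ⟨X₂, LieSubalgebra.subset_lieSpan (by simp)⟩

/-- The affine Cartan matrix of type `A₂⁽²⁾`. -/
def cartanA22 : Matrix (Fin 2) (Fin 2) ℤ := !![2, -1; -4, 2]

/-- The Chevalley generator `E_i` of the affine Kac-Moody algebra of type `A₂⁽²⁾`. -/
def chevalleyE (i : Fin 2) : Matrix.ToLieAlgebra ℂ cartanA22 :=
  show FreeLieAlgebra ℂ (CartanMatrix.Generators (Fin 2)) ⧸
      CartanMatrix.Relations.toIdeal ℂ cartanA22 from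
    LieSubmodule.Quotient.mk (FreeLieAlgebra.of ℂ (CartanMatrix.Generators.E i))

/-- The positive part of the affine algebra of type `A₂⁽²⁾`: the subalgebra generated by the
`E_i`. -/
def posA22 : LieSubalgebra ℂ (Matrix.ToLieAlgebra ℂ cartanA22) :=
  LieSubalgebra.lieSpan ℂ _ (Set.range chevalleyE)

/-- `E_i` as an element of the positive part -/
def posE (i : Fin 2) : posA22 := ⟨chevalleyE i, LieSubalgebra.subset_lieSpan ⟨i, rfl⟩⟩

/-! ### The Harry-Dym type equation -/

/-- The right-hand side of `u_t = u^{5/2} u₅`, where `r` is a branch of `u^{1/2}`. -/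
def hdFlux (r : ℂ → ℂ) (J : Jet) : ℂ := r (J.v 0) ^ 5 * J.v 5

/-- The jets of functions with values in `U`. -/
def valuesIn (U : Set ℂ) : Set Jet := {J | J.v 0 ∈ U}

/-- The right-hand side `-(3/2) v D²(S) + (9/2) v₁ D(S) - 9 v₂ S` of the modified equation. -/
def modFlux (S : Jet → ℂ) (J : Jet) : ℂ :=
  -(3 / 2) * J.v 0 * (totalDx^[2] S) J + 9 / 2 * J.v 1 * totalDx S J - 9 * J.v 2 * S J

end Miura

end

/-!
The four parts rest on three arguments.

**The algebra `𝔤`.** Let `e`, `f` be elements of a Lie algebra with `(ad e)² f = 0` and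
`(ad f)⁵ e = 0` (`SerrePair`), and let `π` be a homomorphism with `π e = X₁` and `π f = X₂`. The
algebra generated by `e` and `f` is spanned, degree by degree in the principal grading, by iterated
brackets that repeat with period six (`BlockTable`, `degPart`). The relations of one period imply
those of the next one as soon as the two brackets in the last degree of the period, an imaginary
root space, are proportional (`ImagRel`). This proportionality is itself a consequence of the Serre
relations: in lower degrees `π` is injective, so that all brackets there can be computed with
matrices, and the Jacobi identity, applied along the whole degree, leaves only one parameter
(`SerrePair.imagRel_of_lt`). Hence `π` is injective on the subalgebra
(`SerrePair.eq_zero_of_map_eq_zero`), that is, `𝔤` is presented by the Serre relations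
(`SerrePair.exists_lieHom`). As the `E_i` satisfy these relations, `𝔤` maps onto the positive part
of `A₂⁽²⁾`; this map is injective, because the affine algebra acts by matrices over the rational
functions of `λ` and `E_i` goes to `X_i` (`affineToLoop`).

**The zero-curvature equation.** As the algebra `L` carries no topology, analytic functions are
treated by means of linear functionals. On compact sets they have values in subspaces of finite
dimension (`finiteDimensional_span_image`), so that they have derivatives in `L`, and brackets are
differentiated by the Leibniz rule. Repeated differentiation of the equation with respect to
`u₅, u₄, …, u₁` determines `A` and `B` up to four elements of `L`: two of them commute with all four
elements, and the other two form a Serre pair (`exists_hdRel_of_isZCR`); conversely, such elements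
give a zero-curvature representation (`HDRel.isZCR`). By the presentation of `𝔤`, this says that the
universal algebra is `ℂ² ⊕ 𝔤` (`exists_weData`). The chain of subalgebras reaches
`(ad Y₂)ᵏ Y₁` at its `(k + 1)`-th step, and `(ad Y₂)⁵ Y₁ = 0` (`HDRel.chain_five`).

**Miura type transformations.** If `S` has order `n`, then the highest derivative of `v` in
`D_t S = S^{5/2} D⁵ S` shows that `R` has order at most `5` and that `∂R/∂v₅ = S^{5/2}`. For
`n > 5` the left-hand side of the last equation does not depend on `v_n`, unlike the right-hand side
(`IsMiura.order_le_five`). For `S = (v / v₃)^{2/3}` all derivatives of `S` that occur follow from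
`S³ v₃² = v²`, and the equation is a linear combination of such relations (`IsBranch.isMiura`).
-/

noncomputable section

namespace Miura

/-! ### The Serre relations of type `A₂⁽²⁾` -/

section Serre

variable {L : Type*} [LieRing L] [LieAlgebra ℂ L]

/-- The Serre relations of type `A₂⁽²⁾` for a pair of elements: `(ad e)² f = 0` and
`(ad f)⁵ e = 0`. -/
structure SerrePair (e f : L) : Prop where
  ad_sq : ⁅e, ⁅e, f⁆⁆ = 0
  ad_pow_five : ⁅f, ⁅f, ⁅f, ⁅f, ⁅f, e⁆⁆⁆⁆⁆ = 0

/-- The relation `ad ((ad e)² f) = 0`, written out. -/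
theorem SerrePair.lie_lie_lie {e f : L} (h : SerrePair e f) (x : L) :
    ⁅e, ⁅e, ⁅f, x⁆⁆⁆ = (2 : ℂ) • ⁅e, ⁅f, ⁅e, x⁆⁆⁆ - ⁅f, ⁅e, ⁅e, x⁆⁆⁆ := by
  have h1 : ⁅⁅e, ⁅e, f⁆⁆, x⁆ = 0 := by rw [h.ad_sq, zero_lie]
  simp only [lie_lie, lie_sub] at h1
  rw [← sub_eq_zero, ← h1]
  module

/-- The relation `ad ((ad f)⁵ e) = 0`, written out. -/
theorem SerrePair.lie_five {e f : L} (h : SerrePair e f) (x : L) :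
    ⁅f, ⁅f, ⁅f, ⁅f, ⁅f, ⁅e, x⁆⁆⁆⁆⁆⁆ - (5 : ℂ) • ⁅f, ⁅f, ⁅f, ⁅f, ⁅e, ⁅f, x⁆⁆⁆⁆⁆⁆
      + (10 : ℂ) • ⁅f, ⁅f, ⁅f, ⁅e, ⁅f, ⁅f, x⁆⁆⁆⁆⁆⁆ - (10 : ℂ) • ⁅f, ⁅f, ⁅e, ⁅f, ⁅f, ⁅f, x⁆⁆⁆⁆⁆⁆
      + (5 : ℂ) • ⁅f, ⁅e, ⁅f, ⁅f, ⁅f, ⁅f, x⁆⁆⁆⁆⁆⁆ - ⁅e, ⁅f, ⁅f, ⁅f, ⁅f, ⁅f, x⁆⁆⁆⁆⁆⁆ = 0 := by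
  have h1 : ⁅⁅f, ⁅f, ⁅f, ⁅f, ⁅f, e⁆⁆⁆⁆⁆, x⁆ = 0 := by rw [h.ad_pow_five, zero_lie]
  simp only [lie_lie, lie_sub] at h1
  rw [← h1]
  module

/-- The part of the multiplication table of the positive part of `A₂⁽²⁾` within one period (six
consecutive principal degrees), for real roots. The period starts with `P` and `Q`; it goes on with
`(ad f)ⁱ Q` for `i ≤ 4`, with `T = [e, (ad f)³ Q]` and with `[f, T]`. -/
structure BlockTable (e f Q P : L) : Prop where
  eQ : ⁅e, Q⁆ = 0
  fP : ⁅f, P⁆ = 0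
  eP : ⁅e, P⁆ = (1 / 2 : ℂ) • ⁅f, Q⁆
  efQ : ⁅e, ⁅f, Q⁆⁆ = 0
  effQ : ⁅e, ⁅f, ⁅f, Q⁆⁆⁆ = 0
  fffffQ : ⁅f, ⁅f, ⁅f, ⁅f, ⁅f, Q⁆⁆⁆⁆⁆ = 0
  eefffQ : ⁅e, ⁅e, ⁅f, ⁅f, ⁅f, Q⁆⁆⁆⁆⁆ = 0

theorem SerrePair.blockTable_zero {e f : L} (h : SerrePair e f) :
    BlockTable e f e (-(1 / 2 : ℂ) • f) := by
  have h2 : ⁅e, ⁅f, e⁆⁆ = 0 := by rw [← lie_skew f e, lie_neg, h.ad_sq, neg_zero]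
  have h3 : ⁅e, ⁅f, ⁅f, e⁆⁆⁆ = 0 := by
    rw [leibniz_lie, h2, lie_zero, add_zero, ← lie_skew e f, neg_lie, lie_self, neg_zero]
  refine ⟨lie_self e, by simp, ?_, h2, h3, h.ad_pow_five, ?_⟩
  · rw [lie_smul, ← lie_skew e f]; module
  · rw [h.lie_lie_lie, h3]; simp

/-- The passage from one period to the next uses the relation `[e, R] = 2 [f, T]` in the imaginary
root space, `R` being `(ad f)⁴ Q`. With this relation, the two identities for `ad e` and `ad f`
determine all other brackets. -/
theorem SerrePair.blockTable_succ {e f Q P : L} (h : SerrePair e f) (b : BlockTable e f Q P)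
    (ht : ⁅e, ⁅f, ⁅f, ⁅f, ⁅f, Q⁆⁆⁆⁆⁆ = (2 : ℂ) • ⁅f, ⁅e, ⁅f, ⁅f, ⁅f, Q⁆⁆⁆⁆⁆) :
    BlockTable e f ⁅e, ⁅f, ⁅e, ⁅f, ⁅f, ⁅f, Q⁆⁆⁆⁆⁆⁆ ⁅f, ⁅f, ⁅e, ⁅f, ⁅f, ⁅f, Q⁆⁆⁆⁆⁆⁆ := by
  set T := ⁅e, ⁅f, ⁅f, ⁅f, Q⁆⁆⁆⁆ with hT
  have eT : ⁅e, T⁆ = 0 := b.eefffQ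
  have h1 : ⁅e, ⁅e, ⁅f, T⁆⁆⁆ = 0 := by rw [h.lie_lie_lie, eT]; simp
  have h2 : ⁅f, ⁅f, ⁅f, T⁆⁆⁆ = 0 := by
    have h0 := h.lie_five ⁅f, Q⁆
    rw [b.fffffQ, b.efQ, b.effQ, ht, ← hT] at h0
    simp only [lie_zero, lie_smul, smul_zero, sub_zero, add_zero, zero_add] at h0
    have h0' : (-10 : ℂ) • ⁅f, ⁅f, ⁅f, T⁆⁆⁆ = 0 := by rw [← h0]; module
    simpa using h0'
  have h3 : ⁅e, ⁅f, ⁅f, T⁆⁆⁆ = (1 / 2 : ℂ) • ⁅f, ⁅e, ⁅f, T⁆⁆⁆ := by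
    have h0 := h.lie_lie_lie ⁅f, ⁅f, ⁅f, ⁅f, Q⁆⁆⁆⁆
    rw [b.fffffQ, ht] at h0
    simp only [lie_zero, lie_smul] at h0
    have h0' : (4 : ℂ) • (⁅e, ⁅f, ⁅f, T⁆⁆⁆ - (1 / 2 : ℂ) • ⁅f, ⁅e, ⁅f, T⁆⁆⁆) = 0 := by
      rw [h0]; module
    rw [← sub_eq_zero]; simpa using h0'
  have h4 : ⁅e, ⁅f, ⁅e, ⁅f, T⁆⁆⁆⁆ = 0 := by
    have h0 := h.lie_lie_lie ⁅f, T⁆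
    rw [h1, h3, lie_smul, lie_zero, sub_zero] at h0
    have h0' : (-(3 / 2) : ℂ) • ⁅e, ⁅f, ⁅e, ⁅f, T⁆⁆⁆⁆ = 0 := by
      rw [← sub_eq_zero] at h0; rw [← h0]; module
    simpa using h0'
  have h5 : ⁅e, ⁅f, ⁅f, ⁅e, ⁅f, T⁆⁆⁆⁆⁆ = 0 := by
    have h0 := h.lie_lie_lie ⁅f, ⁅f, T⁆⁆
    rw [h2, h3] at h0
    simp only [lie_smul, h4, lie_zero, smul_zero, sub_zero] at h0
    rw [← smul_assoc] at h0
    simpa using h0.symm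
  refine ⟨h1, h2, h3, h4, h5, ?_, ?_⟩
  · have h0 := h.lie_five ⁅f, T⁆
    rw [h2, h3] at h0
    simp only [lie_smul, lie_zero, smul_zero, sub_zero, add_zero] at h0
    have h0' : (-(3 / 2) : ℂ) • ⁅f, ⁅f, ⁅f, ⁅f, ⁅f, ⁅e, ⁅f, T⁆⁆⁆⁆⁆⁆⁆ = 0 := by
      rw [← h0]; module
    simpa using h0'
  · rw [h.lie_lie_lie, h5]; simp

/-- The part of principal degree `h` of the subalgebra generated by `e` and `f`. -/
def degPart (e f : L) : ℕ → Submodule ℂ L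
  | 0 => ⊥
  | 1 => Submodule.span ℂ {e, f}
  | h + 2 => (degPart e f (h + 1)).map (LieAlgebra.ad ℂ L e : L →ₗ[ℂ] L) ⊔
      (degPart e f (h + 1)).map (LieAlgebra.ad ℂ L f : L →ₗ[ℂ] L)

theorem lie_left_mem_degPart {e f x : L} {h : ℕ} (hx : x ∈ degPart e f (h + 1)) :
    ⁅e, x⁆ ∈ degPart e f (h + 2) :=
  Submodule.mem_sup_left ⟨x, hx, rfl⟩

theorem lie_right_mem_degPart {e f x : L} {h : ℕ} (hx : x ∈ degPart e f (h + 1)) :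
    ⁅f, x⁆ ∈ degPart e f (h + 2) :=
  Submodule.mem_sup_right ⟨x, hx, rfl⟩

/-- It suffices to bracket a spanning set of the preceding degree with `e` and `f`. -/
theorem degPart_succ_le {e f : L} {h : ℕ} {N : Submodule ℂ L} (s : Set L)
    (hs : degPart e f (h + 1) ≤ Submodule.span ℂ s)
    (he : ∀ x ∈ s, ⁅e, x⁆ ∈ N) (hf : ∀ x ∈ s, ⁅f, x⁆ ∈ N) : degPart e f (h + 2) ≤ N := by
  refine sup_le ?_ ?_
  · refine (Submodule.map_mono hs).trans ?_
    rw [Submodule.map_span, Submodule.span_le]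
    rintro _ ⟨x, hx, rfl⟩
    exact he x hx
  · refine (Submodule.map_mono hs).trans ?_
    rw [Submodule.map_span, Submodule.span_le]
    rintro _ ⟨x, hx, rfl⟩
    exact hf x hx

theorem lie_mem_degPart {e f : L} {i j : ℕ} {x y : L} (hx : x ∈ degPart e f (i + 1))
    (hy : y ∈ degPart e f (j + 1)) : ⁅x, y⁆ ∈ degPart e f (i + j + 2) := by
  induction i generalizing x y j with
  | zero =>
    rw [zero_add]
    induction hx using Submodule.span_induction with
    | mem x hx =>
      rcases hx with rfl | rfl
      · exact lie_left_mem_degPart hy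
      · exact lie_right_mem_degPart hy
    | zero => simp
    | add a b _ _ ha hb => rw [add_lie]; exact add_mem ha hb
    | smul c a _ ha => rw [smul_lie]; exact Submodule.smul_mem _ _ ha
  | succ i ih =>
    have key : ∀ g : L,
        (∀ (k : ℕ) (z : L), z ∈ degPart e f (k + 1) → ⁅g, z⁆ ∈ degPart e f (k + 2)) →
        ∀ a ∈ degPart e f (i + 1), ⁅⁅g, a⁆, y⁆ ∈ degPart e f (i + 1 + j + 2) := by
      intro g hg a ha
      rw [lie_lie]
      refine sub_mem ?_ ?_
      · have := hg _ _ (ih ha hy)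
        convert this using 2; ring
      · have := ih ha (hg _ _ hy)
        convert this using 2; ring
    obtain ⟨_, ⟨a, ha, rfl⟩, _, ⟨b, hb, rfl⟩, rfl⟩ := Submodule.mem_sup.1 hx
    rw [add_lie]
    exact add_mem (key e (fun k z hz => lie_left_mem_degPart hz) a ha)
      (key f (fun k z hz => lie_right_mem_degPart hz) b hb)

theorem lieSpan_le_iSup_degPart (e f : L) :
    ((LieSubalgebra.lieSpan ℂ L {e, f} : LieSubalgebra ℂ L) : Submodule ℂ L) ≤
      ⨆ h, degPart e f h := by
  let K : LieSubalgebra ℂ L :=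
    { (⨆ h, degPart e f h) with
      lie_mem' := by
        intro x y hx hy
        change x ∈ ⨆ h, degPart e f h at hx
        change y ∈ ⨆ h, degPart e f h at hy
        change ⁅x, y⁆ ∈ ⨆ h, degPart e f h
        induction hx using Submodule.iSup_induction' with
        | mem i x hx =>
          induction hy using Submodule.iSup_induction' with
          | mem j y hy =>
            cases i with
            | zero => rw [(Submodule.mem_bot ℂ).1 hx]; simp
            | succ i =>
              cases j with
              | zero => rw [(Submodule.mem_bot ℂ).1 hy]; simp
              | succ j => exact Submodule.mem_iSup_of_mem _ (lie_mem_degPart hx hy)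
          | zero => simp
          | add a b _ _ ha hb => rw [lie_add]; exact add_mem ha hb
        | zero => simp
        | add a b _ _ ha hb => rw [add_lie]; exact add_mem ha hb }
  have hK : LieSubalgebra.lieSpan ℂ L {e, f} ≤ K := by
    rw [LieSubalgebra.lieSpan_le]
    have h1 : Submodule.span ℂ {e, f} ≤ ⨆ h, degPart e f h := le_iSup (degPart e f) 1
    exact (Submodule.subset_span).trans h1
  exact hK

/-- The lowest root vectors `Q` of the successive periods. -/
def blockQ (e f : L) : ℕ → L
  | 0 => e
  | s + 1 => ⁅e, ⁅f, ⁅e, ⁅f, ⁅f, ⁅f, blockQ e f s⁆⁆⁆⁆⁆⁆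

/-- The root vectors `P` of the successive periods. The first one is `-f/2`, so that
`[e, P] = [f, Q]/2` in all periods. -/
def blockP (e f : L) : ℕ → L
  | 0 => -(1 / 2 : ℂ) • f
  | s + 1 => ⁅f, ⁅f, ⁅e, ⁅f, ⁅f, ⁅f, blockQ e f s⁆⁆⁆⁆⁆⁆

/-- `T = [e, (ad f)³ Q]`, the second root vector of fifth degree in a period. -/
def blockT (e f : L) (s : ℕ) : L := ⁅e, ⁅f, ⁅f, ⁅f, blockQ e f s⁆⁆⁆⁆

/-- `R = (ad f)⁴ Q`, the first root vector of fifth degree in a period. -/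
def blockR (e f : L) (s : ℕ) : L := ⁅f, ⁅f, ⁅f, ⁅f, blockQ e f s⁆⁆⁆⁆

variable {e f : L}

theorem blockQ_mem (s : ℕ) : blockQ e f s ∈ degPart e f (6 * s + 1) := by
  induction s with
  | zero => exact Submodule.subset_span (by simp [blockQ])
  | succ s ih =>
    exact lie_left_mem_degPart (lie_right_mem_degPart (lie_left_mem_degPart
      (lie_right_mem_degPart (lie_right_mem_degPart (lie_right_mem_degPart ih)))))

theorem blockP_mem (s : ℕ) : blockP e f s ∈ degPart e f (6 * s + 1) := by
  cases s with
  | zero => exact Submodule.smul_mem _ _ (Submodule.subset_span (by simp))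
  | succ s =>
    exact lie_right_mem_degPart (lie_right_mem_degPart (lie_left_mem_degPart
      (lie_right_mem_degPart (lie_right_mem_degPart (lie_right_mem_degPart (blockQ_mem s))))))

/-- The statement that the imaginary root space in the period `s` is one-dimensional. -/
def ImagRel (e f : L) (s : ℕ) : Prop := ⁅e, blockR e f s⁆ = (2 : ℂ) • ⁅f, blockT e f s⁆

theorem SerrePair.blockTable {s : ℕ} (h : SerrePair e f) (ht : ∀ t < s, ImagRel e f t) :
    BlockTable e f (blockQ e f s) (blockP e f s) := by
  induction s with
  | zero => exact h.blockTable_zero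
  | succ s ih => exact h.blockTable_succ (ih fun t hts => ht t (by omega)) (ht s (by omega))

/-- The spaces of the first five principal degrees of a period, if the first one is known. -/
theorem SerrePair.degPart_le_of_one {s : ℕ} (h : SerrePair e f) (ht : ∀ t < s, ImagRel e f t)
    (h1 : degPart e f (6 * s + 1) ≤ Submodule.span ℂ {blockP e f s, blockQ e f s}) :
    degPart e f (6 * s + 2) ≤ Submodule.span ℂ {⁅f, blockQ e f s⁆} ∧
    degPart e f (6 * s + 3) ≤ Submodule.span ℂ {⁅f, ⁅f, blockQ e f s⁆⁆} ∧
    degPart e f (6 * s + 4) ≤ Submodule.span ℂ {⁅f, ⁅f, ⁅f, blockQ e f s⁆⁆⁆} ∧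
    degPart e f (6 * s + 5) ≤ Submodule.span ℂ {blockR e f s, blockT e f s} := by
  have b := h.blockTable ht
  have h2 : degPart e f (6 * s + 2) ≤ Submodule.span ℂ {⁅f, blockQ e f s⁆} := by
    refine degPart_succ_le _ h1 ?_ ?_
    · rintro x (rfl | rfl)
      · rw [b.eP]; exact Submodule.smul_mem _ _ (Submodule.subset_span rfl)
      · rw [b.eQ]; exact zero_mem _
    · rintro x (rfl | rfl)
      · rw [b.fP]; exact zero_mem _
      · exact Submodule.subset_span rfl
  have h3 : degPart e f (6 * s + 3) ≤ Submodule.span ℂ {⁅f, ⁅f, blockQ e f s⁆⁆} := by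
    refine degPart_succ_le _ h2 ?_ ?_
    · rintro x rfl
      rw [b.efQ]; exact zero_mem _
    · rintro x rfl
      exact Submodule.subset_span rfl
  have h4 : degPart e f (6 * s + 4) ≤ Submodule.span ℂ {⁅f, ⁅f, ⁅f, blockQ e f s⁆⁆⁆} := by
    refine degPart_succ_le _ h3 ?_ ?_
    · rintro x rfl
      rw [b.effQ]; exact zero_mem _
    · rintro x rfl
      exact Submodule.subset_span rfl
  refine ⟨h2, h3, h4, degPart_succ_le _ h4 ?_ ?_⟩
  · rintro x rfl
    exact Submodule.subset_span (Or.inr rfl)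
  · rintro x rfl
    exact Submodule.subset_span (Or.inl rfl)

theorem SerrePair.degPart_six_le {s : ℕ} (h : SerrePair e f) (ht : ∀ t < s + 1, ImagRel e f t)
    (h1 : degPart e f (6 * s + 1) ≤ Submodule.span ℂ {blockP e f s, blockQ e f s}) :
    degPart e f (6 * s + 6) ≤ Submodule.span ℂ {⁅f, blockT e f s⁆} := by
  have ht' : ∀ t < s, ImagRel e f t := fun t hts => ht t (by omega)
  have b := h.blockTable ht'
  refine degPart_succ_le _ (h.degPart_le_of_one ht' h1).2.2.2 ?_ ?_
  · rintro x (rfl | rfl)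
    · rw [ht s (by omega)]; exact Submodule.smul_mem _ _ (Submodule.subset_span rfl)
    · rw [blockT, b.eefffQ]; exact zero_mem _
  · rintro x (rfl | rfl)
    · rw [blockR, b.fffffQ]; exact zero_mem _
    · exact Submodule.subset_span rfl

theorem SerrePair.degPart_one_le {s : ℕ} (h : SerrePair e f) (ht : ∀ t < s, ImagRel e f t) :
    degPart e f (6 * s + 1) ≤ Submodule.span ℂ {blockP e f s, blockQ e f s} := by
  induction s with
  | zero =>
    refine Submodule.span_le.2 ?_
    rintro x (rfl | rfl)
    · exact Submodule.subset_span (by simp [blockQ])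
    · have h1 : blockP e x 0 ∈ Submodule.span ℂ {blockP e x 0, blockQ e x 0} :=
        Submodule.subset_span (by simp)
      have h2 := Submodule.smul_mem _ (-2 : ℂ) h1
      have h3 : (-2 : ℂ) • blockP e x 0 = x := by rw [blockP]; module
      rwa [h3] at h2
  | succ s ih =>
    have h1 := ih fun t hts => ht t (by omega)
    refine degPart_succ_le _ (h.degPart_six_le ht h1) ?_ ?_
    · rintro x rfl
      exact Submodule.subset_span (Or.inr rfl)
    · rintro x rfl
      exact Submodule.subset_span (Or.inl rfl)

end Serre

/-! ### The period of the matrix algebra -/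

local notation "Mat" => Matrix (Fin 3) (Fin 3) ℂ[X]

open Polynomial in
/-- The matrices `(ad X₂)ⁱ X₁`, `i = 1, …, 4`, then `T = [X₁, (ad X₂)³ X₁]` and `[X₂, T]`. -/
def perMat : Fin 6 → Mat
  | 0 => !![0, 0, 0; 0, 0, -X; X, 0, 0]
  | 1 => !![X, 0, 0; 0, X, 0; 0, 0, -2 * X]
  | 2 => !![0, 0, -3 * X; 0, 0, 0; 0, 3 * X, 0]
  | 3 => !![0, 6 * X, 0; 0, 0, 0; 0, 0, 0]
  | 4 => !![0, 0, 0; 0, 0, -3 * X ^ 2; -3 * X ^ 2, 0, 0]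
  | 5 => !![-3 * X ^ 2, 0, 0; 0, 3 * X ^ 2, 0; 0, 0, 0]

open Polynomial in
/-- The factor by which the period `s` of the matrix algebra differs from the period `0`. -/
def perScale (s : ℕ) : ℂ[X] := (-6 * X ^ 2) ^ s

theorem perScale_ne_zero (s : ℕ) : perScale s ≠ 0 := by
  refine pow_ne_zero _ (mul_ne_zero ?_ (pow_ne_zero _ Polynomial.X_ne_zero))
  norm_num

theorem lie_smul_mat (m : ℂ[X]) (M N : Mat) : ⁅M, m • N⁆ = m • ⁅M, N⁆ := by
  simp [Ring.lie_def, smul_sub]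

theorem smul_lie_mat (m : ℂ[X]) (M N : Mat) : ⁅m • M, N⁆ = m • ⁅M, N⁆ := by
  simp [Ring.lie_def, smul_sub]

theorem lie_X₂_X₁ : ⁅X₂, X₁⁆ = perMat 0 := by
  ext i j : 1
  fin_cases i <;> fin_cases j <;>
    simp [Ring.lie_def, perMat, X₁, X₂]

theorem lie_X₂_perMat_zero : ⁅X₂, perMat 0⁆ = perMat 1 := by
  ext i j : 1
  fin_cases i <;> fin_cases j <;>
    simp [Ring.lie_def, perMat, X₂]
  ring

theorem lie_X₂_perMat_one : ⁅X₂, perMat 1⁆ = perMat 2 := by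
  ext i j : 1
  fin_cases i <;> fin_cases j <;>
    simp [Ring.lie_def, perMat, X₂] <;> ring

theorem lie_X₂_perMat_two : ⁅X₂, perMat 2⁆ = perMat 3 := by
  ext i j : 1
  fin_cases i <;> fin_cases j <;>
    simp [Ring.lie_def, perMat, X₂]
  ring

theorem lie_X₁_perMat_two : ⁅X₁, perMat 2⁆ = perMat 4 := by
  ext i j : 1
  fin_cases i <;> fin_cases j <;>
    simp [Ring.lie_def, perMat, X₁] <;> ring

theorem lie_X₂_perMat_four : ⁅X₂, perMat 4⁆ = perMat 5 := by
  ext i j : 1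
  fin_cases i <;> fin_cases j <;>
    simp [Ring.lie_def, perMat, X₂]

theorem lie_X₁_perMat_three : ⁅X₁, perMat 3⁆ = (2 : ℂ[X]) • perMat 5 := by
  ext i j : 1
  fin_cases i <;> fin_cases j <;>
    simp [Ring.lie_def, perMat, X₁] <;> ring

theorem lie_X₁_perMat_five : ⁅X₁, perMat 5⁆ = perScale 1 • X₁ := by
  ext i j : 1
  fin_cases i <;> fin_cases j <;>
    simp [Ring.lie_def, perMat, X₁, perScale]
  ring

theorem lie_X₂_perMat_five_add_self :
    ⁅X₂, perMat 5⁆ + ⁅X₂, perMat 5⁆ = -(perScale 1 • X₂) := by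
  ext i j : 1
  fin_cases i <;> fin_cases j <;>
    simp [Ring.lie_def, perMat, X₂, perScale] <;> ring

theorem lie_perMat_five_three : ⁅perMat 5, perMat 3⁆ = perScale 1 • perMat 3 := by
  ext i j : 1
  fin_cases i <;> fin_cases j <;>
    simp [Ring.lie_def, perMat, perScale]
  ring

theorem lie_perMat_two_X₂ : ⁅perMat 2, X₂⁆ = -perMat 3 := by
  ext i j : 1
  fin_cases i <;> fin_cases j <;>
    simp [Ring.lie_def, perMat, X₂]
  ring

theorem lie_perMat_one_zero : ⁅perMat 1, perMat 0⁆ = perMat 4 := by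
  ext i j : 1
  fin_cases i <;> fin_cases j <;>
    simp [Ring.lie_def, perMat] <;> ring

theorem lie_perMat_four_five_add_self :
    ⁅perMat 4, perMat 5⁆ + ⁅perMat 4, perMat 5⁆ = perScale 1 • perMat 4 := by
  ext i j : 1
  fin_cases i <;> fin_cases j <;>
    simp [Ring.lie_def, perMat, perScale] <;> ring

theorem lie_perMat_zero_one : ⁅perMat 0, perMat 1⁆ = -perMat 4 := by
  ext i j : 1
  fin_cases i <;> fin_cases j <;>
    simp [Ring.lie_def, perMat] <;> ring

/-! ### The presentation of `𝔤` by the Serre relations -/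

section Injective

variable {L : Type*} [LieRing L] [LieAlgebra ℂ L] {e f : L} (π : L →ₗ⁅ℂ⁆ Mat)

theorem perScale_add (s t : ℕ) : perScale (s + t) = perScale s * perScale t := pow_add _ _ _

theorem map_blockQ (he : π e = X₁) (hf : π f = X₂) (s : ℕ) :
    π (blockQ e f s) = perScale s • X₁ := by
  induction s with
  | zero => simp [blockQ, perScale, he]
  | succ s ih =>
    simp only [blockQ, LieHom.map_lie, he, hf, ih, lie_smul_mat, lie_X₂_X₁, lie_X₂_perMat_zero,
      lie_X₂_perMat_one, lie_X₁_perMat_two, lie_X₂_perMat_four, lie_X₁_perMat_five]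
    rw [smul_smul, perScale_add]

theorem map_blockP (he : π e = X₁) (hf : π f = X₂) (s : ℕ) :
    π (blockP e f s) = (-(1 / 2) : ℂ) • perScale s • X₂ := by
  cases s with
  | zero => simp [blockP, perScale, hf]
  | succ s =>
    have h1 : π (blockP e f (s + 1)) = perScale s • ⁅X₂, perMat 5⁆ := by
      simp only [blockP, LieHom.map_lie, he, hf, map_blockQ π he hf, lie_smul_mat, lie_X₂_X₁,
        lie_X₂_perMat_zero, lie_X₂_perMat_one, lie_X₁_perMat_two, lie_X₂_perMat_four]
    have h2 : π (blockP e f (s + 1)) + π (blockP e f (s + 1)) = -(perScale (s + 1) • X₂) := by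
      rw [h1, ← smul_add, lie_X₂_perMat_five_add_self, smul_neg, smul_smul, perScale_add]
    have h3 : (1 / 2 : ℂ) • (π (blockP e f (s + 1)) + π (blockP e f (s + 1))) =
        π (blockP e f (s + 1)) := by module
    rw [← h3, h2]; module

theorem map_lie_blockQ (he : π e = X₁) (hf : π f = X₂) (s : ℕ) :
    π ⁅f, blockQ e f s⁆ = perScale s • perMat 0 := by
  rw [LieHom.map_lie, map_blockQ π he hf, hf, lie_smul_mat, lie_X₂_X₁]

theorem map_lie_lie_blockQ (he : π e = X₁) (hf : π f = X₂) (s : ℕ) :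
    π ⁅f, ⁅f, blockQ e f s⁆⁆ = perScale s • perMat 1 := by
  rw [LieHom.map_lie, map_lie_blockQ π he hf, hf, lie_smul_mat, lie_X₂_perMat_zero]

theorem map_lie_lie_lie_blockQ (he : π e = X₁) (hf : π f = X₂) (s : ℕ) :
    π ⁅f, ⁅f, ⁅f, blockQ e f s⁆⁆⁆ = perScale s • perMat 2 := by
  rw [LieHom.map_lie, map_lie_lie_blockQ π he hf, hf, lie_smul_mat, lie_X₂_perMat_one]

theorem map_blockR (he : π e = X₁) (hf : π f = X₂) (s : ℕ) :
    π (blockR e f s) = perScale s • perMat 3 := by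
  rw [blockR, LieHom.map_lie, map_lie_lie_lie_blockQ π he hf, hf, lie_smul_mat, lie_X₂_perMat_two]

theorem map_blockT (he : π e = X₁) (hf : π f = X₂) (s : ℕ) :
    π (blockT e f s) = perScale s • perMat 4 := by
  rw [blockT, LieHom.map_lie, map_lie_lie_lie_blockQ π he hf, he, lie_smul_mat, lie_X₁_perMat_two]

theorem map_lie_blockT (he : π e = X₁) (hf : π f = X₂) (s : ℕ) :
    π ⁅f, blockT e f s⁆ = perScale s • perMat 5 := by
  rw [LieHom.map_lie, map_blockT π he hf, hf, lie_smul_mat, lie_X₂_perMat_four]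

theorem eq_zero_of_mem_span_singleton {s : ℕ} {x y : L} {M : Mat} (hy : π y = perScale s • M)
    (hM : M ≠ 0) (hx : x ∈ Submodule.span ℂ {y}) (h0 : π x = 0) : x = 0 := by
  obtain ⟨c, rfl⟩ := Submodule.mem_span_singleton.1 hx
  rw [map_smul, hy] at h0
  rcases smul_eq_zero.1 h0 with h | h
  · rw [h, zero_smul]
  · rcases smul_eq_zero.1 h with h | h
    · exact absurd h (perScale_ne_zero s)
    · exact absurd h hM

/-- The entry in the position `(i, j)` separates `M` from `N`. -/
theorem eq_zero_of_mem_span_pair {s : ℕ} {x y z : L} {M N : Mat} (hy : π y = perScale s • M)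
    (hz : π z = perScale s • N) (i j : Fin 3) (hM : M i j ≠ 0) (hN : N i j = 0) (hN' : N ≠ 0)
    (hx : x ∈ Submodule.span ℂ {y, z}) (h0 : π x = 0) : x = 0 := by
  obtain ⟨c, d, rfl⟩ := Submodule.mem_span_pair.1 hx
  have h1 := congr_fun (congr_fun h0 i) j
  simp only [map_add, map_smul, hy, hz, Matrix.add_apply, Matrix.smul_apply, hN,
    smul_zero, add_zero, Matrix.zero_apply, smul_eq_zero, hM, perScale_ne_zero, or_false] at h1
  rw [h1, zero_smul, zero_add] at h0 ⊢
  exact eq_zero_of_mem_span_singleton π hz hN' (Submodule.mem_span_singleton.2 ⟨d, rfl⟩) h0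

theorem perMat_ne_zero (k : Fin 6) : perMat k ≠ 0 := by
  intro h
  fin_cases k
  · simpa [perMat] using congr_fun (congr_fun h 2) 0
  · simpa [perMat] using congr_fun (congr_fun h 0) 0
  · simpa [perMat] using congr_fun (congr_fun h 2) 1
  · simpa [perMat] using congr_fun (congr_fun h 0) 1
  · simpa [perMat] using congr_fun (congr_fun h 2) 0
  · simpa [perMat] using congr_fun (congr_fun h 0) 0

/-- In the fifth degree of a period, `π` separates `R` and `T`, if all imaginary relations of the
preceding periods hold. -/
theorem SerrePair.eq_zero_of_mem_degPart_five (he : π e = X₁) (hf : π f = X₂)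
    (h : SerrePair e f) {s : ℕ}
    (ht : ∀ t < s, ImagRel e f t) {x : L} (hx : x ∈ degPart e f (6 * s + 5)) (h0 : π x = 0) :
    x = 0 :=
  eq_zero_of_mem_span_pair π (map_blockR π he hf s) (map_blockT π he hf s) 0 1
    (by simp [perMat]) (by simp [perMat]) (perMat_ne_zero 4)
    ((h.degPart_le_of_one ht (h.degPart_one_le ht)).2.2.2 hx) h0

/-- A relation in the imaginary root space of degree `6 s + 6`, obtained by the method that shows
that a homogeneous two-cocycle of nonzero degree on a loop algebra is trivial. Below this degree `π`
is injective. Let `W` be the line through `[f, T s]`. Modulo `W`, the brackets `p t = [Q t, R (s -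
t)]` satisfy `p (t + 1) ≡ p t + 2 p 0`, whereas `p s ≡ -p 0`; hence `(2 s + 2) p 0 ≡ 0`, where `p 0
= [e, R s]`. -/
theorem SerrePair.imagRel_of_lt (he : π e = X₁) (hf : π f = X₂)
    (h : SerrePair e f) {s : ℕ}
    (ht : ∀ t < s, ImagRel e f t) : ImagRel e f s := by
  have inj : ∀ x ∈ degPart e f (6 * s + 5), π x = 0 → x = 0 := fun x hx h0 =>
    h.eq_zero_of_mem_degPart_five π he hf ht hx h0
  have hTm : ∀ t, blockT e f t ∈ degPart e f (6 * t + 5) := fun t =>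
    lie_left_mem_degPart (lie_right_mem_degPart (lie_right_mem_degPart
      (lie_right_mem_degPart (blockQ_mem t))))
  have hRm : ∀ t, blockR e f t ∈ degPart e f (6 * t + 5) := fun t =>
    lie_right_mem_degPart (lie_right_mem_degPart (lie_right_mem_degPart
      (lie_right_mem_degPart (blockQ_mem t))))
  set W := Submodule.span ℂ {⁅f, blockT e f s⁆} with hW
  have shift : ∀ (i j : ℕ) (x y : L) (c : ℂ), x ∈ degPart e f (i + 1) → y ∈ degPart e f (j + 1) →
      i + j + 2 = 6 * s + 5 → π ⁅x, y⁆ = c • perScale s • perMat 4 →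
      ⁅⁅f, x⁆, y⁆ + ⁅x, ⁅f, y⁆⁆ ∈ W := by
    intro i j x y c hx hy hij hxy
    have h1 := lie_mem_degPart hx hy
    rw [hij] at h1
    have h2 := inj _ (sub_mem h1 (Submodule.smul_mem _ c (hTm s))) (by
      rw [map_sub, map_smul, hxy, map_blockT π he hf, sub_self])
    rw [← leibniz_lie, sub_eq_zero.1 h2, lie_smul]
    exact Submodule.smul_mem _ _ (Submodule.subset_span rfl)
  -- the relation between `[T t, P u]` and `[Q t, R u]`
  have hq : ∀ t u, t + u = s → (2 : ℂ) • ⁅blockT e f t, blockP e f u⁆ -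
      (⁅e, blockR e f s⁆ + ⁅blockQ e f t, blockR e f u⁆) ∈ W := by
    intro t u htu
    have bu := h.blockTable (s := u) fun k hk => ht k (by omega)
    set q₂ := ⁅f, blockQ e f t⁆ with hq₂
    set q₃ := ⁅f, q₂⁆ with hq₃
    set q₄ := ⁅f, q₃⁆ with hq₄
    set r₂ := ⁅f, blockQ e f u⁆ with hr₂
    set r₃ := ⁅f, r₂⁆ with hr₃
    set r₄ := ⁅f, r₃⁆ with hr₄
    have m₂ : q₂ ∈ degPart e f (6 * t + 2) := lie_right_mem_degPart (blockQ_mem t)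
    have m₃ : q₃ ∈ degPart e f (6 * t + 3) := lie_right_mem_degPart m₂
    have m₄ : q₄ ∈ degPart e f (6 * t + 4) := lie_right_mem_degPart m₃
    have n₂ : r₂ ∈ degPart e f (6 * u + 2) := lie_right_mem_degPart (blockQ_mem u)
    have n₃ : r₃ ∈ degPart e f (6 * u + 3) := lie_right_mem_degPart n₂
    have n₄ : r₄ ∈ degPart e f (6 * u + 4) := lie_right_mem_degPart n₃
    have scale : perScale u * perScale t = perScale s := by
      rw [← perScale_add, add_comm, htu]
    have w₁ : ⁅q₄, r₂⁆ + ⁅q₃, r₃⁆ ∈ W := by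
      refine shift _ _ q₃ r₂ 1 m₃ n₂ (by omega) ?_
      rw [LieHom.map_lie, map_lie_lie_blockQ π he hf, map_lie_blockQ π he hf, lie_smul_mat,
        smul_lie_mat, lie_perMat_one_zero, smul_smul, scale, one_smul]
    have w₂ : ⁅q₃, r₃⁆ + ⁅q₂, r₄⁆ ∈ W := by
      refine shift _ _ q₂ r₃ (-1) m₂ n₃ (by omega) ?_
      rw [LieHom.map_lie, map_lie_lie_blockQ π he hf, map_lie_blockQ π he hf, lie_smul_mat,
        smul_lie_mat, lie_perMat_zero_one, smul_smul, scale, smul_neg, neg_one_smul]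
    have w₃ : ⁅q₂, r₄⁆ + ⁅blockQ e f t, blockR e f u⁆ ∈ W := by
      refine shift _ _ (blockQ e f t) r₄ 1 (blockQ_mem t) n₄ (by omega) ?_
      rw [LieHom.map_lie, map_lie_lie_lie_blockQ π he hf, map_blockQ π he hf, lie_smul_mat,
        smul_lie_mat, lie_X₁_perMat_two, smul_smul, scale, one_smul]
    have hR : (2 : ℂ) • ⁅q₄, blockP e f u⁆ = blockR e f s := by
      have h1 := lie_mem_degPart m₄ (blockP_mem (e := e) (f := f) u)
      have h2 : 6 * t + 3 + 6 * u + 2 = 6 * s + 5 := by omega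
      rw [h2] at h1
      refine sub_eq_zero.1 (inj _ (sub_mem (Submodule.smul_mem _ _ h1) (hRm s)) ?_)
      rw [map_sub, map_smul, LieHom.map_lie, map_lie_lie_lie_blockQ π he hf, map_blockP π he hf,
        map_blockR π he hf, lie_smul, lie_smul_mat, smul_lie_mat, lie_perMat_two_X₂,
        smul_smul (perScale u), scale, smul_neg]
      generalize perScale s • perMat 3 = M
      module
    have hT : (2 : ℂ) • ⁅blockT e f t, blockP e f u⁆ = ⁅e, blockR e f s⁆ - ⁅q₄, r₂⁆ := by
      have h1 : ⁅blockT e f t, blockP e f u⁆ = ⁅⁅e, q₄⁆, blockP e f u⁆ := rfl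
      rw [h1, lie_lie, bu.eP, smul_sub, ← lie_smul, hR, ← hr₂, lie_smul]
      module
    rw [hT]
    have h3 := sub_mem (sub_mem w₂ w₁) w₃
    convert h3 using 1
    abel
  have hp : ∀ t u, t + u = s →
      ⁅blockQ e f t, blockR e f u⁆ - (1 + 2 * t : ℂ) • ⁅e, blockR e f s⁆ ∈ W := by
    intro t
    induction t with
    | zero =>
      intro u hu
      rw [zero_add] at hu
      simp [hu, blockQ]
    | succ t ih =>
      intro u hu
      have i₁ := ih (u + 1) (by omega)
      have i₂ := hq t (u + 1) (by omega)
      have scale : perScale u * perScale t * perScale 1 = perScale s := by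
        rw [← perScale_add, ← perScale_add, ← hu]; congr 1; omega
      have m₆ : ⁅f, blockT e f t⁆ ∈ degPart e f (6 * t + 6) := lie_right_mem_degPart (hTm t)
      have n₆ : ⁅f, blockT e f u⁆ ∈ degPart e f (6 * u + 6) := lie_right_mem_degPart (hTm u)
      have w : ⁅⁅f, blockT e f t⁆, ⁅f, blockT e f u⁆⁆ + ⁅blockT e f t, blockP e f (u + 1)⁆ ∈ W := by
        refine shift _ _ (blockT e f t) ⁅f, blockT e f u⁆ (1 / 2) (hTm t) n₆ (by omega) ?_
        have h1 : ⁅perMat 4, perMat 5⁆ = (1 / 2 : ℂ) • perScale 1 • perMat 4 := by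
          rw [← lie_perMat_four_five_add_self]; module
        rw [LieHom.map_lie, map_lie_blockT π he hf, map_blockT π he hf, lie_smul_mat,
          smul_lie_mat, h1, ← scale, smul_comm, smul_comm, mul_smul, mul_smul]
        rw [smul_comm (perScale t), smul_comm (perScale u)]
      have hR : ⁅⁅f, blockT e f t⁆, blockR e f u⁆ = blockR e f s := by
        have h1 := lie_mem_degPart m₆ (hRm u)
        have h2 : 6 * t + 5 + (6 * u + 4) + 2 = 6 * s + 5 := by omega
        rw [h2] at h1
        refine sub_eq_zero.1 (inj _ (sub_mem h1 (hRm s)) ?_)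
        rw [map_sub, LieHom.map_lie, map_lie_blockT π he hf, map_blockR π he hf,
          map_blockR π he hf, lie_smul_mat, smul_lie_mat, lie_perMat_five_three, smul_smul,
          smul_smul, scale, sub_self]
      have hQ : ⁅blockQ e f (t + 1), blockR e f u⁆ =
          ⁅e, blockR e f s⁆ - (2 : ℂ) • ⁅⁅f, blockT e f t⁆, ⁅f, blockT e f u⁆⁆ := by
        have h1 : blockQ e f (t + 1) = ⁅e, ⁅f, blockT e f t⁆⁆ := rfl
        rw [h1, lie_lie, hR, ht u (by omega), lie_smul]
      rw [hQ]
      have h3 := add_mem (add_mem i₁ i₂) (Submodule.smul_mem W (-2 : ℂ) w)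
      convert h3 using 1
      push_cast
      module
  have hz : ⁅e, blockR e f s⁆ ∈ W := by
    have h1 := hq s 0 (by omega)
    have h2 := hp s 0 (by omega)
    have h3 : (2 : ℂ) • ⁅blockT e f s, blockP e f 0⁆ = ⁅f, blockT e f s⁆ := by
      rw [blockP, lie_smul, ← lie_skew]; module
    rw [h3] at h1
    have h4 : ⁅f, blockT e f s⁆ ∈ W := Submodule.subset_span rfl
    have h5 : (2 + 2 * s : ℂ) • ⁅e, blockR e f s⁆ ∈ W := by
      have h6 := sub_mem (sub_mem h4 h1) h2
      convert h6 using 1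
      module
    have h6 : (2 + 2 * s : ℂ) ≠ 0 := by
      have : ((2 + 2 * s : ℕ) : ℂ) ≠ 0 := Nat.cast_ne_zero.2 (by omega)
      exact_mod_cast this
    exact (Submodule.smul_mem_iff _ h6).1 h5
  obtain ⟨c, hc⟩ := Submodule.mem_span_singleton.1 hz
  have h1 := congr_arg π hc
  have h2 : (perScale s • perMat 5) ≠ 0 :=
    smul_ne_zero (perScale_ne_zero s) (perMat_ne_zero 5)
  rw [map_smul, map_lie_blockT π he hf, LieHom.map_lie, he, map_blockR π he hf, lie_smul_mat,
    lie_X₁_perMat_three, smul_comm (perScale s), ← sub_eq_zero, two_smul ℂ[X]] at h1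
  have h3 : (c - 2) • perScale s • perMat 5 = 0 := by
    rw [← h1]; generalize perScale s • perMat 5 = M; module
  have h4 : c = 2 := by
    rcases smul_eq_zero.1 h3 with h | h
    · exact sub_eq_zero.1 h
    · exact absurd h h2
  rw [ImagRel, ← hc, h4]

theorem SerrePair.imagRel (he : π e = X₁) (hf : π f = X₂) (h : SerrePair e f) (s : ℕ) :
    ImagRel e f s := by
  induction s using Nat.strong_induction_on with
  | _ s ih => exact h.imagRel_of_lt π he hf ih

/-- `M` is homogeneous of degree `h` in the principal grading, for which `λ` has degree `3` and
`E_{ij}` has the degree `εᵢ - εⱼ`, where `ε = (1, -1, 0)`. -/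
def IsPrincipal (h : ℤ) (M : Mat) : Prop :=
  ∀ i j a, (M i j).coeff a ≠ 0 → 3 * (a : ℤ) + (![1, -1, 0] : Fin 3 → ℤ) i -
    (![1, -1, 0] : Fin 3 → ℤ) j = h

theorem IsPrincipal.add {h : ℤ} {M N : Mat} (hM : IsPrincipal h M) (hN : IsPrincipal h N) :
    IsPrincipal h (M + N) := by
  intro i j a ha
  rw [Matrix.add_apply, Polynomial.coeff_add] at ha
  by_cases h0 : (M i j).coeff a = 0
  · rw [h0, zero_add] at ha; exact hN i j a ha
  · exact hM i j a h0

theorem IsPrincipal.smul {h : ℤ} {M : Mat} (hM : IsPrincipal h M) (c : ℂ) :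
    IsPrincipal h (c • M) := by
  intro i j a ha
  rw [Matrix.smul_apply, Polynomial.coeff_smul] at ha
  exact hM i j a (right_ne_zero_of_smul ha)

theorem IsPrincipal.mul {h k : ℤ} {M N : Mat} (hM : IsPrincipal h M) (hN : IsPrincipal k N) :
    IsPrincipal (h + k) (M * N) := by
  intro i j a ha
  rw [Matrix.mul_apply, Polynomial.finsetSum_coeff] at ha
  obtain ⟨l, -, hl⟩ := Finset.exists_ne_zero_of_sum_ne_zero ha
  rw [Polynomial.coeff_mul] at hl
  obtain ⟨⟨b, c⟩, hbc, hl⟩ := Finset.exists_ne_zero_of_sum_ne_zero hl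
  have hbc := Finset.HasAntidiagonal.mem_antidiagonal.1 hbc
  have h1 := hM i l b (left_ne_zero_of_mul hl)
  have h2 := hN l j c (right_ne_zero_of_mul hl)
  have h3 : (b : ℤ) + c = a := by exact_mod_cast hbc
  linarith

theorem IsPrincipal.lie {h k : ℤ} {M N : Mat} (hM : IsPrincipal h M) (hN : IsPrincipal k N) :
    IsPrincipal (h + k) ⁅M, N⁆ := by
  have h1 := (hM.mul hN).add (((add_comm k h) ▸ hN.mul hM).smul (-1))
  rwa [neg_one_smul, ← sub_eq_add_neg] at h1

theorem isPrincipal_X₁ : IsPrincipal 1 X₁ := by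
  intro i j a ha
  fin_cases i <;> fin_cases j <;> simp [X₁, Polynomial.coeff_X] at ha ⊢
  simp [← ha]

theorem isPrincipal_X₂ : IsPrincipal 1 X₂ := by
  intro i j a ha
  fin_cases i <;> fin_cases j <;> simp [X₂, Polynomial.coeff_one] at ha ⊢
  · simp [ha]
  · simp [ha]

/-- `π` takes the part of principal degree `h` to homogeneous matrices of degree `h`, so that the
images of parts of different degree have no monomials in common. -/
theorem isPrincipal_map (he : π e = X₁) (hf : π f = X₂) (h : ℕ) :
    ∀ x ∈ degPart e f h, IsPrincipal h (π x) := by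
  have zero : ∀ k : ℤ, IsPrincipal k (0 : Mat) := fun k i j a ha => by simp at ha
  induction h with
  | zero =>
    intro x hx
    rw [(Submodule.mem_bot ℂ).1 hx, map_zero]
    exact zero _
  | succ h ih =>
    cases h with
    | zero =>
      intro x hx
      obtain ⟨a, b, rfl⟩ := Submodule.mem_span_pair.1 hx
      rw [map_add, map_smul, map_smul, he, hf]
      exact (isPrincipal_X₁.smul a).add (isPrincipal_X₂.smul b)
    | succ h =>
      intro x hx
      obtain ⟨_, ⟨a, ha, rfl⟩, _, ⟨b, hb, rfl⟩, rfl⟩ := Submodule.mem_sup.1 hx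
      have h1 : ((h + 1 + 1 : ℕ) : ℤ) = 1 + (h + 1 : ℕ) := by push_cast; ring
      rw [map_add, h1]
      refine IsPrincipal.add ?_ ?_
      · change IsPrincipal _ (π ⁅e, a⁆)
        rw [LieHom.map_lie, he]
        exact isPrincipal_X₁.lie (ih a ha)
      · change IsPrincipal _ (π ⁅f, b⁆)
        rw [LieHom.map_lie, hf]
        exact isPrincipal_X₂.lie (ih b hb)

theorem SerrePair.eq_zero_of_mem_degPart (he : π e = X₁) (hf : π f = X₂) (h : SerrePair e f)
    {k : ℕ} {x : L} (hx : x ∈ degPart e f k) (h0 : π x = 0) : x = 0 := by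
  rcases Nat.eq_zero_or_pos k with rfl | hk
  · exact (Submodule.mem_bot ℂ).1 hx
  obtain ⟨s, i, hi, rfl⟩ : ∃ s i, i < 6 ∧ k = 6 * s + i + 1 :=
    ⟨(k - 1) / 6, (k - 1) % 6, Nat.mod_lt _ (by norm_num), by omega⟩
  have ht : ∀ t, ImagRel e f t := h.imagRel π he hf
  have h1 := h.degPart_one_le (s := s) fun t _ => ht t
  obtain ⟨h2, h3, h4, h5⟩ := h.degPart_le_of_one (s := s) (fun t _ => ht t) h1
  interval_cases i
  · refine eq_zero_of_mem_span_pair π (s := s) (M := (-(1 / 2) : ℂ) • X₂) ?_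
      (map_blockQ π he hf s) 0 2 (by simp [X₂]) (by simp [X₁]) ?_ (h1 hx) h0
    · rw [map_blockP π he hf, smul_comm]
    · intro h
      simpa [X₁] using congr_fun (congr_fun h 1) 0
  · exact eq_zero_of_mem_span_singleton π (map_lie_blockQ π he hf s) (perMat_ne_zero 0) (h2 hx) h0
  · exact eq_zero_of_mem_span_singleton π (map_lie_lie_blockQ π he hf s) (perMat_ne_zero 1)
      (h3 hx) h0
  · exact eq_zero_of_mem_span_singleton π (map_lie_lie_lie_blockQ π he hf s) (perMat_ne_zero 2)
      (h4 hx) h0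
  · exact h.eq_zero_of_mem_degPart_five π he hf (fun t _ => ht t) hx h0
  · exact eq_zero_of_mem_span_singleton π (map_lie_blockT π he hf s) (perMat_ne_zero 5)
      (h.degPart_six_le (fun t _ => ht t) h1 hx) h0

/-- The algebra generated by `X₁` and `X₂` is presented by the Serre relations: a Lie algebra
generated by two elements subject to these relations maps to it injectively. -/
theorem SerrePair.eq_zero_of_map_eq_zero (he : π e = X₁) (hf : π f = X₂) (h : SerrePair e f) {x : L}
    (hx : x ∈ LieSubalgebra.lieSpan ℂ L {e, f}) (h0 : π x = 0) : x = 0 := by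
  obtain ⟨g, hg, rfl⟩ := (Submodule.mem_iSup_iff_exists_finsupp _ _).1
    (lieSpan_le_iSup_degPart e f hx)
  refine Finset.sum_eq_zero fun k _ => h.eq_zero_of_mem_degPart π he hf (hg k) ?_
  ext i j a
  by_contra hne
  have h1 := congr_arg (fun M : Mat => (M i j).coeff a) h0
  simp only [Finsupp.sum, map_sum, Matrix.sum_apply, Polynomial.finsetSum_coeff, Matrix.zero_apply,
    Polynomial.coeff_zero] at h1
  rw [Finset.sum_eq_single k] at h1
  · exact hne (by simpa using h1)
  · intro l _ hl
    by_contra hne'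
    have h2 := isPrincipal_map π he hf k _ (hg k) i j a (by simpa using hne)
    have h3 := isPrincipal_map π he hf l _ (hg l) i j a hne'
    exact hl (by exact_mod_cast h3.symm.trans h2)
  · intro hk
    rw [Finsupp.notMem_support_iff.1 hk, map_zero]; simp

end Injective

section Universal

variable {L : Type*} [LieRing L] [LieAlgebra ℂ L]

theorem serrePair_X : SerrePair X₁ X₂ := by
  constructor
  · have h : ⁅X₁, X₂⁆ = -perMat 0 := by rw [← lie_skew, lie_X₂_X₁]
    rw [h]
    ext i j : 1
    fin_cases i <;> fin_cases j <;> simp [Ring.lie_def, perMat, X₁]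
  · rw [lie_X₂_X₁, lie_X₂_perMat_zero, lie_X₂_perMat_one, lie_X₂_perMat_two]
    ext i j : 1
    fin_cases i <;> fin_cases j <;> simp [Ring.lie_def, perMat, X₂]

theorem serrePair_x : SerrePair x₁ x₂ :=
  ⟨Subtype.ext serrePair_X.ad_sq, Subtype.ext serrePair_X.ad_pow_five⟩

theorem lieSpan_x : LieSubalgebra.lieSpan ℂ gAlg {x₁, x₂} = ⊤ := by
  have h := LieSubalgebra.lieSpan_lieSpan_coe_preimage (R := ℂ) (s := {X₁, X₂})
  have h2 : (((↑) : gAlg → Mat) ⁻¹' {X₁, X₂}) = {x₁, x₂} := by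
    ext y
    simp [x₁, x₂, Subtype.ext_iff]
  rw [← h2]; exact h

/-- The universal property of `gAlg`. -/
theorem SerrePair.exists_lieHom {e f : L} (h : SerrePair e f) :
    ∃ ψ : gAlg →ₗ⁅ℂ⁆ L, ψ x₁ = e ∧ ψ x₂ = f := by
  -- the graph of `ψ` is generated by `(e, x₁)` and `(f, x₂)`
  let p : L × gAlg := (e, x₁)
  let q : L × gAlg := (f, x₂)
  have hpq : SerrePair p q :=
    ⟨Prod.ext h.ad_sq serrePair_x.ad_sq, Prod.ext h.ad_pow_five serrePair_x.ad_pow_five⟩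
  let H := LieSubalgebra.lieSpan ℂ (L × gAlg) {p, q}
  let φ : H →ₗ⁅ℂ⁆ gAlg := (LieHom.snd ℂ L gAlg).comp H.incl
  have hp : p ∈ H := LieSubalgebra.subset_lieSpan (by simp)
  have hq : q ∈ H := LieSubalgebra.subset_lieSpan (by simp)
  have inj : Function.Injective φ := by
    rw [injective_iff_map_eq_zero]
    intro x hx
    refine Subtype.ext (hpq.eq_zero_of_map_eq_zero (gAlg.incl.comp (LieHom.snd ℂ L gAlg))
      rfl rfl x.2 ?_)
    exact congr_arg Subtype.val hx
  have surj : φ.range = ⊤ := by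
    rw [eq_top_iff, ← lieSpan_x, LieSubalgebra.lieSpan_le]
    rintro x (rfl | rfl)
    · exact ⟨⟨p, hp⟩, rfl⟩
    · exact ⟨⟨q, hq⟩, rfl⟩
  have surj' : Function.Surjective φ := fun y => by
    have : y ∈ φ.range := surj ▸ LieSubalgebra.mem_top y
    exact this
  let E : H ≃ₗ⁅ℂ⁆ gAlg := LieEquiv.ofBijective φ ⟨inj, surj'⟩
  refine ⟨((LieHom.fst ℂ L gAlg).comp H.incl).comp E.symm.toLieHom, ?_, ?_⟩
  · have h1 : E.symm x₁ = ⟨p, hp⟩ := by rw [LieEquiv.symm_apply_eq]; rfl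
    change (E.symm x₁ : L × gAlg).1 = e
    rw [h1]
  · have h1 : E.symm x₂ = ⟨q, hq⟩ := by rw [LieEquiv.symm_apply_eq]; rfl
    change (E.symm x₂ : L × gAlg).1 = f
    rw [h1]

theorem lieHom_gAlg_ext {φ ψ : gAlg →ₗ⁅ℂ⁆ L} (h₁ : φ x₁ = ψ x₁) (h₂ : φ x₂ = ψ x₂) : φ = ψ := by
  ext y
  have hy : y ∈ LieSubalgebra.lieSpan ℂ gAlg {x₁, x₂} := lieSpan_x ▸ LieSubalgebra.mem_top y
  induction hy using LieSubalgebra.lieSpan_induction with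
  | mem y hy => rcases hy with rfl | rfl <;> assumption
  | zero => simp
  | smul c y _ hy => simp [hy]
  | add y z _ _ hy hz => simp [hy, hz]
  | lie y z _ _ hy hz => simp [hy, hz]

end Universal

/-! ### Quotients of Lie algebras -/

section Quotient

variable {L L' : Type*} [LieRing L] [LieAlgebra ℂ L] [LieRing L'] [LieAlgebra ℂ L']

/-- The quotient map modulo an ideal. -/
def idealMk (I : LieIdeal ℂ L) : L →ₗ⁅ℂ⁆ L ⧸ I :=
  { (I : Submodule ℂ L).mkQ with map_lie' := fun {_ _} => rfl }

theorem idealMk_surjective (I : LieIdeal ℂ L) : Function.Surjective (idealMk I) :=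
  Submodule.mkQ_surjective _

theorem idealMk_eq_zero {I : LieIdeal ℂ L} {x : L} : idealMk I x = 0 ↔ x ∈ I :=
  Submodule.Quotient.mk_eq_zero _

/-- The homomorphism from the quotient modulo an ideal that is induced by a homomorphism vanishing
on the ideal. -/
def idealLift (I : LieIdeal ℂ L) (φ : L →ₗ⁅ℂ⁆ L') (h : ∀ x ∈ I, φ x = 0) : L ⧸ I →ₗ⁅ℂ⁆ L' :=
  { (I : Submodule ℂ L).liftQ (φ : L →ₗ[ℂ] L') h with
    map_lie' := by
      intro x y
      obtain ⟨x, rfl⟩ := idealMk_surjective I x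
      obtain ⟨y, rfl⟩ := idealMk_surjective I y
      exact φ.map_lie x y }

theorem lieSpan_le_ker (φ : L →ₗ⁅ℂ⁆ L') {s : Set L} (h : ∀ x ∈ s, φ x = 0) :
    ∀ x ∈ (LieSubmodule.lieSpan ℂ L s : LieIdeal ℂ L), φ x = 0 := by
  have h1 : (LieSubmodule.lieSpan ℂ L s : LieIdeal ℂ L) ≤ φ.ker :=
    LieSubmodule.lieSpan_le.2 fun x hx => LieHom.mem_ker.2 (h x hx)
  exact fun x hx => LieHom.mem_ker.1 (h1 hx)

end Quotient

/-! ### The positive part of the affine algebra -/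

section Affine

open CartanMatrix

/-- The quotient map from the free Lie algebra onto the affine Lie algebra. -/
def affineMk : FreeLieAlgebra ℂ (Generators (Fin 2)) →ₗ⁅ℂ⁆ Matrix.ToLieAlgebra ℂ cartanA22 :=
  idealMk (Relations.toIdeal ℂ cartanA22)

theorem affineMk_eq_zero {a : FreeLieAlgebra ℂ (Generators (Fin 2))}
    (ha : a ∈ Relations.toSet ℂ cartanA22) : affineMk a = 0 :=
  idealMk_eq_zero.2 (LieSubmodule.subset_lieSpan ha)

theorem serrePair_chevalleyE : SerrePair (chevalleyE 0) (chevalleyE 1) := by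
  let E : Fin 2 → FreeLieAlgebra ℂ (Generators (Fin 2)) := fun i =>
    FreeLieAlgebra.of ℂ (Generators.E i)
  constructor
  · have h := affineMk_eq_zero (a := Relations.adE ℂ cartanA22 (0, 1)) (by
      simp [Relations.toSet])
    have h1 : Relations.adE ℂ cartanA22 (0, 1) = ⁅E 0, ⁅E 0, E 1⁆⁆ := by
      simp [Relations.adE, cartanA22, E]
    rwa [h1, LieHom.map_lie, LieHom.map_lie] at h
  · have h := affineMk_eq_zero (a := Relations.adE ℂ cartanA22 (1, 0)) (by
      simp [Relations.toSet])
    have h1 : Relations.adE ℂ cartanA22 (1, 0) =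
        ⁅E 1, ⁅E 1, ⁅E 1, ⁅E 1, ⁅E 1, E 0⁆⁆⁆⁆⁆ := by
      simp [Relations.adE, cartanA22, pow_succ, E]
    rwa [h1, LieHom.map_lie, LieHom.map_lie, LieHom.map_lie, LieHom.map_lie, LieHom.map_lie] at h

local notation "K" => FractionRing ℂ[X]

/-- The entries of the matrices are extended to rational functions of `λ`, so that the negative
Chevalley generators can be represented, too. -/
def matToFrac : Matrix (Fin 3) (Fin 3) ℂ[X] →ₗ⁅ℂ⁆ Matrix (Fin 3) (Fin 3) K :=
  AlgHom.toLieHom (IsScalarTower.toAlgHom ℂ ℂ[X] K).mapMatrix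

theorem matToFrac_injective : Function.Injective matToFrac := by
  intro M N h
  ext1 i j
  exact IsFractionRing.injective ℂ[X] K (congr_fun (congr_fun h i) j)

/-- The images of the Chevalley generators in the loop algebra. -/
def loopGen : Generators (Fin 2) → Matrix (Fin 3) (Fin 3) K
  | .H 0 => !![-1, 0, 0; 0, 1, 0; 0, 0, 0]
  | .H 1 => !![2, 0, 0; 0, -2, 0; 0, 0, 0]
  | .E 0 => matToFrac X₁
  | .E 1 => matToFrac X₂
  | .F 0 => !![0, (algebraMap ℂ[X] K Polynomial.X)⁻¹, 0; 0, 0, 0; 0, 0, 0]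
  | .F 1 => !![0, 0, 0; 0, 0, 2; 2, 0, 0]

theorem matToFrac_X₁ :
    matToFrac X₁ = !![0, 0, 0; algebraMap ℂ[X] K Polynomial.X, 0, 0; 0, 0, 0] := by
  ext i j
  fin_cases i <;> fin_cases j <;> simp [matToFrac, X₁]

theorem matToFrac_X₂ : matToFrac X₂ = !![0, 0, 1; 0, 0, 0; 0, 1, 0] := by
  ext i j
  fin_cases i <;> fin_cases j <;> simp [matToFrac, X₂]

theorem lie_loopGen_F : ⁅loopGen (.F 0), ⁅loopGen (.F 0), loopGen (.F 1)⁆⁆ = 0 := by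
  ext i j : 1
  fin_cases i <;> fin_cases j <;> simp [loopGen, Ring.lie_def]

/-- The brackets are computed one after the other, with `x` in place of `λ⁻¹`. -/
theorem lie_five_loopGen_F : ⁅loopGen (.F 1), ⁅loopGen (.F 1), ⁅loopGen (.F 1),
    ⁅loopGen (.F 1), ⁅loopGen (.F 1), loopGen (.F 0)⁆⁆⁆⁆⁆ = 0 := by
  simp only [loopGen]
  generalize (algebraMap ℂ[X] K Polynomial.X)⁻¹ = x
  set f : Matrix (Fin 3) (Fin 3) K := !![0, 0, 0; 0, 0, 2; 2, 0, 0] with hf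
  have h1 : ⁅f, !![0, x, 0; 0, 0, 0; 0, 0, 0]⁆ = !![0, 0, -2 * x; 0, 0, 0; 0, 2 * x, 0] := by
    ext i j : 1
    fin_cases i <;> fin_cases j <;> simp [hf, Ring.lie_def]
    ring
  have h2 : ⁅f, !![0, 0, -2 * x; 0, 0, 0; 0, 2 * x, 0]⁆ =
      !![4 * x, 0, 0; 0, 4 * x, 0; 0, 0, -8 * x] := by
    ext i j : 1
    fin_cases i <;> fin_cases j <;> simp [hf, Ring.lie_def] <;> ring
  have h3 : ⁅f, !![4 * x, 0, 0; 0, 4 * x, 0; 0, 0, -8 * x]⁆ =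
      !![0, 0, 0; 0, 0, -24 * x; 24 * x, 0, 0] := by
    ext i j : 1
    fin_cases i <;> fin_cases j <;> simp [hf, Ring.lie_def] <;> ring
  have h4 : ⁅f, !![0, 0, 0; 0, 0, -24 * x; 24 * x, 0, 0]⁆ =
      !![0, 0, 0; 96 * x, 0, 0; 0, 0, 0] := by
    ext i j : 1
    fin_cases i <;> fin_cases j <;> simp [hf, Ring.lie_def]
    ring
  rw [h1, h2, h3, h4]
  ext i j : 1
  fin_cases i <;> fin_cases j <;> simp [hf, Ring.lie_def]

theorem lift_loopGen_eq_zero :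
    ∀ a ∈ Relations.toSet ℂ cartanA22, FreeLieAlgebra.lift ℂ loopGen a = 0 := by
  have hX : algebraMap ℂ[X] K Polynomial.X ≠ 0 :=
    (map_ne_zero_iff _ (IsFractionRing.injective ℂ[X] K)).2 Polynomial.X_ne_zero
  have hE : SerrePair (loopGen (.E 0)) (loopGen (.E 1)) := by
    constructor
    · simp only [loopGen, ← LieHom.map_lie, serrePair_X.ad_sq, map_zero]
    · simp only [loopGen, ← LieHom.map_lie, serrePair_X.ad_pow_five, map_zero]
  rintro a (((((⟨⟨i, j⟩, rfl⟩ | ⟨⟨i, j⟩, rfl⟩) | ⟨⟨i, j⟩, rfl⟩) | ⟨⟨i, j⟩, rfl⟩) | ⟨⟨i, j⟩, rfl⟩) |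
    ⟨⟨i, j⟩, rfl⟩)
  · fin_cases i <;> fin_cases j <;> simp [Relations.HH, loopGen, Ring.lie_def]
  · fin_cases i <;> fin_cases j <;>
      simp [Relations.EF, loopGen, matToFrac_X₁, matToFrac_X₂, Ring.lie_def] <;>
      ext k l <;> fin_cases k <;> fin_cases l <;> simp [Algebra.smul_def, hX]
  · fin_cases i <;> fin_cases j <;>
      simp [Relations.HE, loopGen, matToFrac_X₁, matToFrac_X₂, cartanA22, Ring.lie_def] <;>
      ext k l <;> fin_cases k <;> fin_cases l <;> simp [Algebra.smul_def] <;> ring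
  · fin_cases i <;> fin_cases j <;>
      simp [Relations.HF, loopGen, cartanA22, Ring.lie_def] <;>
      ext k l <;> fin_cases k <;> fin_cases l <;> simp <;> ring
  · fin_cases i <;> fin_cases j
    · simp [Relations.adE, cartanA22]
    · simpa [Relations.adE, cartanA22] using hE.ad_sq
    · simpa [Relations.adE, cartanA22, pow_succ] using hE.ad_pow_five
    · simp [Relations.adE, cartanA22]
  · fin_cases i <;> fin_cases j
    · simp [Relations.adF, cartanA22]
    · simpa [Relations.adF, cartanA22] using lie_loopGen_F
    · simpa [Relations.adF, cartanA22, pow_succ] using lie_five_loopGen_F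
    · simp [Relations.adF, cartanA22]

/-- The representation of the affine algebra by matrices over the rational functions of `λ`. -/
def affineToLoop : Matrix.ToLieAlgebra ℂ cartanA22 →ₗ⁅ℂ⁆ Matrix (Fin 3) (Fin 3) K :=
  idealLift (Relations.toIdeal ℂ cartanA22) (FreeLieAlgebra.lift ℂ loopGen)
    (lieSpan_le_ker _ lift_loopGen_eq_zero)

theorem affineToLoop_chevalleyE (i : Fin 2) :
    affineToLoop (chevalleyE i) = loopGen (.E i) := by
  have h : affineToLoop (chevalleyE i) = FreeLieAlgebra.lift ℂ loopGen (.of ℂ (.E i)) := rfl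
  rw [h, FreeLieAlgebra.lift_of_apply]

/-- The universal property of `𝔤` gives a homomorphism onto the positive part. It is injective, as
its composition with the representation of the affine algebra by matrices is the inclusion of `𝔤`.
-/
theorem exists_posA22_equiv :
    ∃ e : posA22 ≃ₗ⁅ℂ⁆ gAlg, e (posE 0) = x₁ ∧ e (posE 1) = x₂ := by
  have hS : SerrePair (posE 0) (posE 1) :=
    ⟨Subtype.ext serrePair_chevalleyE.ad_sq, Subtype.ext serrePair_chevalleyE.ad_pow_five⟩
  obtain ⟨ψ, h₁, h₂⟩ := hS.exists_lieHom
  have inj : Function.Injective ψ := by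
    have h : (affineToLoop.comp posA22.incl).comp ψ = matToFrac.comp gAlg.incl := by
      refine lieHom_gAlg_ext ?_ ?_
      · change affineToLoop (ψ x₁ : posA22) = matToFrac X₁
        rw [h₁]
        exact affineToLoop_chevalleyE 0
      · change affineToLoop (ψ x₂ : posA22) = matToFrac X₂
        rw [h₂]
        exact affineToLoop_chevalleyE 1
    have h' : Function.Injective ((affineToLoop.comp posA22.incl).comp ψ) := by
      rw [h]
      exact matToFrac_injective.comp Subtype.val_injective
    intro x y hxy
    exact h' (congr_arg (affineToLoop.comp posA22.incl) hxy)
  have surj : Function.Surjective ψ := by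
    have h : ψ.range = ⊤ := by
      have h1 := LieSubalgebra.lieSpan_lieSpan_coe_preimage (R := ℂ) (s := Set.range chevalleyE)
      refine eq_top_iff.2 (h1.ge.trans (LieSubalgebra.lieSpan_le.2 ?_))
      rintro ⟨_, hy⟩ ⟨i, rfl⟩
      fin_cases i
      · exact ⟨x₁, h₁⟩
      · exact ⟨x₂, h₂⟩
    intro y
    have : y ∈ ψ.range := h ▸ LieSubalgebra.mem_top y
    exact this
  refine ⟨(LieEquiv.ofBijective ψ ⟨inj, surj⟩).symm, ?_, ?_⟩
  · rw [LieEquiv.symm_apply_eq]; exact h₁.symm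
  · rw [LieEquiv.symm_apply_eq]; exact h₂.symm

end Affine

/-! ### Weakly analytic functions with values in a vector space without topology -/

section Weak

variable {n : ℕ} {V : Type*} [AddCommGroup V] [Module ℂ V]

theorem separating_dual {x : V} (h : ∀ l : V →ₗ[ℂ] ℂ, l x = 0) : x = 0 :=
  (Module.forall_dual_apply_eq_zero_iff ℂ x).1 h

/-- A function on a compact set that is continuous with respect to all linear functionals, bounded
or not, has values in a subspace of finite dimension: otherwise some functional is unbounded on a
sequence of linearly independent values. -/
theorem finiteDimensional_span_image {X : Type*} [TopologicalSpace X] {K : Set X} (hK : IsCompact K)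
    {f : X → V} (hf : ∀ l : V →ₗ[ℂ] ℂ, ContinuousOn (fun x => l (f x)) K) :
    FiniteDimensional ℂ (Submodule.span ℂ (f '' K)) := by
  obtain ⟨b, hb, hspan, hli⟩ := exists_linearIndependent ℂ (f '' K)
  rw [← hspan]
  suffices hfin : b.Finite from FiniteDimensional.span_of_finite ℂ hfin
  by_contra hinf
  have : Infinite b := Set.infinite_coe_iff.2 hinf
  let φ : ℕ ↪ b := Infinite.natEmbedding b
  have hli' : LinearIndepOn ℂ id b := hli
  let B := Module.Basis.extend hli'
  let l : V →ₗ[ℂ] ℂ := B.constr ℂ fun y => ((Function.invFun (fun k => (φ k : V)) (y : V) : ℕ) : ℂ)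
  have hl : ∀ k : ℕ, l (φ k) = k := by
    intro k
    have hmem : (φ k : V) ∈ hli'.extend (Set.subset_univ b) := hli'.subset_extend _ (φ k).2
    have h1 : (φ k : V) = B ⟨φ k, hmem⟩ := by rw [Module.Basis.extend_apply_self]
    rw [h1, Module.Basis.constr_basis]
    have hinj : Function.Injective fun k => (φ k : V) := Subtype.val_injective.comp φ.injective
    have h2 := Function.leftInverse_invFun hinj k
    simpa using h2
  obtain ⟨C, hC⟩ := hK.exists_bound_of_continuousOn (hf l)
  obtain ⟨k, hk⟩ := exists_nat_gt C
  obtain ⟨x, hx, hxk⟩ := hb (φ k).2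
  have h1 := hC x hx
  rw [hxk, hl] at h1
  simp at h1
  linarith

/-- All linear functionals take the function `f` to analytic functions. -/
def WAnalytic (Ω : Set (Fin n → ℂ)) (f : (Fin n → ℂ) → V) : Prop :=
  ∀ l : V →ₗ[ℂ] ℂ, AnalyticOnNhd ℂ (fun z => l (f z)) Ω

/-- The function `f'` is the partial derivative of `f` with respect to the `j`-th variable in the
sense that this is so after application of any linear functional. -/
def HasWD (Ω : Set (Fin n → ℂ)) (j : Fin n) (f f' : (Fin n → ℂ) → V) : Prop :=
  ∀ l : V →ₗ[ℂ] ℂ, ∀ z ∈ Ω, HasDerivAt (fun s => l (f (Function.update z j s))) (l (f' z)) (z j)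

variable {Ω : Set (Fin n → ℂ)} {i j : Fin n} {f g f' g' : (Fin n → ℂ) → V}

theorem eventually_update_mem (hΩ : IsOpen Ω) {z : Fin n → ℂ} (hz : z ∈ Ω) (j : Fin n) :
    ∀ᶠ s in nhds (z j), Function.update z j s ∈ Ω := by
  have hc : ContinuousAt (Function.update z j) (z j) := (hasDerivAt_update z j (z j)).continuousAt
  have h1 := hc.preimage_mem_nhds (t := Ω)
    (by rw [Function.update_eq_self]; exact hΩ.mem_nhds hz)
  exact h1

theorem HasWD.congr (hΩ : IsOpen Ω) (h : HasWD Ω j f f') (hfg : ∀ z ∈ Ω, f z = g z)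
    (hfg' : ∀ z ∈ Ω, f' z = g' z) : HasWD Ω j g g' := by
  intro l z hz
  rw [← hfg' z hz]
  refine (h l z hz).congr_of_eventuallyEq ?_
  filter_upwards [eventually_update_mem hΩ hz j] with s hs
  rw [hfg _ hs]

theorem HasWD.unique (h : HasWD Ω j f f') (h' : HasWD Ω j f g') : ∀ z ∈ Ω, f' z = g' z := by
  intro z hz
  refine sub_eq_zero.1 (separating_dual fun l => ?_)
  rw [map_sub, sub_eq_zero]
  exact (h l z hz).unique (h' l z hz)

theorem HasWD.eq_of_eqOn (hΩ : IsOpen Ω) (h : HasWD Ω j f f') (h' : HasWD Ω j g g')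
    (hfg : ∀ z ∈ Ω, f z = g z) : ∀ z ∈ Ω, f' z = g' z :=
  (h.congr hΩ hfg fun _ _ => rfl).unique h'

theorem HasWD.add (hf : HasWD Ω j f f') (hg : HasWD Ω j g g') :
    HasWD Ω j (fun z => f z + g z) (fun z => f' z + g' z) := fun l z hz => by
  simp only [map_add]
  exact (hf l z hz).add (hg l z hz)

theorem HasWD.sub (hf : HasWD Ω j f f') (hg : HasWD Ω j g g') :
    HasWD Ω j (fun z => f z - g z) (fun z => f' z - g' z) := fun l z hz => by
  simp only [map_sub]
  exact (hf l z hz).sub (hg l z hz)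

theorem HasWD.neg (hf : HasWD Ω j f f') : HasWD Ω j (fun z => -f z) (fun z => -f' z) :=
  fun l z hz => by simp only [map_neg]; exact (hf l z hz).neg

theorem hasWD_const (c : V) : HasWD Ω j (fun _ => c) (fun _ => 0) := fun l z _ => by
  simpa using hasDerivAt_const (z j) (l c)

theorem HasWD.const_smul (c : ℂ) (hf : HasWD Ω j f f') :
    HasWD Ω j (fun z => c • f z) (fun z => c • f' z) := fun l z hz => by
  simpa using (hf l z hz).const_mul c

/-- The function `φ'` is the partial derivative of the scalar function `φ` with respect to the
`j`-th variable. -/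
def HasPD (Ω : Set (Fin n → ℂ)) (j : Fin n) (φ φ' : (Fin n → ℂ) → ℂ) : Prop :=
  ∀ z ∈ Ω, HasDerivAt (fun s => φ (Function.update z j s)) (φ' z) (z j)

theorem HasPD.smul_wd {φ φ' : (Fin n → ℂ) → ℂ} (hφ : HasPD Ω j φ φ') (hf : HasWD Ω j f f') :
    HasWD Ω j (fun z => φ z • f z) (fun z => φ' z • f z + φ z • f' z) := fun l z hz => by
  have h := (hφ z hz).mul (hf l z hz)
  simp only [Function.update_eq_self] at h
  simp only [map_add, map_smul, smul_eq_mul]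
  exact h

theorem hasPD_apply_self (j : Fin n) : HasPD Ω j (fun z => z j) (fun _ => 1) := fun z _ => by
  simp only [Function.update_self]
  exact hasDerivAt_id (z j)

theorem hasPD_apply_of_ne (h : i ≠ j) : HasPD Ω j (fun z => z i) (fun _ => 0) := fun z _ => by
  simpa [Function.update_of_ne h] using hasDerivAt_const (z j) (z i)

theorem AnalyticAt.hasDerivAt_update {F : (Fin n → ℂ) → ℂ} {z : Fin n → ℂ} (h : AnalyticAt ℂ F z)
    (j : Fin n) :
    HasDerivAt (fun s => F (Function.update z j s)) (fderiv ℂ F z (Pi.single j 1)) (z j) := by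
  have h1 : HasFDerivAt F (fderiv ℂ F z) (Function.update z j (z j)) := by
    rw [Function.update_eq_self]; exact h.differentiableAt.hasFDerivAt
  exact h1.comp_hasDerivAt (z j) (_root_.hasDerivAt_update z j (z j))

/-- Near `z`, on the line in the direction of the `j`-th variable, the values of `f` are
combinations of finitely many fixed vectors, the coefficients being linear functionals of these
values. -/
theorem exists_local_basis (hΩ : IsOpen Ω)
    (hf : ∀ l : V →ₗ[ℂ] ℂ, ∀ z ∈ Ω, ContinuousAt (fun s => l (f (Function.update z j s))) (z j))
    {z : Fin n → ℂ} (hz : z ∈ Ω) :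
    ∃ (N : ℕ) (b : Fin N → V) (c : Fin N → V →ₗ[ℂ] ℂ),
      ∀ᶠ s in nhds (z j), f (Function.update z j s) =
        ∑ k, c k (f (Function.update z j s)) • b k := by
  obtain ⟨ε, hε, hball⟩ := Metric.nhds_basis_closedBall.eventually_iff.1
    (eventually_update_mem hΩ hz j)
  set F : ℂ → V := fun s => f (Function.update z j s) with hF
  have hcont : ∀ l : V →ₗ[ℂ] ℂ, ContinuousOn (fun s => l (F s)) (Metric.closedBall (z j) ε) := by
    intro l s hs
    have h1 := hf l _ (hball hs)
    simp only [Function.update_idem, Function.update_self] at h1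
    exact h1.continuousWithinAt
  have hfin := finiteDimensional_span_image (isCompact_closedBall (z j) ε) hcont
  set W := Submodule.span ℂ (F '' Metric.closedBall (z j) ε)
  let b := Module.finBasis ℂ W
  obtain ⟨p, hp⟩ := W.subtype.exists_leftInverse_of_injective W.ker_subtype
  refine ⟨_, fun k => (b k : V), fun k => (b.coord k) ∘ₗ p, ?_⟩
  filter_upwards [Metric.closedBall_mem_nhds (z j) hε] with s hs
  have hmem : F s ∈ W := Submodule.subset_span ⟨s, hs, rfl⟩
  have h1 : p (F s) = ⟨F s, hmem⟩ := LinearMap.congr_fun hp ⟨F s, hmem⟩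
  have h2 := congr_arg (Subtype.val : W → V) (b.sum_repr ⟨F s, hmem⟩)
  simp only [AddSubmonoidClass.coe_finsetSum, Submodule.coe_smul] at h2
  change F s = ∑ k, b.coord k (p (F s)) • (b k : V)
  rw [h1]
  exact h2.symm

theorem WAnalytic.sub (hf : WAnalytic Ω f) (hg : WAnalytic Ω g) :
    WAnalytic Ω (fun z => f z - g z) := fun l => by
  simp only [map_sub]
  exact (hf l).sub (hg l)

theorem WAnalytic.add (hf : WAnalytic Ω f) (hg : WAnalytic Ω g) :
    WAnalytic Ω (fun z => f z + g z) := fun l => by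
  simp only [map_add]
  exact (hf l).add (hg l)

theorem wAnalytic_smul {φ : (Fin n → ℂ) → ℂ} (hφ : AnalyticOnNhd ℂ φ Ω) (c : V) :
    WAnalytic Ω (fun z => φ z • c) := fun l => by
  simp only [map_smul, smul_eq_mul]
  exact hφ.mul analyticOnNhd_const

theorem WAnalytic.continuousAt_update (hf : WAnalytic Ω f) (j : Fin n) (l : V →ₗ[ℂ] ℂ) :
    ∀ z ∈ Ω, ContinuousAt (fun s => l (f (Function.update z j s))) (z j) := fun z hz =>
  (AnalyticAt.hasDerivAt_update (hf l z hz) j).continuousAt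

/-- A weakly analytic function has weak partial derivatives. They exist as elements of `V`, as the
function has values in a space of finite dimension locally on lines. -/
theorem WAnalytic.exists_hasWD (hΩ : IsOpen Ω) (hf : WAnalytic Ω f) (j : Fin n) :
    ∃ f', WAnalytic Ω f' ∧ HasWD Ω j f f' := by
  have h : ∀ z : Fin n → ℂ, ∃ y : V, z ∈ Ω →
      ∀ l : V →ₗ[ℂ] ℂ, HasDerivAt (fun s => l (f (Function.update z j s))) (l y) (z j) := by
    intro z
    by_cases hz : z ∈ Ω
    · obtain ⟨N, b, c, hb⟩ := exists_local_basis hΩ (fun l => hf.continuousAt_update j l) hz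
      refine ⟨∑ k, fderiv ℂ (fun z => c k (f z)) z (Pi.single j 1) • b k, fun _ l => ?_⟩
      have h1 : HasDerivAt (fun s => ∑ k, c k (f (Function.update z j s)) * l (b k))
          (∑ k, fderiv ℂ (fun z => c k (f z)) z (Pi.single j 1) * l (b k)) (z j) :=
        HasDerivAt.fun_sum fun k _ =>
          (AnalyticAt.hasDerivAt_update (hf (c k) z hz) j).mul_const (l (b k))
      simp only [map_sum, map_smul, smul_eq_mul]
      refine h1.congr_of_eventuallyEq ?_
      filter_upwards [hb] with s hs
      conv_lhs => rw [hs]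
      simp
    · exact ⟨0, fun h => absurd h hz⟩
  choose f' hf' using h
  refine ⟨f', fun l => ?_, fun l z hz => hf' z hz l⟩
  have h1 : AnalyticOnNhd ℂ (fun z => fderiv ℂ (fun z => l (f z)) z (Pi.single j 1)) Ω := by
    intro z hz
    exact ((ContinuousLinearMap.apply ℂ ℂ (Pi.single j 1)).analyticAt _).comp (hf l z hz).fderiv
  exact h1.congr hΩ fun z hz =>
    (AnalyticAt.hasDerivAt_update (hf l z hz) j).unique (hf' z hz l)

theorem HasWD.eq_fderiv (hf : WAnalytic Ω f) (h : HasWD Ω j f f') (l : V →ₗ[ℂ] ℂ) :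
    ∀ z ∈ Ω, l (f' z) = fderiv ℂ (fun z => l (f z)) z (Pi.single j 1) := fun z hz =>
  (h l z hz).unique (AnalyticAt.hasDerivAt_update (hf l z hz) j)

/-- Weak partial derivatives commute. -/
theorem HasWD.comm (hΩ : IsOpen Ω) (hf : WAnalytic Ω f) {fi fj g : (Fin n → ℂ) → V}
    (hi : HasWD Ω i f fi) (hj : HasWD Ω j f fj) (hij : HasWD Ω j fi g) : HasWD Ω i fj g := by
  intro l z hz
  have hz' := hf l z hz
  set F := fun z => l (f z) with hF
  have key : ∀ (a b : Fin n), HasDerivAt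
      (fun s => fderiv ℂ F (Function.update z a s) (Pi.single b 1))
      (fderiv ℂ (fderiv ℂ F) z (Pi.single a 1) (Pi.single b 1)) (z a) := by
    intro a b
    have h1 : HasFDerivAt (fderiv ℂ F) (fderiv ℂ (fderiv ℂ F) z) (Function.update z a (z a)) := by
      rw [Function.update_eq_self]; exact hz'.fderiv.differentiableAt.hasFDerivAt
    have h2 := h1.comp_hasDerivAt (z a) (_root_.hasDerivAt_update z a (z a))
    exact h2.clm_apply (hasDerivAt_const (z a) (Pi.single b 1)) |>.congr_deriv (by simp)
  have hsymm : fderiv ℂ (fderiv ℂ F) z (Pi.single i 1) (Pi.single j 1) =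
      fderiv ℂ (fderiv ℂ F) z (Pi.single j 1) (Pi.single i 1) :=
    (hz'.contDiffAt (n := 2)).isSymmSndFDerivAt (by simp) _ _
  have h1 : l (g z) = fderiv ℂ (fderiv ℂ F) z (Pi.single j 1) (Pi.single i 1) := by
    refine (hij l z hz).unique ((key j i).congr_of_eventuallyEq ?_)
    filter_upwards [eventually_update_mem hΩ hz j] with s hs
    exact hi.eq_fderiv hf l _ hs
  rw [h1, ← hsymm]
  refine (key i j).congr_of_eventuallyEq ?_
  filter_upwards [eventually_update_mem hΩ hz i] with s hs
  exact hj.eq_fderiv hf l _ hs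

/-- A weakly analytic function on a connected open set is constant if all its weak partial
derivatives vanish. -/
theorem WAnalytic.exists_eq_const (hΩ : IsOpen Ω) (hc : IsPreconnected Ω) (hf : WAnalytic Ω f)
    (h : ∀ j, HasWD Ω j f fun _ => 0) : ∃ c, ∀ z ∈ Ω, f z = c := by
  rcases Ω.eq_empty_or_nonempty with rfl | ⟨z₀, hz₀⟩
  · exact ⟨0, fun z hz => absurd hz (Set.notMem_empty z)⟩
  refine ⟨f z₀, fun z hz => sub_eq_zero.1 (separating_dual fun l => ?_)⟩
  rw [map_sub, sub_eq_zero]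
  refine hΩ.is_const_of_fderiv_eq_zero hc (f := fun z => l (f z))
    (fun y hy => (hf l y hy).differentiableAt.differentiableWithinAt) (fun y hy => ?_) hz hz₀
  refine ContinuousLinearMap.coe_injective (LinearMap.pi_ext' fun j => LinearMap.ext_ring ?_)
  have h1 := (h j).eq_fderiv hf l y hy
  rw [map_zero] at h1
  simpa using h1.symm

end Weak

section WeakLie

variable {n : ℕ} {L : Type*} [LieRing L] [LieAlgebra ℂ L] {Ω : Set (Fin n → ℂ)} {j : Fin n}
  {f g f' g' : (Fin n → ℂ) → L}

/-- The functional `y ↦ l [x, y]`. -/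
def lieFunctional (l : L →ₗ[ℂ] ℂ) (x : L) : L →ₗ[ℂ] ℂ := l ∘ₗ (LieAlgebra.ad ℂ L x : L →ₗ[ℂ] L)

/-- The Leibniz rule for brackets. The bracket is a bilinear map without continuity, but locally on
lines its first argument varies in a space of finite dimension. -/
theorem HasWD.lie (hΩ : IsOpen Ω) (hf : HasWD Ω j f f') (hg : HasWD Ω j g g') :
    HasWD Ω j (fun z => ⁅f z, g z⁆) (fun z => ⁅f' z, g z⁆ + ⁅f z, g' z⁆) := by
  intro l z hz
  obtain ⟨N, b, c, hb⟩ := exists_local_basis hΩ (j := j) (f := f)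
    (fun l z hz => (hf l z hz).continuousAt) hz
  have h1 : HasDerivAt
      (fun s => ∑ k, c k (f (Function.update z j s)) * l ⁅b k, g (Function.update z j s)⁆)
      (∑ k, (c k (f' z) * l ⁅b k, g z⁆ + c k (f z) * l ⁅b k, g' z⁆)) (z j) := by
    refine HasDerivAt.fun_sum fun k _ => ?_
    have h2 := (hf (c k) z hz).mul (hg (lieFunctional l (b k)) z hz)
    simp only [Function.update_eq_self] at h2
    exact h2
  have hbz : f z = ∑ k, c k (f z) • b k := by simpa using hb.self_of_nhds
  have hbz' : f' z = ∑ k, c k (f' z) • b k := by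
    refine sub_eq_zero.1 (separating_dual fun l => ?_)
    rw [map_sub, sub_eq_zero]
    refine (hf l z hz).unique ?_
    have h3 : HasDerivAt (fun s => ∑ k, c k (f (Function.update z j s)) * l (b k))
        (∑ k, c k (f' z) * l (b k)) (z j) :=
      HasDerivAt.fun_sum fun k _ => (hf (c k) z hz).mul_const (l (b k))
    simp only [map_sum, map_smul, smul_eq_mul]
    refine h3.congr_of_eventuallyEq ?_
    filter_upwards [hb] with s hs
    conv_lhs => rw [hs]
    simp
  have h4 : l (⁅f' z, g z⁆ + ⁅f z, g' z⁆) =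
      ∑ k, (c k (f' z) * l ⁅b k, g z⁆ + c k (f z) * l ⁅b k, g' z⁆) := by
    conv_lhs => rw [hbz, hbz']
    simp only [sum_lie, smul_lie, map_add, map_sum, map_smul, smul_eq_mul,
      Finset.sum_add_distrib]
  rw [h4]
  refine h1.congr_of_eventuallyEq ?_
  filter_upwards [hb] with s hs
  conv_lhs => rw [hs]
  simp only [sum_lie, smul_lie, map_sum, map_smul, smul_eq_mul]

end WeakLie

/-! ### The zero-curvature equation in terms of weak partial derivatives -/

section Bridge

variable {p : ℕ} {V : Type*} [AddCommGroup V] [Module ℂ V] {Ω : Set (Fin p → ℂ)}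

theorem head_update_of_lt (J : Jet) (j : Fin p) (s : ℂ) :
    Jet.head p ⟨J.x, J.t, Function.update J.v j s⟩ = Function.update (J.head p) j s := by
  ext i
  by_cases h : i = j
  · subst h; simp [Jet.head]
  · have : (i : ℕ) ≠ j := fun h' => h (Fin.ext h')
    simp [Jet.head, Function.update_of_ne h, Function.update_of_ne this]

theorem head_update_of_le (J : Jet) {j : ℕ} (hj : p ≤ j) (s : ℂ) :
    Jet.head p ⟨J.x, J.t, Function.update J.v j s⟩ = J.head p := by
  ext i
  have : (i : ℕ) ≠ j := by have := i.2; omega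
  simp [Jet.head, Function.update_of_ne this]

theorem pdV_head {f f' : (Fin p → ℂ) → V} {j : Fin p} (h : HasWD Ω j f f') (l : V →ₗ[ℂ] ℂ)
    {J : Jet} (hJ : J.head p ∈ Ω) : pdV j (fun K => l (f (K.head p))) J = l (f' (J.head p)) := by
  rw [pdV]
  simp only [head_update_of_lt]
  exact (h l _ hJ).deriv

theorem pdV_head_of_le (f : (Fin p → ℂ) → ℂ) {j : ℕ} (hj : p ≤ j) (J : Jet) :
    pdV j (fun K => f (K.head p)) J = 0 := by
  rw [pdV]
  simp only [head_update_of_le J hj]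
  exact deriv_const _ _

theorem finsum_pdV_head {f : (Fin p → ℂ) → V} {f' : Fin p → (Fin p → ℂ) → V}
    (h : ∀ j, HasWD Ω j f (f' j)) (l : V →ₗ[ℂ] ℂ) {J : Jet} (hJ : J.head p ∈ Ω) (c : ℕ → ℂ) :
    ∑ᶠ j : ℕ, c j * pdV j (fun K => l (f (K.head p))) J =
      ∑ j : Fin p, c j * l (f' j (J.head p)) := by
  rw [finsum_eq_sum_of_support_subset (s := Finset.range p), Finset.sum_range]
  · exact Finset.sum_congr rfl fun j _ => by rw [pdV_head (h j) l hJ]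
  · intro j hj
    rw [Finset.coe_range, Set.mem_Iio]
    by_contra hle
    refine hj ?_
    change c j * _ = 0
    rw [pdV_head_of_le (fun z => l (f z)) (not_lt.1 hle), mul_zero]

theorem totalDx_head {f : (Fin p → ℂ) → V} {f' : Fin p → (Fin p → ℂ) → V}
    (h : ∀ j, HasWD Ω j f (f' j)) (l : V →ₗ[ℂ] ℂ) {J : Jet} (hJ : J.head p ∈ Ω) :
    totalDx (fun K => l (f (K.head p))) J = ∑ j : Fin p, J.v (j + 1) * l (f' j (J.head p)) := by
  have h1 : pdX (fun K => l (f (K.head p))) J = 0 := deriv_const J.x (l (f (J.head p)))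
  rw [totalDx, h1, zero_add, finsum_pdV_head h l hJ fun j => J.v (j + 1)]

theorem totalDt_head {f : (Fin p → ℂ) → V} {f' : Fin p → (Fin p → ℂ) → V} (P : Jet → ℂ)
    (h : ∀ j, HasWD Ω j f (f' j)) (l : V →ₗ[ℂ] ℂ) {J : Jet} (hJ : J.head p ∈ Ω) :
    totalDt P (fun K => l (f (K.head p))) J =
      ∑ j : Fin p, (totalDx^[j] P) J * l (f' j (J.head p)) := by
  have h1 : pdT (fun K => l (f (K.head p))) J = 0 := deriv_const J.t (l (f (J.head p)))
  rw [totalDt, h1, zero_add, finsum_pdV_head h l hJ fun j => (totalDx^[j] P) J]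

/-- The infinite jet with the coordinates `z` of order less than `5`, with the coordinate `y` of
order `5`, and with all other coordinates zero. -/
def extendJet (z : Fin 5 → ℂ) (y : ℂ) : Jet :=
  ⟨0, 0, fun k => if h : k < 5 then z ⟨k, h⟩ else if k = 5 then y else 0⟩

theorem head_extendJet (z : Fin 5 → ℂ) (y : ℂ) : (extendJet z y).head 5 = z := by
  ext i; simp [Jet.head, extendJet]

end Bridge

section ZCR

variable {L : Type*} [LieRing L] [LieAlgebra ℂ L] {Ω : Set (Fin 5 → ℂ)} {r : ℂ → ℂ}

/-- The zero-curvature equation of `u_t = u^{5/2} u₅`, split with respect to `u₅`. -/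
theorem zcr_eqn_iff {A : ℂ → L} {B : (Fin 5 → ℂ) → L} {A' : (Fin 5 → ℂ) → L}
    {B' : Fin 5 → (Fin 5 → ℂ) → L} (hA : HasWD Ω 0 (fun z => A (z 0)) A')
    (hB : ∀ j, HasWD Ω j B (B' j)) :
    (∀ l : L →ₗ[ℂ] ℂ, ∀ J : Jet, J.head 5 ∈ Ω →
      totalDx (fun K => l (B (K.head 5))) J - totalDt (hdFlux r) (fun K => l (A (K.v 0))) J
        + l ⁅A (J.v 0), B (J.head 5)⁆ = 0) ↔
    ∀ z ∈ Ω, B' 4 z = r (z 0) ^ 5 • A' z ∧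
      z 1 • B' 0 z + z 2 • B' 1 z + z 3 • B' 2 z + z 4 • B' 3 z + ⁅A (z 0), B z⁆ = 0 := by
  have hAj : ∀ j, HasWD Ω j (fun z => A (z 0)) (if j = 0 then A' else fun _ => 0) := by
    intro j
    split_ifs with h
    · rw [h]; exact hA
    · intro l z _
      simpa [Function.update_of_ne (Ne.symm h)] using hasDerivAt_const (z j) (l (A (z 0)))
  have key : ∀ l : L →ₗ[ℂ] ℂ, ∀ J : Jet, J.head 5 ∈ Ω →
      totalDx (fun K => l (B (K.head 5))) J - totalDt (hdFlux r) (fun K => l (A (K.v 0))) J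
        + l ⁅A (J.v 0), B (J.head 5)⁆ =
      l (J.v 1 • B' 0 (J.head 5) + J.v 2 • B' 1 (J.head 5) + J.v 3 • B' 2 (J.head 5)
        + J.v 4 • B' 3 (J.head 5) + ⁅A (J.v 0), B (J.head 5)⁆
        + J.v 5 • (B' 4 (J.head 5) - r (J.v 0) ^ 5 • A' (J.head 5))) := by
    intro l J hJ
    have h1 : (fun K : Jet => l (A (K.v 0))) =
        fun K : Jet => l ((fun z : Fin 5 → ℂ => A (z 0)) (K.head 5)) := rfl
    rw [totalDx_head hB l hJ, h1, totalDt_head _ hAj l hJ]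
    simp [Fin.sum_univ_five, hdFlux]
    ring
  constructor
  · intro h z hz
    have h0 := fun l => (key l (extendJet z 0) (by rwa [head_extendJet])).symm.trans
      (h l (extendJet z 0) (by rwa [head_extendJet]))
    have h1 := fun l => (key l (extendJet z 1) (by rwa [head_extendJet])).symm.trans
      (h l (extendJet z 1) (by rwa [head_extendJet]))
    have h0' := separating_dual h0
    have h1' := separating_dual h1
    simp only [head_extendJet] at h0' h1'
    simp only [extendJet] at h0' h1'
    norm_num at h0' h1'
    refine ⟨?_, h0'⟩
    have h2 : (z 1 • B' 0 z + z 2 • B' 1 z + z 3 • B' 2 z + z 4 • B' 3 z + ⁅A (z 0), B z⁆) +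
      (B' 4 z - r (z 0) ^ 5 • A' z) = 0 := h1'
    have h3 : z 1 • B' 0 z + z 2 • B' 1 z + z 3 • B' 2 z + z 4 • B' 3 z + ⁅A (z 0), B z⁆ = 0 := h0'
    rw [h3, zero_add] at h2
    exact sub_eq_zero.1 h2
  · intro h l J hJ
    obtain ⟨h1, h2⟩ := h _ hJ
    have h3 : J.v 1 • B' 0 (J.head 5) + J.v 2 • B' 1 (J.head 5) + J.v 3 • B' 2 (J.head 5)
        + J.v 4 • B' 3 (J.head 5) + ⁅A (J.v 0), B (J.head 5)⁆ = 0 := h2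
    have h4 : B' 4 (J.head 5) = r (J.v 0) ^ 5 • A' (J.head 5) := h1
    rw [key l J hJ, h3, h4, sub_self, smul_zero, add_zero, map_zero]

end ZCR

/-! ### The branch of the square root -/

section Root

variable {U : Set ℂ} {r : ℂ → ℂ}

theorem two_mul_mul_deriv_root (hU : IsOpen U) (hr : AnalyticOnNhd ℂ r U)
    (hsq : ∀ u ∈ U, r u ^ 2 = u) {u : ℂ} (hu : u ∈ U) : 2 * r u * deriv r u = 1 := by
  have h1 := (hr u hu).differentiableAt.hasDerivAt
  have h2 : HasDerivAt (fun v => r v ^ 2) 1 u := by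
    refine (hasDerivAt_id u).congr_of_eventuallyEq ?_
    filter_upwards [hU.mem_nhds hu] with v hv
    exact hsq v hv
  have h3 := (h1.fun_pow 2).unique h2
  simpa using h3

theorem root_ne_zero (hU : IsOpen U) (hr : AnalyticOnNhd ℂ r U)
    (hsq : ∀ u ∈ U, r u ^ 2 = u) {u : ℂ} (hu : u ∈ U) : r u ≠ 0 := by
  intro h
  have h1 := two_mul_mul_deriv_root hU hr hsq hu
  simp [h] at h1

theorem hasDerivAt_root_inv (hU : IsOpen U) (hr : AnalyticOnNhd ℂ r U)
    (hsq : ∀ u ∈ U, r u ^ 2 = u) {u : ℂ} (hu : u ∈ U) :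
    HasDerivAt (fun v => (r v)⁻¹) (-(1 / 2) * (r u)⁻¹ ^ 3) u := by
  have h0 := root_ne_zero hU hr hsq hu
  have h1 := (hr u hu).differentiableAt.hasDerivAt.fun_inv h0
  refine h1.congr_deriv ?_
  have h2 := two_mul_mul_deriv_root hU hr hsq hu
  have h3 : deriv r u = (2 * r u)⁻¹ := by field_simp; linear_combination h2
  rw [h3]
  field_simp

variable {n : ℕ} [NeZero n] {Ω : Set (Fin n → ℂ)}

theorem hasPD_root_inv_pow (hU : IsOpen U) (hr : AnalyticOnNhd ℂ r U)
    (hsq : ∀ u ∈ U, r u ^ 2 = u) (hΩU : ∀ z ∈ Ω, z 0 ∈ U) (k : ℕ) :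
    HasPD Ω 0 (fun z => (r (z 0))⁻¹ ^ k) (fun z => -(k / 2 : ℂ) * (r (z 0))⁻¹ ^ (k + 2)) := by
  intro z hz
  simp only [Function.update_self]
  refine ((hasDerivAt_root_inv hU hr hsq (hΩU z hz)).fun_pow k).congr_deriv ?_
  cases k with
  | zero => simp
  | succ k => simp only [Nat.add_sub_cancel]; ring

theorem hasPD_comp_zero_of_ne {j : Fin n} (hj : j ≠ 0) (φ : ℂ → ℂ) :
    HasPD Ω j (fun z => φ (z 0)) (fun _ => 0) := fun z _ => by
  simpa [Function.update_of_ne (Ne.symm hj)] using hasDerivAt_const (z j) (φ (z 0))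

theorem analyticOnNhd_root_inv_pow (hU : IsOpen U) (hr : AnalyticOnNhd ℂ r U)
    (hsq : ∀ u ∈ U, r u ^ 2 = u) (hΩU : ∀ z ∈ Ω, z 0 ∈ U) (k : ℕ) :
    AnalyticOnNhd ℂ (fun z : Fin n → ℂ => (r (z 0))⁻¹ ^ k) Ω := by
  intro z hz
  have h1 : AnalyticAt ℂ (fun z : Fin n → ℂ => z 0) z :=
    (ContinuousLinearMap.proj (R := ℂ) (φ := fun _ : Fin n => ℂ) 0).analyticAt z
  have h2 : AnalyticAt ℂ (fun z : Fin n → ℂ => r (z 0)) z :=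
    AnalyticAt.comp (g := r) (f := fun z : Fin n → ℂ => z 0) (hr _ (hΩU z hz)) h1
  exact (h2.inv (root_ne_zero hU hr hsq (hΩU z hz))).pow k

theorem infinite_image_root_inv (hsq : ∀ u ∈ U, r u ^ 2 = u) (hΩ : IsOpen Ω) (hne : Ω.Nonempty)
    (hΩU : ∀ z ∈ Ω, z 0 ∈ U) : ((fun z : Fin n → ℂ => (r (z 0))⁻¹) '' Ω).Infinite := by
  obtain ⟨z, hz⟩ := hne
  have h1 := eventually_update_mem hΩ hz 0
  have h2 : {s : ℂ | Function.update z 0 s ∈ Ω}.Infinite := infinite_of_mem_nhds (z 0) h1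
  have h3 : Set.InjOn (fun s => (r s)⁻¹) {s : ℂ | Function.update z 0 s ∈ Ω} := by
    intro s hs t ht hst
    have hs' := hΩU _ hs
    have ht' := hΩU _ ht
    rw [Function.update_self] at hs' ht'
    rw [← hsq s hs', ← hsq t ht', inv_injective hst]
  refine (h2.image h3).mono ?_
  rintro _ ⟨s, hs, rfl⟩
  exact ⟨_, hs, by simp⟩

/-- Different powers of `u^{-1/2}` are linearly independent, even with coefficients in a vector
space. -/
theorem eq_zero_of_sum_root_inv_pow {V : Type*} [AddCommGroup V] [Module ℂ V]
    (hsq : ∀ u ∈ U, r u ^ 2 = u) (hΩ : IsOpen Ω) (hne : Ω.Nonempty)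
    (hΩU : ∀ z ∈ Ω, z 0 ∈ U) {N : ℕ} (y : ℕ → V)
    (h : ∀ z ∈ Ω, ∑ k ∈ Finset.range N, (r (z 0))⁻¹ ^ k • y k = 0) {k : ℕ} (hk : k < N) :
    y k = 0 := by
  refine separating_dual fun l => ?_
  let P : ℂ[X] := ∑ k ∈ Finset.range N, Polynomial.C (l (y k)) * Polynomial.X ^ k
  have hP : P = 0 := by
    refine Polynomial.eq_zero_of_infinite_isRoot P
      ((infinite_image_root_inv hsq hΩ hne hΩU).mono ?_)
    rintro _ ⟨z, hz, rfl⟩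
    have h1 := congr_arg l (h z hz)
    simp only [map_sum, map_smul, smul_eq_mul, map_zero] at h1
    simp only [Set.mem_ofPred_eq, Polynomial.IsRoot, P, Polynomial.eval_finsetSum,
      Polynomial.eval_mul, Polynomial.eval_C, Polynomial.eval_pow, Polynomial.eval_X]
    rw [← h1]
    exact Finset.sum_congr rfl fun k _ => mul_comm _ _
  have h2 : P.coeff k = l (y k) := by
    simp [P, Polynomial.coeff_X_pow, hk]
  rw [← h2, hP, Polynomial.coeff_zero]

end Root

/-! ### The form of a zero-curvature representation -/

section Structure

variable {L : Type*} [LieRing L] [LieAlgebra ℂ L] {Ω : Set (Fin 5 → ℂ)}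

/-- The equation `z₁ B₀ + z₂ B₁ + z₃ B₂ + z₄ B₃ + [a, B] = 0`, where `Bⱼ = ∂B/∂zⱼ` and where `a`
depends on `z₀` only, differentiated with respect to `zᵢ`, `i > 0`. -/
theorem deriv_zcr_eqn (hΩ : IsOpen Ω) {a B B₀ B₁ B₂ B₃ Bi C₀ C₁ C₂ C₃ : (Fin 5 → ℂ) → L}
    (h : ∀ z ∈ Ω, z 1 • B₀ z + z 2 • B₁ z + z 3 • B₂ z + z 4 • B₃ z + ⁅a z, B z⁆ = 0)
    {i : Fin 5} (ha : HasWD Ω i a fun _ => 0) (hB : HasWD Ω i B Bi) (h₀ : HasWD Ω i B₀ C₀)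
    (h₁ : HasWD Ω i B₁ C₁) (h₂ : HasWD Ω i B₂ C₂) (h₃ : HasWD Ω i B₃ C₃) :
    ∀ z ∈ Ω, z 1 • C₀ z + z 2 • C₁ z + z 3 • C₂ z + z 4 • C₃ z +
      ((if i = 1 then B₀ z else 0) + (if i = 2 then B₁ z else 0) + (if i = 3 then B₂ z else 0) +
        (if i = 4 then B₃ z else 0)) + ⁅a z, Bi z⁆ = 0 := by
  have hz : ∀ j : Fin 5, HasPD Ω i (fun z => z j) fun _ => if i = j then 1 else 0 := by
    intro j
    split_ifs with hij
    · subst hij; exact hasPD_apply_self i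
    · exact hasPD_apply_of_ne fun h => hij h.symm
  have h5 := ((((((hz 1).smul_wd h₀).add ((hz 2).smul_wd h₁)).add ((hz 3).smul_wd h₂)).add
    ((hz 4).smul_wd h₃)).add (ha.lie hΩ hB))
  intro z hz
  have h6 := h5.eq_of_eqOn hΩ (hasWD_const 0) h z hz
  simp only [ite_smul, one_smul, zero_smul, zero_lie, zero_add] at h6
  refine Eq.trans ?_ h6
  abel

variable {U : Set ℂ} {r : ℂ → ℂ}

/-- The first half of the classification of zero-curvature representations `A`, `B`: the
shape of `A`, and the derivatives `Bⱼ = ∂B/∂zⱼ`, `j > 1`, up to one further use of the equation. -/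
theorem exists_form_of_isZCR (hU : IsOpen U) (hr : AnalyticOnNhd ℂ r U)
    (hsq : ∀ u ∈ U, r u ^ 2 = u) (hΩ : IsOpen Ω) (hc : IsConnected Ω) (hΩU : ∀ z ∈ Ω, z 0 ∈ U)
    {A : ℂ → L} {B : (Fin 5 → ℂ) → L} (h : IsZCR 5 Ω (hdFlux r) A B) :
    ∃ (C Y₁ Y₂ : L) (B' : Fin 5 → (Fin 5 → ℂ) → L),
      ⁅C, Y₁⁆ = 0 ∧ ⁅C, Y₂⁆ = 0 ∧
      (∀ z ∈ Ω, A (z 0) = (r (z 0))⁻¹ • C + (r (z 0))⁻¹ ^ 3 • Y₁ + Y₂) ∧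
      WAnalytic Ω B ∧ (∀ j, WAnalytic Ω (B' j)) ∧ (∀ j, HasWD Ω j B (B' j)) ∧
      (∀ z ∈ Ω, z 1 • B' 0 z + z 2 • B' 1 z + z 3 • B' 2 z + z 4 • B' 3 z + ⁅A (z 0), B z⁆ = 0) ∧
      (∀ z ∈ Ω, B' 4 z = (-(1 / 2) * z 0) • C - (3 / 2 : ℂ) • Y₁) ∧
      (∀ z ∈ Ω, B' 3 z = (1 / 2 * z 1) • C + (3 / 2 : ℂ) • ⁅Y₂, Y₁⁆) ∧
      (∀ z ∈ Ω, B' 2 z = (-(1 / 2) * z 2) • C - (3 / 2 : ℂ) • ⁅A (z 0), ⁅Y₂, Y₁⁆⁆) := by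
  set a : (Fin 5 → ℂ) → L := fun z => A (z 0) with ha
  have wa : WAnalytic Ω a := by
    intro l z hz
    have h1 : AnalyticAt ℂ (fun z : Fin 5 → ℂ => z 0) z :=
      (ContinuousLinearMap.proj (R := ℂ) (φ := fun _ : Fin 5 => ℂ) 0).analyticAt z
    exact AnalyticAt.comp (g := fun u => l (A u)) (f := fun z : Fin 5 → ℂ => z 0)
      (h.analyticA l z hz) h1
  have wB : WAnalytic Ω B := h.analyticB
  obtain ⟨A₁, -, hA₁⟩ := wa.exists_hasWD hΩ 0
  choose B' wB' hB' using wB.exists_hasWD hΩ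
  have hE := (zcr_eqn_iff (r := r) hA₁ hB').1 h.eqn
  have E0 : ∀ z ∈ Ω, z 1 • B' 0 z + z 2 • B' 1 z + z 3 • B' 2 z + z 4 • B' 3 z + ⁅a z, B z⁆ = 0 :=
    fun z hz => (hE z hz).2
  have EB : ∀ z ∈ Ω, B' 4 z = r (z 0) ^ 5 • A₁ z := fun z hz => (hE z hz).1
  have zero : ∀ j, HasWD Ω j (fun _ => (0 : L)) fun _ => 0 := fun j => hasWD_const 0
  have haj : ∀ j, j ≠ 0 → HasWD Ω j a fun _ => 0 := by
    intro j hj l z _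
    simpa [ha, Function.update_of_ne (Ne.symm hj)] using hasDerivAt_const (z j) (l (A (z 0)))
  have hA₁j : ∀ j, j ≠ 0 → HasWD Ω j A₁ fun _ => 0 := fun j hj =>
    (haj j hj).comm hΩ wa hA₁ (zero 0)
  have hB4j : ∀ j, j ≠ 0 → HasWD Ω j (B' 4) fun _ => 0 := by
    intro j hj
    refine ((hasPD_comp_zero_of_ne hj fun u => r u ^ 5).smul_wd (hA₁j j hj)).congr hΩ
      (fun z hz => (EB z hz).symm) fun z _ => ?_
    simp
  obtain ⟨D₁, wD₁, hD₁⟩ := (wB' 4).exists_hasWD hΩ 0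
  obtain ⟨D₂, wD₂, hD₂⟩ := wD₁.exists_hasWD hΩ 0
  have hD₁j : ∀ j, j ≠ 0 → HasWD Ω j D₁ fun _ => 0 := fun j hj =>
    (hB4j j hj).comm hΩ (wB' 4) hD₁ (zero 0)
  have hD₂j : ∀ j, j ≠ 0 → HasWD Ω j D₂ fun _ => 0 := fun j hj =>
    (hD₁j j hj).comm hΩ wD₁ hD₂ (zero 0)
  -- the coefficient of `z₄`
  have h4 : ∀ j, j ≠ 0 → HasWD Ω 4 (B' j) fun _ => 0 := fun j hj =>
    (hB' 4).comm hΩ wB (hB' j) (hB4j j hj)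
  have h40 : HasWD Ω 4 (B' 0) D₁ := (hB' 4).comm hΩ wB (hB' 0) hD₁
  have E4 : ∀ z ∈ Ω, B' 3 z = -(z 1 • D₁ z + ⁅a z, B' 4 z⁆) := by
    intro z hz
    have h1 := deriv_zcr_eqn hΩ E0 (haj 4 (by decide)) (hB' 4) h40 (h4 1 (by decide))
      (h4 2 (by decide)) (h4 3 (by decide)) z hz
    simp at h1
    rw [eq_neg_iff_add_eq_zero, ← h1]
    abel
  -- the coefficient of `z₃`
  have cancel : ∀ z ∈ Ω, ⁅A₁ z, B' 4 z⁆ = 0 := fun z hz => by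
    rw [EB z hz, lie_smul, lie_self, smul_zero]
  have hB3 : ∀ j, j ≠ 0 → HasWD Ω j (B' 3) fun z => -((if j = 1 then 1 else 0 : ℂ) • D₁ z) := by
    intro j hj
    have hz : HasPD Ω j (fun z => z 1) fun _ => if j = 1 then 1 else 0 := by
      split_ifs with hj'
      · subst hj'; exact hasPD_apply_self 1
      · exact hasPD_apply_of_ne fun h => hj' h.symm
    refine ((hz.smul_wd (hD₁j j hj)).add ((haj j hj).lie hΩ (hB4j j hj))).neg.congr hΩ
      (fun z hz => (E4 z hz).symm) fun z _ => ?_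
    simp
  have hB30 : HasWD Ω 0 (B' 3) fun z => -(z 1 • D₂ z + ⁅a z, D₁ z⁆) := by
    refine (((hasPD_apply_of_ne (by decide)).smul_wd hD₂).add
      (hA₁.lie hΩ hD₁)).neg.congr hΩ (fun z hz => (E4 z hz).symm) fun z hz => ?_
    rw [cancel z hz]
    simp
  have h3 : ∀ j, j ≠ 0 → HasWD Ω 3 (B' j) fun z => -((if j = 1 then 1 else 0 : ℂ) • D₁ z) :=
    fun j hj => (hB' 3).comm hΩ wB (hB' j) (hB3 j hj)
  have h30 := (hB' 3).comm hΩ wB (hB' 0) hB30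
  have E3 : ∀ z ∈ Ω, B' 2 z = (z 1 ^ 2) • D₂ z + (2 * z 1) • ⁅a z, D₁ z⁆ + z 2 • D₁ z +
      ⁅a z, ⁅a z, B' 4 z⁆⁆ := by
    intro z hz
    have h1 := deriv_zcr_eqn hΩ E0 (haj 3 (by decide)) (hB' 3) h30 (h3 1 (by decide))
      (h3 2 (by decide)) (h3 3 (by decide)) z hz
    simp [-lie_skew, E4 z hz] at h1
    rw [← sub_eq_zero, ← h1]
    module
  -- the part of second degree in `z₂`
  have hB21 : HasWD Ω 1 (B' 2) fun z => (2 * z 1) • D₂ z + (2 : ℂ) • ⁅a z, D₁ z⁆ := by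
    have hz : HasPD Ω 1 (fun z : Fin 5 → ℂ => z 1) fun _ => 1 := hasPD_apply_self 1
    have hz1 : HasPD Ω 1 (fun z : Fin 5 → ℂ => z 1 ^ 2) fun z => 2 * z 1 := fun z hz' => by
      simpa using (hz z hz').fun_pow 2
    have hz2 : HasPD Ω 1 (fun z : Fin 5 → ℂ => 2 * z 1) fun z => 2 := fun z hz' => by
      simpa using (hz z hz').const_mul 2
    have n1 : (1 : Fin 5) ≠ 0 := by decide
    refine ((((hz1.smul_wd (hD₂j 1 n1)).add (hz2.smul_wd ((haj 1 n1).lie hΩ (hD₁j 1 n1)))).add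
      ((hasPD_apply_of_ne (by decide)).smul_wd (hD₁j 1 n1))).add
      ((haj 1 n1).lie hΩ ((haj 1 n1).lie hΩ (hB4j 1 n1)))).congr hΩ
      (fun z hz => (E3 z hz).symm) fun z _ => ?_
    simp
  have hB22 : HasWD Ω 2 (B' 2) D₁ := by
    have n2 : (2 : Fin 5) ≠ 0 := by decide
    have hz : HasPD Ω 2 (fun z : Fin 5 → ℂ => z 1) fun _ => 0 := hasPD_apply_of_ne (by decide)
    have hz1 : HasPD Ω 2 (fun z : Fin 5 → ℂ => z 1 ^ 2) fun z => 0 := fun z hz' => by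
      simpa using (hz z hz').fun_pow 2
    have hz2 : HasPD Ω 2 (fun z : Fin 5 → ℂ => 2 * z 1) fun z => 0 := fun z hz' => by
      simpa using (hz z hz').const_mul 2
    refine ((((hz1.smul_wd (hD₂j 2 n2)).add (hz2.smul_wd ((haj 2 n2).lie hΩ (hD₁j 2 n2)))).add
      ((hasPD_apply_self 2).smul_wd (hD₁j 2 n2))).add ((haj 2 n2).lie hΩ ((haj 2 n2).lie hΩ
        (hB4j 2 n2)))).congr hΩ (fun z hz => (E3 z hz).symm) fun z _ => ?_
    simp
  obtain ⟨Y, -, hY⟩ := (wB' 2).exists_hasWD hΩ 0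
  have hY2 : HasWD Ω 2 Y D₂ := hB22.comm hΩ (wB' 2) hY hD₂
  have h20 := (hB' 2).comm hΩ wB (hB' 0) hY
  have h21 := (hB' 2).comm hΩ wB (hB' 1) hB21
  have E2 : ∀ z ∈ Ω, z 1 • Y z + z 2 • ((2 * z 1) • D₂ z + (2 : ℂ) • ⁅a z, D₁ z⁆) + z 3 • D₁ z +
      B' 1 z + ⁅a z, B' 2 z⁆ = 0 := by
    intro z hz
    have h1 := deriv_zcr_eqn hΩ E0 (haj 2 (by decide)) (hB' 2) h20 h21 hB22
      (hB3 2 (by decide)) z hz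
    simpa [-lie_skew, -smul_add] using h1
  -- differentiated with respect to `z₂`, the last equation becomes `5 (z₁ D₂ + [a, D₁]) = 0`
  have E22 : ∀ z ∈ Ω, z 1 • D₂ z + ⁅a z, D₁ z⁆ = 0 := by
    intro z hz
    have n2 : (2 : Fin 5) ≠ 0 := by decide
    have p1 : HasPD Ω 2 (fun z : Fin 5 → ℂ => z 1) fun _ => 0 := hasPD_apply_of_ne (by decide)
    have p2 : HasPD Ω 2 (fun z : Fin 5 → ℂ => z 2) fun _ => 1 := hasPD_apply_self 2
    have p3 : HasPD Ω 2 (fun z : Fin 5 → ℂ => z 3) fun _ => 0 := hasPD_apply_of_ne (by decide)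
    have p4 : HasPD Ω 2 (fun z : Fin 5 → ℂ => 2 * z 1) fun z => 0 := fun z hz' => by
      simpa using (p1 z hz').const_mul 2
    have h1 := (((((p1.smul_wd hY2).add (p2.smul_wd ((p4.smul_wd (hD₂j 2 n2)).add
      (((haj 2 n2).lie hΩ (hD₁j 2 n2)).const_smul 2)))).add (p3.smul_wd (hD₁j 2 n2))).add h21).add
      ((haj 2 n2).lie hΩ hB22)).eq_of_eqOn hΩ (zero 2) E2 z hz
    simp only [zero_smul, one_smul, zero_add, add_zero, smul_zero, zero_lie, lie_zero] at h1
    have h2 : (5 : ℂ) • (z 1 • D₂ z + ⁅a z, D₁ z⁆) = 0 := by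
      rw [← h1]; module
    exact (smul_eq_zero.1 h2).resolve_left (by norm_num)
  have hD₂0 : ∀ z ∈ Ω, D₂ z = 0 := by
    intro z hz
    have n1 : (1 : Fin 5) ≠ 0 := by decide
    have h1 := (((hasPD_apply_self 1).smul_wd (hD₂j 1 n1)).add
      ((haj 1 n1).lie hΩ (hD₁j 1 n1))).eq_of_eqOn hΩ (zero 1) E22 z hz
    simpa using h1
  have haD₁ : ∀ z ∈ Ω, ⁅a z, D₁ z⁆ = 0 := by
    intro z hz
    have h1 := E22 z hz
    rwa [hD₂0 z hz, smul_zero, zero_add] at h1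
  -- integration: `D₁ = P` is constant, `∂B/∂z₄ = z₀ P + Q`, and `A` is an integral of
  -- `u^{-5/2} ∂B/∂z₄`
  obtain ⟨P, hP⟩ := wD₁.exists_eq_const hΩ hc.isPreconnected fun j => by
    by_cases hj : j = 0
    · subst hj; exact hD₂.congr hΩ (fun _ _ => rfl) hD₂0
    · exact hD₁j j hj
  have an0 : AnalyticOnNhd ℂ (fun z : Fin 5 → ℂ => z 0) Ω := fun z _ =>
    (ContinuousLinearMap.proj (R := ℂ) (φ := fun _ : Fin 5 => ℂ) 0).analyticAt z
  obtain ⟨Q, hQ⟩ := ((wB' 4).sub (wAnalytic_smul an0 P)).exists_eq_const hΩ hc.isPreconnected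
    fun j => by
      by_cases hj : j = 0
      · subst hj
        refine (hD₁.sub ((hasPD_apply_self 0).smul_wd (hasWD_const P))).congr hΩ
          (fun _ _ => rfl) fun z hz => ?_
        simp [hP z hz]
      · refine ((hB4j j hj).sub ((hasPD_apply_of_ne (Ne.symm hj)).smul_wd (hasWD_const P))).congr hΩ
          (fun _ _ => rfl) fun z hz => ?_
        simp
  have hB4 : ∀ z ∈ Ω, B' 4 z = z 0 • P + Q := fun z hz => by rw [← hQ z hz]; abel
  have hr0 : ∀ z ∈ Ω, r (z 0) ≠ 0 := fun z hz => root_ne_zero hU hr hsq (hΩU z hz)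
  have hA₁' : ∀ z ∈ Ω, A₁ z = (r (z 0))⁻¹ ^ 3 • P + (r (z 0))⁻¹ ^ 5 • Q := by
    intro z hz
    have h1 : A₁ z = (r (z 0))⁻¹ ^ 5 • B' 4 z := by
      rw [EB z hz, smul_smul, ← mul_pow, inv_mul_cancel₀ (hr0 z hz), one_pow, one_smul]
    have h2 : (r (z 0))⁻¹ ^ 5 * z 0 = (r (z 0))⁻¹ ^ 3 := by
      have h3 := hr0 z hz
      have h4 := hsq _ (hΩU z hz)
      field_simp
      exact h4.symm
    rw [h1, hB4 z hz, smul_add, smul_smul, h2]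
  have pd := fun k : ℕ => hasPD_root_inv_pow hU hr hsq hΩU k
  have an := fun k : ℕ => analyticOnNhd_root_inv_pow hU hr hsq hΩU k
  obtain ⟨Y₂, hY₂⟩ := ((wa.add (wAnalytic_smul (an 1) ((2 : ℂ) • P))).add
    (wAnalytic_smul (an 3) ((2 / 3 : ℂ) • Q))).exists_eq_const hΩ hc.isPreconnected fun j => by
      by_cases hj : j = 0
      · subst hj
        refine ((hA₁.add ((pd 1).smul_wd (hasWD_const _))).add
          ((pd 3).smul_wd (hasWD_const _))).congr hΩ (fun _ _ => rfl) fun z hz => ?_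
        rw [hA₁' z hz]
        push_cast
        module
      · refine (((haj j hj).add ((hasPD_comp_zero_of_ne hj fun u => (r u)⁻¹ ^ 1).smul_wd
          (hasWD_const _))).add ((hasPD_comp_zero_of_ne hj fun u => (r u)⁻¹ ^ 3).smul_wd
          (hasWD_const _))).congr hΩ (fun _ _ => rfl) fun z hz => ?_
        simp
  have haz : ∀ z ∈ Ω, a z = (r (z 0))⁻¹ • (-2 : ℂ) • P + (r (z 0))⁻¹ ^ 3 • (-(2 / 3) : ℂ) • Q +
      Y₂ := by
    intro z hz
    rw [← hY₂ z hz, pow_one]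
    module
  -- `[a, P] = 0`, by powers of `u^{-1/2}`
  have hPQ : ∀ z ∈ Ω, ∑ k ∈ Finset.range 4, (r (z 0))⁻¹ ^ k •
      (if k = 0 then ⁅Y₂, P⁆ else if k = 3 then (-(2 / 3) : ℂ) • ⁅Q, P⁆ else 0) = 0 := by
    intro z hz
    have h1 := haD₁ z hz
    rw [hP z hz, haz z hz] at h1
    simp only [add_lie, smul_lie, lie_self, smul_zero, zero_add] at h1
    simp only [Finset.sum_range_succ, Finset.sum_range_zero]
    norm_num [-lie_skew]
    rw [← h1]
    module
  have hne := hc.nonempty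
  have hYP : ⁅Y₂, P⁆ = 0 := by
    simpa using eq_zero_of_sum_root_inv_pow hsq hΩ hne hΩU _ hPQ (k := 0) (by norm_num)
  have hQP : ⁅Q, P⁆ = 0 := by
    have h1 := eq_zero_of_sum_root_inv_pow hsq hΩ hne hΩU _ hPQ (k := 3) (by norm_num)
    simpa [-lie_skew] using h1
  have hPY : ⁅P, Y₂⁆ = 0 := by rw [← lie_skew, hYP, neg_zero]
  have hPQ' : ⁅P, Q⁆ = 0 := by rw [← lie_skew, hQP, neg_zero]
  have haB4 : ∀ z ∈ Ω, ⁅a z, B' 4 z⁆ = ⁅Y₂, Q⁆ := by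
    intro z hz
    rw [hB4 z hz, haz z hz]
    simp [-lie_skew, hPQ', hYP, hQP]
  refine ⟨(-2 : ℂ) • P, (-(2 / 3) : ℂ) • Q, Y₂, B', ?_, ?_, haz, wB, wB', hB', E0, ?_, ?_, ?_⟩
  · rw [smul_lie, lie_smul, hPQ', smul_zero, smul_zero]
  · rw [smul_lie, hPY, smul_zero]
  · intro z hz
    rw [hB4 z hz]
    module
  · intro z hz
    rw [E4 z hz, hP z hz, haB4 z hz, lie_smul]
    module
  · intro z hz
    rw [E3 z hz, hD₂0 z hz, haD₁ z hz, hP z hz, haB4 z hz, lie_smul]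
    change _ = _ - (3 / 2 : ℂ) • ⁅a z, _⁆
    rw [lie_smul]
    module

end Structure

/-! ### The classification of zero-curvature representations -/

section Form

variable {L : Type*} [LieRing L] [LieAlgebra ℂ L]

/-- The relations between the coefficients of a zero-curvature representation: `Y₁`, `Y₂` satisfy
the Serre relations, and `C₁`, `C₂` are central. -/
structure HDRel (C₁ C₂ Y₁ Y₂ : L) : Prop where
  serre : SerrePair Y₁ Y₂
  c₁_c₂ : ⁅C₁, C₂⁆ = 0
  c₁_y₁ : ⁅C₁, Y₁⁆ = 0
  c₁_y₂ : ⁅C₁, Y₂⁆ = 0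
  c₂_y₁ : ⁅C₂, Y₁⁆ = 0
  c₂_y₂ : ⁅C₂, Y₂⁆ = 0

/-- The functions `f_i(u)` in the `x`-part of a zero-curvature representation. -/
def hdF (r : ℂ → ℂ) : Fin 3 → ℂ → ℂ := ![fun u => (r u)⁻¹, fun u => (r u)⁻¹ ^ 3, fun _ => 1]

/-- The functions `g_i(u, …, u₄)` in the `t`-part of a zero-curvature representation. -/
def hdG (r : ℂ → ℂ) : Fin 8 → (Fin 5 → ℂ) → ℂ :=
  ![fun z => -(1 / 2) * (z 0 * z 4 - z 1 * z 3 + 1 / 2 * z 2 ^ 2), fun z => -(3 / 2) * z 4,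
    fun z => 3 / 2 * z 3, fun z => -(3 / 2) * z 2, fun z => 3 / 2 * z 1, fun z => -(3 / 2) * z 0,
    fun z => 3 * (r (z 0))⁻¹, fun _ => 1]

/-- The coefficients of the functions `hdF`. -/
def lettersF (C₁ Y₁ Y₂ : L) : Fin 3 → L := ![C₁, Y₁, Y₂]

/-- The coefficients of the functions `hdG`. -/
def lettersG (C₁ C₂ Y₁ Y₂ : L) : Fin 8 → L :=
  ![C₁, Y₁, ⁅Y₂, Y₁⁆, ⁅Y₂, ⁅Y₂, Y₁⁆⁆, ⁅Y₂, ⁅Y₂, ⁅Y₂, Y₁⁆⁆⁆, ⁅Y₂, ⁅Y₂, ⁅Y₂, ⁅Y₂, Y₁⁆⁆⁆⁆,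
    ⁅Y₁, ⁅Y₂, ⁅Y₂, ⁅Y₂, Y₁⁆⁆⁆⁆, C₂]

theorem sum_hdF {V : Type*} [AddCommGroup V] [Module ℂ V] (r : ℂ → ℂ) (y : Fin 3 → V) (u : ℂ) :
    ∑ i, hdF r i u • y i = (r u)⁻¹ • y 0 + (r u)⁻¹ ^ 3 • y 1 + y 2 := by
  simp [Fin.sum_univ_three, hdF]

theorem sum_hdG {V : Type*} [AddCommGroup V] [Module ℂ V] (r : ℂ → ℂ) (y : Fin 8 → V)
    (z : Fin 5 → ℂ) : ∑ i, hdG r i z • y i =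
      (-(1 / 2) * (z 0 * z 4 - z 1 * z 3 + 1 / 2 * z 2 ^ 2)) • y 0 + (-(3 / 2) * z 4) • y 1 +
      (3 / 2 * z 3) • y 2 + (-(3 / 2) * z 2) • y 3 + (3 / 2 * z 1) • y 4 + (-(3 / 2) * z 0) • y 5 +
      (3 * (r (z 0))⁻¹) • y 6 + y 7 := by
  simp [Fin.sum_univ_eight, hdG]

/-- The partial derivatives of `∑ g_i y_i`. -/
def hdGDeriv {V : Type*} [AddCommGroup V] [Module ℂ V] (r : ℂ → ℂ) (y : Fin 8 → V) :
    Fin 5 → (Fin 5 → ℂ) → V :=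
  ![fun z => (-(1 / 2) * z 4) • y 0 - (3 / 2 : ℂ) • (y 5 + (r (z 0))⁻¹ ^ 3 • y 6),
    fun z => (1 / 2 * z 3) • y 0 + (3 / 2 : ℂ) • y 4,
    fun z => (-(1 / 2) * z 2) • y 0 - (3 / 2 : ℂ) • y 3,
    fun z => (1 / 2 * z 1) • y 0 + (3 / 2 : ℂ) • y 2,
    fun z => (-(1 / 2) * z 0) • y 0 - (3 / 2 : ℂ) • y 1]

variable {U : Set ℂ} {r : ℂ → ℂ} {Ω : Set (Fin 5 → ℂ)}

theorem hasDerivAt_quadratic (a b c s : ℂ) :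
    HasDerivAt (fun s => a + b * s + c * s ^ 2) (b + c * (2 * s)) s := by
  simpa using (((hasDerivAt_id s).const_mul b).const_add a).fun_add
    (((hasDerivAt_id s).fun_pow 2).const_mul c)

theorem hasWD_sum_hdG {V : Type*} [AddCommGroup V] [Module ℂ V] (hU : IsOpen U)
    (hr : AnalyticOnNhd ℂ r U) (hsq : ∀ u ∈ U, r u ^ 2 = u) (hΩU : ∀ z ∈ Ω, z 0 ∈ U)
    (y : Fin 8 → V) (j : Fin 5) :
    HasWD Ω j (fun z => ∑ i, hdG r i z • y i) (hdGDeriv r y j) := by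
  intro l z hz
  have hq := hasDerivAt_root_inv hU hr hsq (hΩU z hz)
  simp only [sum_hdG, map_add, map_smul, smul_eq_mul]
  fin_cases j
  · refine (((hasDerivAt_quadratic (-(1 / 2) * (- z 1 * z 3 + 1 / 2 * z 2 ^ 2) * l (y 0) +
      -(3 / 2) * z 4 * l (y 1) + 3 / 2 * z 3 * l (y 2) + -(3 / 2) * z 2 * l (y 3) +
      3 / 2 * z 1 * l (y 4) + l (y 7)) (-(1 / 2) * z 4 * l (y 0) - 3 / 2 * l (y 5)) 0 (z 0)).add
      (hq.mul_const (3 * l (y 6)))).congr_of_eventuallyEq (Filter.Eventually.of_forall fun s =>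
        ?_)).congr_deriv ?_
    · simp
      ring
    · simp [hdGDeriv]
      ring
  · refine ((hasDerivAt_quadratic (-(1 / 2) * (z 0 * z 4 + 1 / 2 * z 2 ^ 2) * l (y 0) +
      -(3 / 2) * z 4 * l (y 1) + 3 / 2 * z 3 * l (y 2) + -(3 / 2) * z 2 * l (y 3) +
      -(3 / 2) * z 0 * l (y 5) + 3 * (r (z 0))⁻¹ * l (y 6) + l (y 7))
      (1 / 2 * z 3 * l (y 0) + 3 / 2 * l (y 4)) 0 (z 1)).congr_of_eventuallyEq
      (Filter.Eventually.of_forall fun s => ?_)).congr_deriv ?_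
    · simp
      ring
    · simp [hdGDeriv]
  · refine ((hasDerivAt_quadratic (-(1 / 2) * (z 0 * z 4 - z 1 * z 3) * l (y 0) +
      -(3 / 2) * z 4 * l (y 1) + 3 / 2 * z 3 * l (y 2) + 3 / 2 * z 1 * l (y 4) +
      -(3 / 2) * z 0 * l (y 5) + 3 * (r (z 0))⁻¹ * l (y 6) + l (y 7))
      (-(3 / 2) * l (y 3)) (-(1 / 4) * l (y 0)) (z 2)).congr_of_eventuallyEq
      (Filter.Eventually.of_forall fun s => ?_)).congr_deriv ?_
    · simp
      ring
    · simp [hdGDeriv]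
      ring
  · refine ((hasDerivAt_quadratic (-(1 / 2) * (z 0 * z 4 + 1 / 2 * z 2 ^ 2) * l (y 0) +
      -(3 / 2) * z 4 * l (y 1) + -(3 / 2) * z 2 * l (y 3) + 3 / 2 * z 1 * l (y 4) +
      -(3 / 2) * z 0 * l (y 5) + 3 * (r (z 0))⁻¹ * l (y 6) + l (y 7))
      (1 / 2 * z 1 * l (y 0) + 3 / 2 * l (y 2)) 0 (z 3)).congr_of_eventuallyEq
      (Filter.Eventually.of_forall fun s => ?_)).congr_deriv ?_
    · simp
      ring
    · simp [hdGDeriv]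
  · refine ((hasDerivAt_quadratic (-(1 / 2) * (- z 1 * z 3 + 1 / 2 * z 2 ^ 2) * l (y 0) +
      3 / 2 * z 3 * l (y 2) + -(3 / 2) * z 2 * l (y 3) + 3 / 2 * z 1 * l (y 4) +
      -(3 / 2) * z 0 * l (y 5) + 3 * (r (z 0))⁻¹ * l (y 6) + l (y 7))
      (-(1 / 2) * z 0 * l (y 0) + -(3 / 2) * l (y 1)) 0 (z 4)).congr_of_eventuallyEq
      (Filter.Eventually.of_forall fun s => ?_)).congr_deriv ?_
    · simp
      ring
    · simp [hdGDeriv]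
      ring

theorem analyticOnNhd_hdG (hU : IsOpen U) (hr : AnalyticOnNhd ℂ r U) (hsq : ∀ u ∈ U, r u ^ 2 = u)
    (hΩU : ∀ z ∈ Ω, z 0 ∈ U) (i : Fin 8) : AnalyticOnNhd ℂ (hdG r i) Ω := by
  have hz : ∀ k : Fin 5, AnalyticOnNhd ℂ (fun z : Fin 5 → ℂ => z k) Ω := fun k z _ =>
    (ContinuousLinearMap.proj (R := ℂ) (φ := fun _ : Fin 5 => ℂ) k).analyticAt z
  have hc : ∀ c : ℂ, AnalyticOnNhd ℂ (fun _ : Fin 5 → ℂ => c) Ω := fun c => analyticOnNhd_const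
  have hq := analyticOnNhd_root_inv_pow hU hr hsq hΩU 1
  simp only [pow_one] at hq
  fin_cases i
  · exact (hc _).mul ((((hz 0).mul (hz 4)).sub ((hz 1).mul (hz 3))).add ((hc _).mul ((hz 2).pow 2)))
  · exact (hc _).mul (hz 4)
  · exact (hc _).mul (hz 3)
  · exact (hc _).mul (hz 2)
  · exact (hc _).mul (hz 1)
  · exact (hc _).mul (hz 0)
  · exact (hc _).mul hq
  · exact hc 1

/-- The functions `hdF` are linearly independent, even with coefficients in a vector space. -/
theorem lettersF_eq_zero {V : Type*} [AddCommGroup V] [Module ℂ V] (hsq : ∀ u ∈ U, r u ^ 2 = u)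
    (hΩ : IsOpen Ω) (hne : Ω.Nonempty) (hΩU : ∀ z ∈ Ω, z 0 ∈ U) {y : Fin 3 → V}
    (h : ∀ z ∈ Ω, ∑ i, hdF r i (z 0) • y i = 0) : y = 0 := by
  have h1 : ∀ z ∈ Ω, ∑ k ∈ Finset.range 4, (r (z 0))⁻¹ ^ k •
      (if k = 0 then y 2 else if k = 1 then y 0 else if k = 3 then y 1 else 0) = 0 := by
    intro z hz
    refine Eq.trans ?_ (h z hz)
    rw [sum_hdF]
    simp only [Finset.sum_range_succ, Finset.sum_range_zero]
    norm_num
    abel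
  have h2 := fun k (hk : k < 4) => eq_zero_of_sum_root_inv_pow hsq hΩ hne hΩU _ h1 hk
  funext i
  fin_cases i
  · simpa using h2 1 (by norm_num)
  · simpa using h2 3 (by norm_num)
  · simpa using h2 0 (by norm_num)

/-- The functions `hdG` are linearly independent, even with coefficients in a vector space. -/
theorem lettersG_eq_zero {V : Type*} [AddCommGroup V] [Module ℂ V] (hU : IsOpen U)
    (hr : AnalyticOnNhd ℂ r U) (hsq : ∀ u ∈ U, r u ^ 2 = u)
    (hΩ : IsOpen Ω) (hne : Ω.Nonempty) (hΩU : ∀ z ∈ Ω, z 0 ∈ U) {y : Fin 8 → V}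
    (h : ∀ z ∈ Ω, ∑ i, hdG r i z • y i = 0) : y = 0 := by
  have hD : ∀ j, ∀ z ∈ Ω, hdGDeriv r y j z = 0 := fun j =>
    (hasWD_sum_hdG hU hr hsq hΩU y j).eq_of_eqOn hΩ (hasWD_const 0) h
  have h40 : HasWD Ω 0 (hdGDeriv r y 4) fun _ => -(1 / 2 : ℂ) • y 0 := by
    intro l z _
    refine ((hasDerivAt_quadratic (-(3 / 2) * l (y 1)) (-(1 / 2) * l (y 0)) 0
      (z 0)).congr_of_eventuallyEq (Filter.Eventually.of_forall fun s => ?_)).congr_deriv ?_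
    · simp [hdGDeriv]
      ring
    · simp
  obtain ⟨z₀, hz₀⟩ := hne
  have y0 : y 0 = 0 := by
    simpa using h40.eq_of_eqOn hΩ (hasWD_const 0) (hD 4) z₀ hz₀
  have y1 : y 1 = 0 := by simpa [hdGDeriv, y0] using hD 4 z₀ hz₀
  have y2 : y 2 = 0 := by simpa [hdGDeriv, y0] using hD 3 z₀ hz₀
  have y3 : y 3 = 0 := by simpa [hdGDeriv, y0] using hD 2 z₀ hz₀
  have y4 : y 4 = 0 := by simpa [hdGDeriv, y0] using hD 1 z₀ hz₀
  have h1 : ∀ z ∈ Ω, ∑ k ∈ Finset.range 4, (r (z 0))⁻¹ ^ k • (if k = 0 then y 5 else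
      if k = 3 then y 6 else 0) = 0 := by
    intro z hz
    have h2 := hD 0 z hz
    simp only [hdGDeriv, y0] at h2
    simp at h2
    have h3 : (-(3 / 2) : ℂ) • (y 5 + (r (z 0) ^ 3)⁻¹ • y 6) = 0 := by
      rw [← h2]; module
    have h4 := (smul_eq_zero.1 h3).resolve_left (by norm_num)
    refine Eq.trans ?_ h4
    simp [Finset.sum_range_succ]
  have h2 := fun k (hk : k < 4) => eq_zero_of_sum_root_inv_pow hsq hΩ ⟨z₀, hz₀⟩ hΩU _ h1 hk
  have y5 : y 5 = 0 := by simpa using h2 0 (by norm_num)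
  have y6 : y 6 = 0 := by simpa using h2 3 (by norm_num)
  have y7 : y 7 = 0 := by simpa [sum_hdG, y0, y1, y2, y3, y4, y5, y6] using h z₀ hz₀
  funext i
  fin_cases i <;> assumption

/-- The left-hand side of the zero-curvature equation, for `A` and `B` of the general form. It has
been multiplied by `u⁻¹`, so that it is a polynomial in `u^{-1/2}`, the coefficients of which are
the relations still to be imposed. -/
theorem smul_zcr_expr {C₁ C₂ Y₁ Y₂ : L} (h1 : ⁅C₁, Y₁⁆ = 0) (h2 : ⁅C₁, Y₂⁆ = 0)
    (h3 : ⁅Y₁, ⁅Y₂, Y₁⁆⁆ = 0) {z : Fin 5 → ℂ} (hz : r (z 0) ^ 2 = z 0) (h0 : r (z 0) ≠ 0) :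
    (r (z 0))⁻¹ ^ 2 • (z 1 • hdGDeriv r (lettersG C₁ C₂ Y₁ Y₂) 0 z +
      z 2 • hdGDeriv r (lettersG C₁ C₂ Y₁ Y₂) 1 z + z 3 • hdGDeriv r (lettersG C₁ C₂ Y₁ Y₂) 2 z +
      z 4 • hdGDeriv r (lettersG C₁ C₂ Y₁ Y₂) 3 z +
      ⁅∑ i, hdF r i (z 0) • lettersF C₁ Y₁ Y₂ i, ∑ i, hdG r i z • lettersG C₁ C₂ Y₁ Y₂ i⁆) =
    (-(3 / 2) : ℂ) • ⁅Y₂, ⁅Y₂, ⁅Y₂, ⁅Y₂, ⁅Y₂, Y₁⁆⁆⁆⁆⁆ + (r (z 0))⁻¹ ^ 2 • ⁅Y₂, C₂⁆ +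
      (r (z 0))⁻¹ ^ 3 • ⁅C₁, C₂⁆ + (r (z 0))⁻¹ ^ 5 • ⁅Y₁, C₂⁆ +
      (r (z 0))⁻¹ ^ 6 • (3 : ℂ) • ⁅Y₁, ⁅Y₁, ⁅Y₂, ⁅Y₂, ⁅Y₂, Y₁⁆⁆⁆⁆⁆ := by
  have b1 : ⁅Y₂, C₁⁆ = 0 := by rw [← lie_skew, h2, neg_zero]
  have b1' : ⁅Y₁, C₁⁆ = 0 := by rw [← lie_skew, h1, neg_zero]
  have c1 : ⁅C₁, ⁅Y₂, Y₁⁆⁆ = 0 := by rw [leibniz_lie, h1, h2]; simp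
  have c2 : ⁅C₁, ⁅Y₂, ⁅Y₂, Y₁⁆⁆⁆ = 0 := by rw [leibniz_lie, c1, h2]; simp
  have c3 : ⁅C₁, ⁅Y₂, ⁅Y₂, ⁅Y₂, Y₁⁆⁆⁆⁆ = 0 := by rw [leibniz_lie, c2, h2]; simp
  have c4 : ⁅C₁, ⁅Y₂, ⁅Y₂, ⁅Y₂, ⁅Y₂, Y₁⁆⁆⁆⁆⁆ = 0 := by rw [leibniz_lie, c3, h2]; simp
  have cT : ⁅C₁, ⁅Y₁, ⁅Y₂, ⁅Y₂, ⁅Y₂, Y₁⁆⁆⁆⁆⁆ = 0 := by rw [leibniz_lie, c3, h1]; simp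
  set w1 := ⁅Y₂, Y₁⁆ with hw1
  have s : ⁅Y₁, Y₂⁆ = -w1 := by rw [hw1, lie_skew]
  have d2 : ⁅Y₁, ⁅Y₂, w1⁆⁆ = 0 := by rw [leibniz_lie, s, h3]; simp
  set w2 := ⁅Y₂, w1⁆ with hw2
  have d3 : ⁅Y₁, ⁅Y₂, w2⁆⁆ = -⁅w1, w2⁆ := by rw [leibniz_lie, s, d2]; simp [-lie_skew]
  set w3 := ⁅Y₂, w2⁆ with hw3
  have d4 : ⁅Y₂, ⁅Y₁, w3⁆⁆ = -⁅w1, w3⁆ := by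
    rw [d3, lie_neg, leibniz_lie, ← hw2, ← hw3]; simp [-lie_skew]
  have d5 : ⁅Y₁, ⁅Y₂, w3⁆⁆ = (2 : ℂ) • ⁅Y₂, ⁅Y₁, w3⁆⁆ := by
    rw [leibniz_lie, s, d4]
    simp only [neg_lie]
    module
  simp only [sum_hdF, sum_hdG, hdGDeriv, lettersF, lettersG, ← hw1, ← hw2, ← hw3]
  simp only [Matrix.cons_val]
  generalize r (z 0) = q at *
  rw [← hz]
  simp only [lie_add, add_lie, lie_smul, smul_lie, lie_self, h1, h3, b1, b1', c1, c2, c3, c4,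
    cT, d2, d5, ← hw1, ← hw2, ← hw3]
  match_scalars <;> field_simp <;> ring

/-- The relation `(ad Y₁)² (ad Y₂)³ Y₁ = 0`, which the equation also requires, follows from the
Serre relations. -/
theorem HDRel.isZCR (hU : IsOpen U) (hr : AnalyticOnNhd ℂ r U) (hsq : ∀ u ∈ U, r u ^ 2 = u)
    (hΩU : ∀ z ∈ Ω, z 0 ∈ U) {C₁ C₂ Y₁ Y₂ : L} (h : HDRel C₁ C₂ Y₁ Y₂) :
    IsZCR 5 Ω (hdFlux r) (fun u => ∑ i, hdF r i u • lettersF C₁ Y₁ Y₂ i)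
      (fun z => ∑ i, hdG r i z • lettersG C₁ C₂ Y₁ Y₂ i) := by
  have pd := fun k : ℕ => hasPD_root_inv_pow hU hr hsq hΩU k
  refine ⟨fun l z hz => ?_, fun l => ?_, ?_⟩
  · have h1 := (hr _ (hΩU z hz)).inv (root_ne_zero hU hr hsq (hΩU z hz))
    simp only [sum_hdF, map_add, map_smul, smul_eq_mul]
    exact ((h1.mul analyticAt_const).add ((h1.pow 3).mul analyticAt_const)).add analyticAt_const
  · simp only [map_sum, map_smul, smul_eq_mul]
    exact Finset.analyticOnNhd_fun_sum _ fun i _ =>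
      (analyticOnNhd_hdG hU hr hsq hΩU i).mul analyticOnNhd_const
  · have hA : HasWD Ω 0 (fun z => ∑ i, hdF r i (z 0) • lettersF C₁ Y₁ Y₂ i)
        fun z => (-(1 / 2) * (r (z 0))⁻¹ ^ 3) • C₁ + (-(3 / 2) * (r (z 0))⁻¹ ^ 5) • Y₁ := by
      have h1 := (((pd 1).smul_wd (hasWD_const C₁)).add ((pd 3).smul_wd (hasWD_const Y₁))).add
        (hasWD_const Y₂)
      intro l z hz
      refine ((h1 l z hz).congr_deriv ?_).congr_of_eventuallyEq
        (Filter.Eventually.of_forall fun s => ?_)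
      · simp
      · simp [sum_hdF, lettersF]
    rw [zcr_eqn_iff (A := fun u => ∑ i, hdF r i u • lettersF C₁ Y₁ Y₂ i) hA
      fun j => hasWD_sum_hdG hU hr hsq hΩU (lettersG C₁ C₂ Y₁ Y₂) j]
    intro z hz
    have h0 := root_ne_zero hU hr hsq (hΩU z hz)
    have h2 := hsq _ (hΩU z hz)
    constructor
    · simp only [hdGDeriv, lettersG, Matrix.cons_val]
      generalize r (z 0) = q at *
      rw [← h2]
      match_scalars <;> field_simp
    · have h3 : ⁅Y₁, ⁅Y₂, Y₁⁆⁆ = 0 := by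
        rw [← lie_skew Y₂ Y₁, lie_neg, h.serre.ad_sq, neg_zero]
      have h4 := smul_zcr_expr (C₂ := C₂) h.c₁_y₁ h.c₁_y₂ h3 h2 h0
      have h5 : ⁅Y₁, ⁅Y₁, ⁅Y₂, ⁅Y₂, ⁅Y₂, Y₁⁆⁆⁆⁆⁆ = 0 := h.serre.blockTable_zero.eefffQ
      rw [h.serre.ad_pow_five, h.c₁_c₂, h5, ← lie_skew Y₂ C₂, h.c₂_y₂, ← lie_skew Y₁ C₂,
        h.c₂_y₁] at h4
      simp only [smul_zero, neg_zero, add_zero] at h4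
      exact (smul_eq_zero.1 h4).resolve_left (pow_ne_zero 2 (inv_ne_zero h0))

/-- The classification of zero-curvature representations. The equation is differentiated with
respect to `u₂` and `u₁`; this gives `(ad Y₁)² Y₂ = 0` and the remaining derivatives of `B`. The
constant of integration is `C₂`, and the other relations are the coefficients of the powers of
`u^{-1/2}` in the equation itself. -/
theorem exists_hdRel_of_isZCR (hU : IsOpen U) (hr : AnalyticOnNhd ℂ r U)
    (hsq : ∀ u ∈ U, r u ^ 2 = u) (hΩ : IsOpen Ω) (hc : IsConnected Ω) (hΩU : ∀ z ∈ Ω, z 0 ∈ U)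
    {A : ℂ → L} {B : (Fin 5 → ℂ) → L} (h : IsZCR 5 Ω (hdFlux r) A B) :
    ∃ C₁ C₂ Y₁ Y₂ : L, HDRel C₁ C₂ Y₁ Y₂ ∧
      ∀ z ∈ Ω, A (z 0) = ∑ i, hdF r i (z 0) • lettersF C₁ Y₁ Y₂ i ∧
        B z = ∑ i, hdG r i z • lettersG C₁ C₂ Y₁ Y₂ i := by
  obtain ⟨C, Y₁, Y₂, B', hCY₁, hCY₂, hA, wB, wB', hB', E0, hB4, hB3, hB2⟩ :=
    exists_form_of_isZCR hU hr hsq hΩ hc hΩU h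
  have pd := fun k : ℕ => hasPD_root_inv_pow hU hr hsq hΩU k
  have hr0 : ∀ z ∈ Ω, r (z 0) ≠ 0 := fun z hz => root_ne_zero hU hr hsq (hΩU z hz)
  set a : (Fin 5 → ℂ) → L := fun z => A (z 0) with ha
  have haz : ∀ z ∈ Ω, a z = (r (z 0))⁻¹ • C + (r (z 0))⁻¹ ^ 3 • Y₁ + Y₂ := hA
  have haj : ∀ j, j ≠ 0 → HasWD Ω j a fun _ => 0 := by
    intro j hj l z _
    simpa [ha, Function.update_of_ne (Ne.symm hj)] using hasDerivAt_const (z j) (l (A (z 0)))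
  have Cw : ⁅C, ⁅Y₂, Y₁⁆⁆ = 0 := by rw [leibniz_lie, hCY₁, hCY₂]; simp
  have n2 : (2 : Fin 5) ≠ 0 := by decide
  have n1 : (1 : Fin 5) ≠ 0 := by decide
  have hpow : ∀ {j : Fin 5}, j ≠ 0 → ∀ k : ℕ, HasPD Ω j (fun z => (r (z 0))⁻¹ ^ k) fun _ => 0 :=
    fun hj k => hasPD_comp_zero_of_ne hj fun u => (r u)⁻¹ ^ k
  have half : ∀ i j : Fin 5, i ≠ j → ∀ c : ℂ, HasWD Ω j (fun z => (c * z i) • C) fun _ => 0 := by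
    intro i j hij c
    refine (((hasPD_apply_of_ne hij).smul_wd (hasWD_const C)).const_smul c).congr hΩ
      (fun z _ => smul_smul _ _ _) fun z _ => by simp
  have half' : ∀ i : Fin 5, ∀ c : ℂ, HasWD Ω i (fun z => (c * z i) • C) fun _ => c • C := by
    intro i c
    refine (((hasPD_apply_self i).smul_wd (hasWD_const C)).const_smul c).congr hΩ
      (fun z _ => smul_smul _ _ _) fun z _ => by simp
  -- the coefficient of `z₂`
  set y := ⁅Y₁, ⁅Y₂, Y₁⁆⁆ with hy
  have haw : ∀ z ∈ Ω, ⁅a z, ⁅Y₂, Y₁⁆⁆ = (r (z 0))⁻¹ ^ 3 • y + ⁅Y₂, ⁅Y₂, Y₁⁆⁆ := by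
    intro z hz
    rw [haz z hz, add_lie, add_lie, smul_lie, smul_lie, Cw, smul_zero, zero_add]
  have hB2' : ∀ z ∈ Ω, B' 2 z = (-(1 / 2) * z 2) • C - ((3 / 2 : ℂ) • (r (z 0))⁻¹ ^ 3 • y +
      (3 / 2 : ℂ) • ⁅Y₂, ⁅Y₂, Y₁⁆⁆) := by
    intro z hz
    rw [hB2 z hz, ← smul_add]
    exact congr_arg (fun x => (-(1 / 2) * z 2) • C - (3 / 2 : ℂ) • x) (haw z hz)
  have d20 : HasWD Ω 0 (B' 2) fun z => (r (z 0))⁻¹ ^ 5 • (9 / 4 : ℂ) • y := by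
    refine ((half 2 0 n2 _).sub ((((pd 3).smul_wd (hasWD_const y)).const_smul (3 / 2)).add
      (hasWD_const _))).congr hΩ (fun z hz => (hB2' z hz).symm) fun z _ => ?_
    push_cast
    module
  have d2j : ∀ j, j ≠ 0 → j ≠ 2 → HasWD Ω j (B' 2) fun z => 0 := by
    intro j hj hj2
    refine ((half 2 j hj2.symm _).sub ((((hpow hj 3).smul_wd (hasWD_const y)).const_smul
      (3 / 2)).add (hasWD_const _))).congr hΩ (fun z hz => (hB2' z hz).symm) fun z _ => ?_
    simp
  have d22 : HasWD Ω 2 (B' 2) fun z => (-(1 / 2) : ℂ) • C := by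
    refine ((half' 2 _).sub ((((hpow n2 3).smul_wd (hasWD_const y)).const_smul (3 / 2)).add
      (hasWD_const _))).congr hΩ (fun z hz => (hB2' z hz).symm) fun z _ => ?_
    simp
  have d3j : ∀ j, j ≠ 1 → HasWD Ω j (B' 3) fun _ => 0 := by
    intro j hj
    refine ((half 1 j hj.symm _).add (hasWD_const _)).congr hΩ (fun z hz => (hB3 z hz).symm)
      fun z _ => ?_
    simp
  have d31 : HasWD Ω 1 (B' 3) fun _ => (1 / 2 : ℂ) • C := by
    refine ((half' 1 _).add (hasWD_const _)).congr hΩ (fun z hz => (hB3 z hz).symm)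
      fun z _ => ?_
    simp
  have h20 := (hB' 2).comm hΩ wB (hB' 0) d20
  have h21 := (hB' 2).comm hΩ wB (hB' 1) (d2j 1 n1 (by decide))
  have E2 : ∀ z ∈ Ω, z 1 • (r (z 0))⁻¹ ^ 5 • (9 / 4 : ℂ) • y + z 3 • (-(1 / 2) : ℂ) • C + B' 1 z +
      ⁅a z, B' 2 z⁆ = 0 := by
    intro z hz
    have h1 := deriv_zcr_eqn hΩ E0 (haj 2 n2) (hB' 2) h20 h21 d22 (d3j 2 (by decide)) z hz
    simp only [smul_zero, add_zero, zero_add, ↓reduceIte,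
      if_neg (show ¬((2 : Fin 5) = 1) by decide),
      if_neg (show ¬((2 : Fin 5) = 3) by decide), if_neg (show ¬((2 : Fin 5) = 4) by decide)] at h1
    exact h1
  -- the coefficient of `z₁`
  have hB1 : ∀ z ∈ Ω, B' 1 z = 0 - (z 1 • (r (z 0))⁻¹ ^ 5 • (9 / 4 : ℂ) • y +
      z 3 • (-(1 / 2) : ℂ) • C + ⁅a z, B' 2 z⁆) := by
    intro z hz
    rw [← E2 z hz]
    abel
  have d11 : HasWD Ω 1 (B' 1) fun z => -((r (z 0))⁻¹ ^ 5 • (9 / 4 : ℂ) • y) := by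
    refine ((hasWD_const 0).sub ((((hasPD_apply_self 1).smul_wd ((hpow n1 5).smul_wd
      (hasWD_const _))).add ((hasPD_apply_of_ne (by decide)).smul_wd (hasWD_const _))).add
      ((haj 1 n1).lie hΩ (d2j 1 n1 (by decide))))).congr hΩ (fun z hz => (hB1 z hz).symm)
      fun z _ => ?_
    simp
  obtain ⟨K, -, hK⟩ := (wB' 1).exists_hasWD hΩ 0
  have d110 : HasWD Ω 0 (fun z => -((r (z 0))⁻¹ ^ 5 • (9 / 4 : ℂ) • y)) fun z =>
      (r (z 0))⁻¹ ^ 7 • (45 / 8 : ℂ) • y := by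
    refine ((pd 5).smul_wd (hasWD_const _)).neg.congr hΩ (fun _ _ => rfl) fun z _ => ?_
    push_cast
    module
  have hK1 : HasWD Ω 1 K fun z => (r (z 0))⁻¹ ^ 7 • (45 / 8 : ℂ) • y :=
    d11.comm hΩ (wB' 1) hK d110
  have h10 := (hB' 1).comm hΩ wB (hB' 0) hK
  have E1 : ∀ z ∈ Ω, z 1 • K z + z 2 • -((r (z 0))⁻¹ ^ 5 • (9 / 4 : ℂ) • y) +
      z 4 • (1 / 2 : ℂ) • C + B' 0 z + ⁅a z, B' 1 z⁆ = 0 := by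
    intro z hz
    have h1 := deriv_zcr_eqn hΩ E0 (haj 1 n1) (hB' 1) h10 d11 (d2j 1 n1 (by decide)) d31 z hz
    simp only [smul_zero, add_zero, ↓reduceIte, if_neg (show ¬((1 : Fin 5) = 2) by decide),
      if_neg (show ¬((1 : Fin 5) = 3) by decide), if_neg (show ¬((1 : Fin 5) = 4) by decide)] at h1
    exact h1
  -- two further derivatives with respect to `z₁`; the last one is a multiple of `[Y₁, [Y₂, Y₁]]`
  have p1 : HasPD Ω 1 (fun z : Fin 5 → ℂ => z 1) fun _ => 1 := hasPD_apply_self 1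
  have E11 : ∀ z ∈ Ω, K z + z 1 • (r (z 0))⁻¹ ^ 7 • (45 / 8 : ℂ) • y + K z +
      ⁅a z, -((r (z 0))⁻¹ ^ 5 • (9 / 4 : ℂ) • y)⁆ = 0 := by
    intro z hz
    have h1 := (((((p1.smul_wd hK1).add ((hasPD_apply_of_ne (by decide)).smul_wd
      ((hpow n1 5).smul_wd (hasWD_const _)).neg)).add ((hasPD_apply_of_ne (by decide)).smul_wd
      (hasWD_const _))).add h10).add ((haj 1 n1).lie hΩ d11)).eq_of_eqOn hΩ (hasWD_const 0) E1 z hz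
    simpa only [one_smul, zero_smul, smul_zero, neg_zero, zero_lie, zero_add, add_zero] using h1
  have hne := hc.nonempty
  have hy0 : y = 0 := by
    obtain ⟨z, hz⟩ := hne
    have h1 := (((hK1.add (p1.smul_wd ((hpow n1 7).smul_wd (hasWD_const _)))).add hK1).add
      ((haj 1 n1).lie hΩ ((hpow n1 5).smul_wd (hasWD_const _)).neg)).eq_of_eqOn hΩ
      (hasWD_const 0) E11 z hz
    simp only [one_smul, zero_smul, smul_zero, neg_zero, zero_lie, lie_zero,
      add_zero] at h1
    have h2 : (r (z 0))⁻¹ ^ 7 • (135 / 8 : ℂ) • y = 0 := by rw [← h1]; module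
    exact (smul_eq_zero.1 ((smul_eq_zero.1 h2).resolve_left
      (pow_ne_zero 7 (inv_ne_zero (hr0 z hz))))).resolve_left (by norm_num)
  -- integration
  have Cw2 : ⁅C, ⁅Y₂, ⁅Y₂, Y₁⁆⁆⁆ = 0 := by rw [leibniz_lie, Cw, hCY₂]; simp
  have Cw3 : ⁅C, ⁅Y₂, ⁅Y₂, ⁅Y₂, Y₁⁆⁆⁆⁆ = 0 := by rw [leibniz_lie, Cw2, hCY₂]; simp
  have Y₁w2 : ⁅Y₁, ⁅Y₂, ⁅Y₂, Y₁⁆⁆⁆ = 0 := by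
    rw [leibniz_lie, ← hy, hy0, lie_zero, add_zero, ← lie_skew Y₁ Y₂, neg_lie, lie_self, neg_zero]
  have hYC₁ : ⁅Y₁, C⁆ = 0 := by rw [← lie_skew, hCY₁, neg_zero]
  have hYC₂ : ⁅Y₂, C⁆ = 0 := by rw [← lie_skew, hCY₂, neg_zero]
  simp only [hy0, smul_zero, zero_add, add_zero, neg_zero, lie_zero] at hB2' E11 E1 hB1
  have hK0 : ∀ z ∈ Ω, K z = 0 := by
    intro z hz
    have h1 : (2 : ℂ) • K z = 0 := by rw [two_smul]; exact E11 z hz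
    exact (smul_eq_zero.1 h1).resolve_left two_ne_zero
  have hB1' : ∀ z ∈ Ω, B' 1 z = (1 / 2 * z 3) • C + (3 / 2 : ℂ) • ⁅Y₂, ⁅Y₂, ⁅Y₂, Y₁⁆⁆⁆ := by
    intro z hz
    rw [hB1 z hz, hB2' z hz, haz z hz]
    simp only [add_lie, smul_lie, lie_smul, lie_sub, lie_self, hYC₁, hYC₂, Cw2, Y₁w2]
    module
  have hB0 : ∀ z ∈ Ω, B' 0 z = (-(1 / 2) * z 4) • C - (3 / 2 : ℂ) •
      (⁅Y₂, ⁅Y₂, ⁅Y₂, ⁅Y₂, Y₁⁆⁆⁆⁆ + (r (z 0))⁻¹ ^ 3 • ⁅Y₁, ⁅Y₂, ⁅Y₂, ⁅Y₂, Y₁⁆⁆⁆⁆) := by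
    intro z hz
    have h1 := E1 z hz
    rw [hK0 z hz, hB1' z hz, haz z hz] at h1
    simp only [add_lie, smul_lie, lie_smul, lie_add, lie_self, hYC₁, hYC₂, Cw3] at h1
    rw [← sub_eq_zero, ← h1]
    module
  have hBj : ∀ C₂ j, ∀ z ∈ Ω, B' j z = hdGDeriv r (lettersG C C₂ Y₁ Y₂) j z := by
    intro C₂ j z hz
    fin_cases j
    · exact hB0 z hz
    · exact hB1' z hz
    · exact hB2' z hz
    · exact hB3 z hz
    · exact hB4 z hz
  obtain ⟨C₂, hC₂⟩ := (wB.sub fun l => by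
    simp only [map_sum, map_smul, smul_eq_mul]
    exact Finset.analyticOnNhd_fun_sum _ fun i _ =>
      (analyticOnNhd_hdG hU hr hsq hΩU i).mul (analyticOnNhd_const
        (v := l (lettersG C 0 Y₁ Y₂ i)))).exists_eq_const hΩ hc.isPreconnected
    (f := fun z => B z - ∑ i, hdG r i z • lettersG C 0 Y₁ Y₂ i) fun j =>
    ((hB' j).sub (hasWD_sum_hdG hU hr hsq hΩU _ j)).congr hΩ (fun _ _ => rfl) fun z hz => by
      rw [hBj 0 j z hz, sub_self]
  have hB : ∀ z ∈ Ω, B z = ∑ i, hdG r i z • lettersG C C₂ Y₁ Y₂ i := by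
    intro z hz
    rw [eq_add_of_sub_eq (hC₂ z hz), sum_hdG, sum_hdG]
    simp only [lettersG, Matrix.cons_val]
    abel
  have hAf : ∀ z ∈ Ω, A (z 0) = ∑ i, hdF r i (z 0) • lettersF C Y₁ Y₂ i := by
    intro z hz
    rw [sum_hdF]
    exact hA z hz
  -- the remaining relations
  have hrel : ∀ z ∈ Ω, ∑ k ∈ Finset.range 7, (r (z 0))⁻¹ ^ k •
      (if k = 0 then (-(3 / 2) : ℂ) • ⁅Y₂, ⁅Y₂, ⁅Y₂, ⁅Y₂, ⁅Y₂, Y₁⁆⁆⁆⁆⁆ else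
        if k = 2 then ⁅Y₂, C₂⁆ else
        if k = 3 then ⁅C, C₂⁆ else if k = 5 then ⁅Y₁, C₂⁆ else
        if k = 6 then (3 : ℂ) • ⁅Y₁, ⁅Y₁, ⁅Y₂, ⁅Y₂, ⁅Y₂, Y₁⁆⁆⁆⁆⁆ else 0) = 0 := by
    intro z hz
    have h1 := smul_zcr_expr (C₂ := C₂) hCY₁ hCY₂ hy0 (hsq _ (hΩU z hz)) (hr0 z hz)
    have h2 := E0 z hz
    simp only [← hAf z hz, ← hB z hz, ← hBj C₂ _ z hz] at h1
    rw [h2, smul_zero] at h1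
    refine Eq.trans ?_ h1.symm
    simp only [Finset.sum_range_succ, Finset.sum_range_zero]
    norm_num [-lie_skew]
  have hk := fun k (hk : k < 7) => eq_zero_of_sum_root_inv_pow hsq hΩ hne hΩU _ hrel hk
  have k0 : ⁅Y₂, ⁅Y₂, ⁅Y₂, ⁅Y₂, ⁅Y₂, Y₁⁆⁆⁆⁆⁆ = 0 := by
    simpa [-lie_skew] using hk 0 (by norm_num)
  have k2 : ⁅Y₂, C₂⁆ = 0 := by simpa [-lie_skew] using hk 2 (by norm_num)
  have k3 : ⁅C, C₂⁆ = 0 := by simpa [-lie_skew] using hk 3 (by norm_num)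
  have k5 : ⁅Y₁, C₂⁆ = 0 := by simpa [-lie_skew] using hk 5 (by norm_num)
  refine ⟨C, C₂, Y₁, Y₂, ⟨⟨?_, k0⟩, k3, hCY₁, hCY₂, ?_, ?_⟩, fun z hz => ⟨hAf z hz, hB z hz⟩⟩
  · rw [← lie_skew Y₁ Y₂, lie_neg, ← hy, hy0, neg_zero]
  · rw [← lie_skew, k5, neg_zero]
  · rw [← lie_skew, k2, neg_zero]

end Form

/-! ### The Wahlquist-Estabrook algebra -/

section WE

variable {L L' : Type*} [LieRing L] [LieAlgebra ℂ L] [LieRing L'] [LieAlgebra ℂ L']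

theorem map_lettersF (φ : L →ₗ⁅ℂ⁆ L') (C₁ Y₁ Y₂ : L) (i : Fin 3) :
    φ (lettersF C₁ Y₁ Y₂ i) = lettersF (φ C₁) (φ Y₁) (φ Y₂) i := by
  fin_cases i <;> rfl

theorem map_lettersG (φ : L →ₗ⁅ℂ⁆ L') (C₁ C₂ Y₁ Y₂ : L) (i : Fin 8) :
    φ (lettersG C₁ C₂ Y₁ Y₂ i) = lettersG (φ C₁) (φ C₂) (φ Y₁) (φ Y₂) i := by
  fin_cases i <;> simp [lettersG, -lie_skew]

theorem HDRel.of_map {φ : L →ₗ⁅ℂ⁆ L'} (hφ : ∀ x, φ x = 0 → x = 0) {C₁ C₂ Y₁ Y₂ : L}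
    (h : HDRel (φ C₁) (φ C₂) (φ Y₁) (φ Y₂)) : HDRel C₁ C₂ Y₁ Y₂ := by
  refine ⟨⟨hφ _ ?_, hφ _ ?_⟩, hφ _ ?_, hφ _ ?_, hφ _ ?_, hφ _ ?_, hφ _ ?_⟩ <;>
    simp only [LieHom.map_lie]
  · exact h.serre.ad_sq
  · exact h.serre.ad_pow_five
  · exact h.c₁_c₂
  · exact h.c₁_y₁
  · exact h.c₁_y₂
  · exact h.c₂_y₁
  · exact h.c₂_y₂

/-- The standard generators of `ℂ² ⊕ 𝔤` satisfy the relations. -/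
theorem hdRel_prod :
    HDRel (((1, 0), 0) : (ℂ × ℂ) × gAlg) ((0, 1), 0) (0, x₁) (0, x₂) := by
  refine ⟨⟨Prod.ext ?_ serrePair_x.ad_sq, Prod.ext ?_ serrePair_x.ad_pow_five⟩, ?_, ?_, ?_, ?_, ?_⟩
  · change ⁅(0 : ℂ × ℂ), _⁆ = 0
    exact zero_lie _
  · change ⁅(0 : ℂ × ℂ), _⁆ = 0
    exact zero_lie _
  · refine Prod.ext (Prod.ext ?_ ?_) (lie_self _)
    · exact lie_zero _
    · exact zero_lie _
  all_goals exact Prod.ext (lie_zero _) (zero_lie _)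

theorem lie_lieHom_gAlg_eq_zero {ψ : gAlg →ₗ⁅ℂ⁆ L} {C : L} (h₁ : ⁅C, ψ x₁⁆ = 0) (h₂ : ⁅C, ψ x₂⁆ = 0)
    (y : gAlg) : ⁅C, ψ y⁆ = 0 := by
  have hy : y ∈ LieSubalgebra.lieSpan ℂ gAlg {x₁, x₂} := lieSpan_x ▸ LieSubalgebra.mem_top y
  induction hy using LieSubalgebra.lieSpan_induction with
  | mem y hy => rcases hy with rfl | rfl <;> assumption
  | zero => simp
  | smul c y _ hy => simp [hy]
  | add y z _ _ hy hz => simp [hy, hz]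
  | lie y z _ _ hy hz => rw [LieHom.map_lie, leibniz_lie, hy, hz, zero_lie, lie_zero, add_zero]

/-- The universal property of `ℂ² ⊕ 𝔤`. -/
theorem HDRel.exists_lieHom {C₁ C₂ Y₁ Y₂ : L} (h : HDRel C₁ C₂ Y₁ Y₂) :
    ∃ Φ : (ℂ × ℂ) × gAlg →ₗ⁅ℂ⁆ L, Φ ((1, 0), 0) = C₁ ∧ Φ ((0, 1), 0) = C₂ ∧ Φ (0, x₁) = Y₁ ∧
      Φ (0, x₂) = Y₂ := by
  obtain ⟨ψ, rfl, rfl⟩ := h.serre.exists_lieHom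
  have k₁ := lie_lieHom_gAlg_eq_zero h.c₁_y₁ h.c₁_y₂
  have k₂ := lie_lieHom_gAlg_eq_zero h.c₂_y₁ h.c₂_y₂
  have k₁' : ∀ y, ⁅ψ y, C₁⁆ = 0 := fun y => by rw [← lie_skew, k₁, neg_zero]
  have k₂' : ∀ y, ⁅ψ y, C₂⁆ = 0 := fun y => by rw [← lie_skew, k₂, neg_zero]
  have k₃ : ⁅C₂, C₁⁆ = 0 := by rw [← lie_skew, h.c₁_c₂, neg_zero]
  let Φ : (ℂ × ℂ) × gAlg →ₗ⁅ℂ⁆ L :=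
    { toFun := fun y => y.1.1 • C₁ + y.1.2 • C₂ + ψ y.2
      map_add' := fun y z => by simp only [Prod.fst_add, Prod.snd_add, map_add]; module
      map_smul' := fun c y => by
        simp only [Prod.smul_fst, Prod.smul_snd, map_smul, RingHom.id_apply, smul_eq_mul]; module
      map_lie' := fun {y z} => by
        have h1 : (⁅y, z⁆ : (ℂ × ℂ) × gAlg).1.1 = 0 := by
          change ⁅y.1.1, z.1.1⁆ = 0
          rw [Ring.lie_def]; ring
        have h2 : (⁅y, z⁆ : (ℂ × ℂ) × gAlg).1.2 = 0 := by
          change ⁅y.1.2, z.1.2⁆ = 0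
          rw [Ring.lie_def]; ring
        have h3 : (⁅y, z⁆ : (ℂ × ℂ) × gAlg).2 = ⁅y.2, z.2⁆ := rfl
        simp only [h1, h2, h3, LieHom.map_lie, zero_smul, zero_add, add_lie, lie_add, smul_lie,
          lie_smul, lie_self, smul_zero, h.c₁_c₂, k₃, k₁, k₂, k₁', k₂', add_zero] }
  refine ⟨Φ, ?_, ?_, ?_, ?_⟩ <;> change _ • C₁ + _ • C₂ + ψ _ = _ <;> simp

/-- The values of the letters in `ℂ² ⊕ 𝔤`. -/
def hdLetters : Fin 3 ⊕ Fin 8 → (ℂ × ℂ) × gAlg :=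
  Sum.elim (lettersF ((1, 0), 0) (0, x₁) (0, x₂)) (lettersG ((1, 0), 0) ((0, 1), 0) (0, x₁) (0, x₂))

theorem lift_letters_eq (φ : (ℂ × ℂ) × gAlg →ₗ⁅ℂ⁆ L) (a : FreeLieAlgebra ℂ (Fin 3 ⊕ Fin 8)) :
    FreeLieAlgebra.lift ℂ (Sum.elim (lettersF (φ ((1, 0), 0)) (φ (0, x₁)) (φ (0, x₂)))
      (lettersG (φ ((1, 0), 0)) (φ ((0, 1), 0)) (φ (0, x₁)) (φ (0, x₂)))) a =
      φ (FreeLieAlgebra.lift ℂ hdLetters a) := by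
  have h : FreeLieAlgebra.lift ℂ (Sum.elim (lettersF (φ ((1, 0), 0)) (φ (0, x₁)) (φ (0, x₂)))
      (lettersG (φ ((1, 0), 0)) (φ ((0, 1), 0)) (φ (0, x₁)) (φ (0, x₂)))) =
      φ.comp (FreeLieAlgebra.lift ℂ hdLetters) := by
    refine FreeLieAlgebra.hom_ext fun i => ?_
    rw [LieHom.comp_apply, FreeLieAlgebra.lift_of_apply, FreeLieAlgebra.lift_of_apply]
    rcases i with i | i
    · exact (map_lettersF φ _ _ _ i).symm
    · exact (map_lettersG φ _ _ _ _ i).symm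
  rw [h]
  rfl

/-- If the relations valid in `ℂ² ⊕ 𝔤` hold between the letters `F`, `G`, then these letters are
determined by four of them, which satisfy `HDRel`. -/
theorem hdRel_of_lift {F : Fin 3 → L} {G : Fin 8 → L}
    (h : ∀ a, FreeLieAlgebra.lift ℂ hdLetters a = 0 →
      FreeLieAlgebra.lift ℂ (Sum.elim F G) a = 0) :
    HDRel (F 0) (G 7) (F 1) (F 2) ∧ F = lettersF (F 0) (F 1) (F 2) ∧
      G = lettersG (F 0) (G 7) (F 1) (F 2) := by
  set φ := FreeLieAlgebra.lift ℂ hdLetters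
  set θ := FreeLieAlgebra.lift ℂ (Sum.elim F G)
  have hθ : ∀ a b, φ a = φ b → θ a = θ b := fun a b hab => by
    rw [← sub_eq_zero, ← map_sub]
    exact h _ (by rw [map_sub, hab, sub_self])
  let f := fun i : Fin 3 => FreeLieAlgebra.of ℂ (Sum.inl i : Fin 3 ⊕ Fin 8)
  let g := fun i : Fin 8 => FreeLieAlgebra.of ℂ (Sum.inr i : Fin 3 ⊕ Fin 8)
  have hf : ∀ i, θ (f i) = F i := fun i => FreeLieAlgebra.lift_of_apply _ _
  have hg : ∀ i, θ (g i) = G i := fun i => FreeLieAlgebra.lift_of_apply _ _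
  have hf' : ∀ i, φ (f i) = hdLetters (Sum.inl i) := fun i => FreeLieAlgebra.lift_of_apply _ _
  have hg' : ∀ i, φ (g i) = hdLetters (Sum.inr i) := fun i => FreeLieAlgebra.lift_of_apply _ _
  have p := hdRel_prod
  refine ⟨?_, ?_, ?_⟩
  · rw [← hf, ← hf, ← hf, ← hg]
    refine ⟨⟨?_, ?_⟩, ?_, ?_, ?_, ?_, ?_⟩ <;> simp only [← LieHom.map_lie] <;> refine h _ ?_ <;>
      simp only [LieHom.map_lie, hf', hg']
    exacts [p.serre.ad_sq, p.serre.ad_pow_five, p.c₁_c₂, p.c₁_y₁, p.c₁_y₂, p.c₂_y₁, p.c₂_y₂]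
  · funext i
    fin_cases i <;> rfl
  · funext i
    rw [← hg i, ← hf, ← hf, ← hf, ← hg 7, ← map_lettersG]
    refine hθ _ _ ?_
    rw [map_lettersG, hf', hf', hf', hg', hg']
    rfl

variable {U : Set ℂ} {r : ℂ → ℂ} {Ω : Set (Fin 5 → ℂ)}

/-- The Wahlquist-Estabrook data; the relations are all those that hold in `ℂ² ⊕ 𝔤`. -/
def hdWE (hU : IsOpen U) (hr : AnalyticOnNhd ℂ r U) (hsq : ∀ u ∈ U, r u ^ 2 = u) (hΩ : IsOpen Ω)
    (hc : IsConnected Ω) (hΩU : ∀ z ∈ Ω, z 0 ∈ U) : WEData.{w} 5 Ω (hdFlux r) where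
  k₁ := 3
  k₂ := 8
  f := hdF r
  g := hdG r
  rel := {a | FreeLieAlgebra.lift ℂ hdLetters a = 0}
  analytic_f := fun i z hz => by
    have h1 := (hr _ (hΩU z hz)).inv (root_ne_zero hU hr hsq (hΩU z hz))
    fin_cases i
    · exact h1
    · exact h1.pow 3
    · exact analyticAt_const
  analytic_g := analyticOnNhd_hdG hU hr hsq hΩU
  indep_f := fun c h => lettersF_eq_zero hsq hΩ hc.nonempty hΩU fun z hz => by
    simp only [smul_eq_mul, mul_comm, ← h z hz]
  indep_g := fun c h => lettersG_eq_zero hU hr hsq hΩ hc.nonempty hΩU fun z hz => by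
    simp only [smul_eq_mul, mul_comm, ← h z hz]
  form := fun L _ _ A B h => by
    obtain ⟨C₁, C₂, Y₁, Y₂, -, hAB⟩ := exists_hdRel_of_isZCR hU hr hsq hΩ hc hΩU h
    exact ⟨_, _, hAB⟩
  isZCR_iff := fun L _ _ F G => by
    constructor
    · intro h
      obtain ⟨C₁, C₂, Y₁, Y₂, hrel, hAB⟩ := exists_hdRel_of_isZCR hU hr hsq hΩ hc hΩU h
      have hF : F = lettersF C₁ Y₁ Y₂ := by
        rw [← sub_eq_zero]
        refine lettersF_eq_zero hsq hΩ hc.nonempty hΩU fun z hz => ?_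
        simp only [Pi.sub_apply, smul_sub, Finset.sum_sub_distrib]
        exact sub_eq_zero.2 (hAB z hz).1
      have hG : G = lettersG C₁ C₂ Y₁ Y₂ := by
        rw [← sub_eq_zero]
        refine lettersG_eq_zero hU hr hsq hΩ hc.nonempty hΩU fun z hz => ?_
        simp only [Pi.sub_apply, smul_sub, Finset.sum_sub_distrib]
        exact sub_eq_zero.2 (hAB z hz).2
      obtain ⟨Φ, rfl, rfl, rfl, rfl⟩ := hrel.exists_lieHom
      intro a ha
      rw [hF, hG, lift_letters_eq, show FreeLieAlgebra.lift ℂ hdLetters a = 0 from ha, map_zero]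
    · intro h
      obtain ⟨hrel, hF, hG⟩ := hdRel_of_lift h
      rw [hF, hG]
      exact hrel.isZCR hU hr hsq hΩU

end WE

/-! ### The chain of subalgebras -/

section Chain

variable {L : Type*} [LieRing L] [LieAlgebra ℂ L] {U : Set ℂ} {r : ℂ → ℂ} {Ω : Set (Fin 5 → ℂ)}

theorem chain_le_succ {ι : Type*} (M : ι → L) (k : ℕ) : chain M k ≤ chain M (k + 1) := by
  cases k with
  | zero => exact bot_le
  | succ k => exact fun x hx => LieSubalgebra.subset_lieSpan (Or.inl hx)

theorem lie_mem_chain {ι : Type*} (M : ι → L) {k : ℕ} {x : L} (hx : x ∈ chain M (k + 1)) (a : ι) :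
    ⁅x, M a⁆ ∈ chain M (k + 2) :=
  LieSubalgebra.subset_lieSpan (Or.inr ⟨x, hx, a, rfl⟩)

/-- Modulo the subalgebra generated by the differences `M a - M b`, the function `M` is constant,
and different powers of `u^{-1/2}` are linearly independent. -/
theorem mem_chain_one (hsq : ∀ u ∈ U, r u ^ 2 = u) (hΩ : IsOpen Ω) (hne : Ω.Nonempty)
    (hΩU : ∀ z ∈ Ω, z 0 ∈ U) {C₁ Y₁ Y₂ : L} {M : Ω → L}
    (hM : ∀ z : Ω, M z = (r (z.1 0))⁻¹ • C₁ + (r (z.1 0))⁻¹ ^ 3 • Y₁ + Y₂) :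
    C₁ ∈ chain M 1 ∧ Y₁ ∈ chain M 1 := by
  obtain ⟨z₀, hz₀⟩ := hne
  let p := (chain M 1).toSubmodule.mkQ
  have hp : ∀ z, p (M z) = p (M ⟨z₀, hz₀⟩) := fun z => by
    rw [← sub_eq_zero, ← map_sub]
    exact (Submodule.Quotient.mk_eq_zero _).2 (LieSubalgebra.subset_lieSpan ⟨_, _, rfl⟩)
  have h1 : ∀ z ∈ Ω, ∑ k ∈ Finset.range 4, (r (z 0))⁻¹ ^ k • (if k = 0 then
      p Y₂ - p (M ⟨z₀, hz₀⟩) else if k = 1 then p C₁ else if k = 3 then p Y₁ else 0) = 0 := by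
    intro z hz
    refine Eq.trans ?_ (sub_eq_zero.2 (hp ⟨z, hz⟩))
    rw [hM ⟨z, hz⟩]
    simp only [Finset.sum_range_succ, Finset.sum_range_zero, map_add, map_smul]
    norm_num
    abel
  have h2 := fun k (hk : k < 4) => eq_zero_of_sum_root_inv_pow hsq hΩ ⟨z₀, hz₀⟩ hΩU _ h1 hk
  have hC : p C₁ = 0 := by simpa using h2 1 (by norm_num)
  have hY : p Y₁ = 0 := by simpa using h2 3 (by norm_num)
  exact ⟨(Submodule.Quotient.mk_eq_zero _).1 hC, (Submodule.Quotient.mk_eq_zero _).1 hY⟩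

/-- The chain is exhausted by the subalgebra generated by `C₁` and all `(ad Y₂)ᵏ Y₁`; as
`(ad Y₂)⁵ Y₁ = 0`, this is its fifth term. -/
theorem HDRel.chain_five (hsq : ∀ u ∈ U, r u ^ 2 = u) (hΩ : IsOpen Ω) (hne : Ω.Nonempty)
    (hΩU : ∀ z ∈ Ω, z 0 ∈ U) {C₁ C₂ Y₁ Y₂ : L} (h : HDRel C₁ C₂ Y₁ Y₂) {M : Ω → L}
    (hM : ∀ z : Ω, M z = (r (z.1 0))⁻¹ • C₁ + (r (z.1 0))⁻¹ ^ 3 • Y₁ + Y₂) :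
    (chain M 5 : Set L) = ⋃ k, (chain M k : Set L) := by
  obtain ⟨hC₁, hY₁⟩ := mem_chain_one hsq hΩ hne hΩU hM
  let v : ℕ → L := fun k => (fun x => ⁅Y₂, x⁆)^[k] Y₁
  have v0 : v 0 = Y₁ := rfl
  have vs : ∀ k, v (k + 1) = ⁅Y₂, v k⁆ := fun k => Function.iterate_succ_apply' _ k Y₁
  have v5 : ∀ k, v (k + 5) = 0 := by
    intro k
    induction k with
    | zero => exact h.serre.ad_pow_five
    | succ k ih => rw [show k + 1 + 5 = (k + 5) + 1 by ring, vs, ih, lie_zero]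
  have hCv : ∀ k, ⁅v k, C₁⁆ = 0 := by
    intro k
    induction k with
    | zero => rw [v0, ← lie_skew, h.c₁_y₁, neg_zero]
    | succ k ih =>
      rw [vs, lie_lie, ih, lie_zero, ← lie_skew Y₂ C₁, h.c₁_y₂, neg_zero, lie_zero, sub_zero]
  have hvM : ∀ k z, ⁅v k, M z⁆ = -(r (z.1 0))⁻¹ ^ 3 • ⁅Y₁, v k⁆ - v (k + 1) := by
    intro k z
    rw [hM, lie_add, lie_add, lie_smul, lie_smul, hCv, vs, ← lie_skew (v k) Y₁,
      ← lie_skew (v k) Y₂]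
    module
  let T := LieSubalgebra.lieSpan ℂ L (insert C₁ (Set.range v))
  have hCT : C₁ ∈ T := LieSubalgebra.subset_lieSpan (Set.mem_insert _ _)
  have hvT : ∀ k, v k ∈ T := fun k => LieSubalgebra.subset_lieSpan (Or.inr ⟨k, rfl⟩)
  have hMT : ∀ x ∈ T, ∀ z, ⁅x, M z⁆ ∈ T := by
    intro x hx z
    induction hx using LieSubalgebra.lieSpan_induction with
    | mem x hx =>
      rcases hx with rfl | ⟨k, rfl⟩
      · rw [hM, lie_add, lie_add, lie_smul, lie_smul, lie_self, h.c₁_y₁, h.c₁_y₂]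
        simp
      · rw [hvM]
        exact sub_mem (T.smul_mem _ (T.lie_mem (hvT 0) (hvT k))) (hvT (k + 1))
    | zero => rw [zero_lie]; exact T.zero_mem
    | smul c x _ hx => rw [smul_lie]; exact T.smul_mem _ hx
    | add x y _ _ hx hy => rw [add_lie]; exact T.add_mem hx hy
    | lie x y hx' hy' hx hy =>
      rw [lie_lie]
      exact sub_mem (T.lie_mem hx' hy) (T.lie_mem hy' hx)
  have chain_le : ∀ k, chain M k ≤ T := by
    intro k
    induction k with
    | zero => exact bot_le
    | succ k ih =>
      cases k with
      | zero =>
        refine LieSubalgebra.lieSpan_le.2 ?_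
        rintro _ ⟨a, b, rfl⟩
        have h1 : M a - M b = ((r (a.1 0))⁻¹ - (r (b.1 0))⁻¹) • C₁ +
            ((r (a.1 0))⁻¹ ^ 3 - (r (b.1 0))⁻¹ ^ 3) • Y₁ := by
          rw [hM, hM]; module
        rw [h1]
        exact T.add_mem (T.smul_mem _ hCT) (T.smul_mem _ (hvT 0))
      | succ k =>
        refine LieSubalgebra.lieSpan_le.2 ?_
        rintro x (hx | ⟨c, hc, a, rfl⟩)
        · exact ih hx
        · exact hMT c (ih hc) a
  have one_le : ∀ k, chain M 1 ≤ chain M (k + 1) := by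
    intro k
    induction k with
    | zero => exact le_rfl
    | succ k ih => exact ih.trans (chain_le_succ M _)
  have v_mem : ∀ k, v k ∈ chain M (k + 1) := by
    intro k
    induction k with
    | zero => exact hY₁
    | succ k ih =>
      have h1 := lie_mem_chain M ih ⟨_, hne.some_mem⟩
      rw [hvM] at h1
      have h2 := LieSubalgebra.lie_mem _ (one_le (k + 1) hY₁) (chain_le_succ M _ ih)
      have h3 := sub_mem ((chain M (k + 2)).smul_mem (-(r (hne.some 0))⁻¹ ^ 3) h2) h1
      rwa [sub_sub_cancel] at h3
  have le_chain : T ≤ chain M 5 := by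
    refine LieSubalgebra.lieSpan_le.2 ?_
    rintro _ (rfl | ⟨k, rfl⟩)
    · exact one_le 4 hC₁
    · have up := chain_le_succ M
      match k with
      | 0 => exact up _ (up _ (up _ (up _ (v_mem 0))))
      | 1 => exact up _ (up _ (up _ (v_mem 1)))
      | 2 => exact up _ (up _ (v_mem 2))
      | 3 => exact up _ (v_mem 3)
      | 4 => exact v_mem 4
      | k + 5 => rw [v5]; exact (chain M 5).zero_mem
  refine Set.Subset.antisymm (Set.subset_iUnion (fun k => (chain M k : Set L)) 5) ?_
  exact Set.iUnion_subset fun k => (chain_le k).trans le_chain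

end Chain

/-! ### The isomorphism of the Wahlquist-Estabrook algebra with `ℂ² ⊕ 𝔤` -/

section WEMain

variable {U : Set ℂ} {r : ℂ → ℂ} {Ω : Set (Fin 5 → ℂ)}

/-- The Wahlquist-Estabrook algebra maps to `ℂ² ⊕ 𝔤` by the values of the letters. The map is
injective, as all relations valid in `ℂ² ⊕ 𝔤` have been imposed. -/
theorem exists_weData (hU : IsOpen U) (hr : AnalyticOnNhd ℂ r U) (hsq : ∀ u ∈ U, r u ^ 2 = u)
    (hΩ : IsOpen Ω) (hc : IsConnected Ω) (hΩU : ∀ z ∈ Ω, z 0 ∈ U) :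
    ∃ W : WEData.{w} 5 Ω (hdFlux r),
      (∃ e : W.Algebra ≃ₗ⁅ℂ⁆ (ℂ × ℂ) × gAlg, ∀ z ∈ Ω,
        e (W.A (z 0)) = (((r (z 0))⁻¹, 0), ((r (z 0))⁻¹ ^ 3) • x₁ + x₂)) ∧
      (chain (fun z : Ω => W.A (z.1 0)) 5 : Set W.Algebra) =
        ⋃ k, (chain (fun z : Ω => W.A (z.1 0)) k : Set W.Algebra) := by
  let W := hdWE.{w} hU hr hsq hΩ hc hΩU
  let I : LieIdeal ℂ (FreeLieAlgebra ℂ (Fin 3 ⊕ Fin 8)) := LieSubmodule.lieSpan ℂ _ W.rel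
  let φ := FreeLieAlgebra.lift ℂ hdLetters
  let ε : W.Algebra →ₗ⁅ℂ⁆ (ℂ × ℂ) × gAlg := idealLift I φ (lieSpan_le_ker φ fun x hx => hx)
  have hε : ∀ i, ε (W.letter i) = hdLetters i := fun i => FreeLieAlgebra.lift_of_apply _ _
  have inj : ∀ x, ε x = 0 → x = 0 := by
    intro x hx
    obtain ⟨a, rfl⟩ := idealMk_surjective I x
    exact idealMk_eq_zero.2 (LieSubmodule.subset_lieSpan (show φ a = 0 from hx))
  have hmem : ∀ i, hdLetters i ∈ ε.range := fun i => ⟨_, hε i⟩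
  have hg : ∀ y : gAlg, ((0, y) : (ℂ × ℂ) × gAlg) ∈ ε.range := by
    intro y
    have hy : y ∈ LieSubalgebra.lieSpan ℂ gAlg {x₁, x₂} := lieSpan_x ▸ LieSubalgebra.mem_top y
    induction hy using LieSubalgebra.lieSpan_induction with
    | mem y hy =>
      rcases hy with rfl | rfl
      · exact hmem (Sum.inl 1)
      · exact hmem (Sum.inl 2)
    | zero => exact ε.range.zero_mem
    | smul c y _ hy =>
      have h1 := ε.range.smul_mem c hy
      rwa [Prod.smul_mk, smul_zero] at h1
    | add y z _ _ hy hz =>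
      have h1 := ε.range.add_mem hy hz
      rwa [Prod.mk_add_mk, add_zero] at h1
    | lie y z _ _ hy hz =>
      have h1 := ε.range.lie_mem hy hz
      have h2 : ⁅((0, y) : (ℂ × ℂ) × gAlg), ((0, z) : (ℂ × ℂ) × gAlg)⁆ = (0, ⁅y, z⁆) :=
        Prod.ext (lie_self _) rfl
      rwa [h2] at h1
  have surj : Function.Surjective ε := by
    rintro ⟨⟨a, b⟩, y⟩
    have h1 := ε.range.add_mem (ε.range.add_mem (ε.range.smul_mem a (hmem (Sum.inl 0)))
      (ε.range.smul_mem b (hmem (Sum.inr 7)))) (hg y)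
    have h2 : a • hdLetters (Sum.inl 0) + b • hdLetters (Sum.inr 7) + (0, y) = ((a, b), y) := by
      change a • (((1, 0), 0) : (ℂ × ℂ) × gAlg) + b • (((0, 1), 0) : (ℂ × ℂ) × gAlg) + (0, y) = _
      simp
    rw [h2] at h1
    exact h1
  have hA : ∀ u, W.A u = (r u)⁻¹ • W.letter (Sum.inl (0 : Fin 3)) +
      (r u)⁻¹ ^ 3 • W.letter (Sum.inl (1 : Fin 3)) + W.letter (Sum.inl (2 : Fin 3)) := fun u =>
    sum_hdF r (fun i : Fin 3 => W.letter (Sum.inl i)) u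
  refine ⟨W, ⟨LieEquiv.ofBijective ε ⟨(injective_iff_map_eq_zero _).2 inj, surj⟩, ?_⟩, ?_⟩
  · intro z _
    change ε (W.A (z 0)) = _
    rw [hA, map_add, map_add, map_smul, map_smul, hε, hε, hε]
    change _ • (((1, 0), 0) : (ℂ × ℂ) × gAlg) + _ • ((0, x₁) : (ℂ × ℂ) × gAlg) + (0, x₂) = _
    simp
  · have hrel : HDRel (W.letter (Sum.inl (0 : Fin 3))) (W.letter (Sum.inr (7 : Fin 8)))
        (W.letter (Sum.inl (1 : Fin 3))) (W.letter (Sum.inl (2 : Fin 3))) := by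
      refine HDRel.of_map inj ?_
      rw [hε, hε, hε, hε]
      exact hdRel_prod
    exact hrel.chain_five hsq hΩ hc.nonempty hΩU fun z => hA _

end WEMain

/-! ### Calculus on jet spaces -/

section JetCalculus

/-- The direction of `∂/∂x` in the space of jets of order `p`. -/
def dirX (p : ℕ) : JetSpace p := (1, 0, 0)

/-- The direction of `∂/∂t` in the space of jets of order `p`. -/
def dirT (p : ℕ) : JetSpace p := (0, 1, 0)

/-- The direction of `∂/∂v_j` in the space of jets of order `p`; it is zero for `j > p`. -/
def dirV (p j : ℕ) : JetSpace p := (0, 0, fun i => if (i : ℕ) = j then 1 else 0)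

/-- The projection to jets of lower order. -/
def jetRes {p p' : ℕ} (h : p ≤ p') : JetSpace p' →L[ℂ] JetSpace p :=
  (ContinuousLinearMap.id ℂ ℂ).prodMap ((ContinuousLinearMap.id ℂ ℂ).prodMap
    (ContinuousLinearMap.pi fun i => ContinuousLinearMap.proj (Fin.castLE (Nat.succ_le_succ h) i)))

/-- The linear map `(x, t, v, v₁, …) ↦ (0, 0, v₁, v₂, …)`. -/
def jetShift (p : ℕ) : JetSpace (p + 1) →L[ℂ] JetSpace p :=
  (0 : JetSpace (p + 1) →L[ℂ] ℂ).prod ((0 : JetSpace (p + 1) →L[ℂ] ℂ).prod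
    ((ContinuousLinearMap.pi fun i : Fin (p + 1) => ContinuousLinearMap.proj (R := ℂ)
      (φ := fun _ : Fin (p + 2) => ℂ) i.succ).comp
    ((ContinuousLinearMap.snd ℂ ℂ _).comp (ContinuousLinearMap.snd ℂ ℂ _))))

theorem jetRes_trunc {p p' : ℕ} (h : p ≤ p') (J : Jet) : jetRes h (J.trunc p') = J.trunc p := rfl

theorem jetRes_dirV {p p' : ℕ} (h : p ≤ p') (j : ℕ) : jetRes h (dirV p' j) = dirV p j := rfl

theorem jetShift_trunc (p : ℕ) (J : Jet) :
    jetShift p (J.trunc (p + 1)) = ((0, 0, fun i => J.v (i + 1)) : JetSpace p) := rfl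

theorem jetShift_dirV_succ (p j : ℕ) : jetShift p (dirV (p + 1) (j + 1)) = dirV p j := by
  refine Prod.ext rfl (Prod.ext rfl (funext fun i => ?_))
  simp [jetShift, dirV]

theorem dirV_of_lt {p j : ℕ} (h : p < j) : dirV p j = 0 := by
  refine Prod.ext rfl (Prod.ext rfl (funext fun i => ?_))
  have := i.2
  exact if_neg (by omega)

theorem jet_eq_sum {p : ℕ} (a b : ℂ) (y : Fin (p + 1) → ℂ) :
    ((a, b, y) : JetSpace p) = a • dirX p + b • dirT p + ∑ i, y i • dirV p i := by
  refine Prod.ext ?_ (Prod.ext ?_ (funext fun i => ?_))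
  · simp [dirX, dirT, dirV, Prod.fst_sum]
  · simp [dirX, dirT, dirV, Prod.snd_sum, Prod.fst_sum]
  · simp [dirX, dirT, dirV, Prod.snd_sum, Finset.sum_apply, Fin.val_inj, eq_comm]

theorem hasDerivAt_trunc_x (J : Jet) (p : ℕ) (s : ℂ) :
    HasDerivAt (fun s => Jet.trunc p ⟨s, J.t, J.v⟩) (dirX p) s :=
  (hasDerivAt_id s).prodMk (hasDerivAt_const s (J.t, fun i : Fin (p + 1) => J.v i))

theorem hasDerivAt_trunc_t (J : Jet) (p : ℕ) (s : ℂ) :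
    HasDerivAt (fun s => Jet.trunc p ⟨J.x, s, J.v⟩) (dirT p) s :=
  (hasDerivAt_const s J.x).prodMk ((hasDerivAt_id s).prodMk
    (hasDerivAt_const s fun i : Fin (p + 1) => J.v i))

theorem hasDerivAt_trunc_v (J : Jet) (j p : ℕ) (s : ℂ) :
    HasDerivAt (fun s => Jet.trunc p ⟨J.x, J.t, Function.update J.v j s⟩) (dirV p j) s := by
  refine (hasDerivAt_const s _).prodMk ((hasDerivAt_const s _).prodMk
    (hasDerivAt_pi.2 fun i => ?_))
  by_cases h : (i : ℕ) = j
  · simp only [h, Function.update_self, if_true]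
    exact hasDerivAt_id s
  · simp only [Function.update_of_ne h, h, if_false]
    exact hasDerivAt_const s _

variable {m : ℕ} {Ω : Set (JetSpace m)} {p : ℕ} {F : JetSpace p → ℂ} {f g : Jet → ℂ}

/-- Over the open set `Ω` of jets of order `m`, the function `f` is given by the analytic function
`F` of jets of order `p`. The order `p` may differ from `m`, so that the set `Ω` need not be changed
when the total derivative raises the order. -/
structure Rep (Ω : Set (JetSpace m)) (p : ℕ) (F : JetSpace p → ℂ) (f : Jet → ℂ) : Prop where
  analytic : ∀ J : Jet, J.trunc m ∈ Ω → AnalyticAt ℂ F (J.trunc p)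
  eq : ∀ J : Jet, J.trunc m ∈ Ω → f J = F (J.trunc p)

theorem Rep.congr (h : Rep Ω p F f) (hfg : ∀ J : Jet, J.trunc m ∈ Ω → f J = g J) : Rep Ω p F g :=
  ⟨h.analytic, fun J hJ => (hfg J hJ).symm.trans (h.eq J hJ)⟩

/-- The chain rule along a curve of infinite jets. -/
theorem Rep.hasDerivAt (hΩ : IsOpen Ω) (h : Rep Ω p F f) {γ : ℂ → Jet} {s : ℂ}
    {e : ∀ p, JetSpace p} (hγ : ∀ p, HasDerivAt (fun s => (γ s).trunc p) (e p) s)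
    (hJ : (γ s).trunc m ∈ Ω) :
    HasDerivAt (fun s => f (γ s)) (fderiv ℂ F ((γ s).trunc p) (e p)) s := by
  refine ((h.analytic _ hJ).differentiableAt.hasFDerivAt.comp_hasDerivAt s
    (hγ p)).congr_of_eventuallyEq ?_
  filter_upwards [(hγ m).continuousAt.preimage_mem_nhds (hΩ.mem_nhds hJ)] with s hs
  exact h.eq _ hs

theorem Rep.hasDerivAt_v (hΩ : IsOpen Ω) (h : Rep Ω p F f) (j : ℕ) {J : Jet}
    (hJ : J.trunc m ∈ Ω) : HasDerivAt (fun s => f ⟨J.x, J.t, Function.update J.v j s⟩)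
      (fderiv ℂ F (J.trunc p) (dirV p j)) (J.v j) := by
  have h0 : (⟨J.x, J.t, Function.update J.v j (J.v j)⟩ : Jet) = J := by
    rw [Function.update_eq_self]
  have h1 := h.hasDerivAt hΩ (γ := fun s => ⟨J.x, J.t, Function.update J.v j s⟩)
    (fun p => hasDerivAt_trunc_v J j p (J.v j)) (by rw [h0]; exact hJ)
  rwa [h0] at h1

theorem Rep.pdV_eq (hΩ : IsOpen Ω) (h : Rep Ω p F f) (j : ℕ) {J : Jet} (hJ : J.trunc m ∈ Ω) :
    pdV j f J = fderiv ℂ F (J.trunc p) (dirV p j) := (h.hasDerivAt_v hΩ j hJ).deriv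

theorem Rep.pdX_eq (hΩ : IsOpen Ω) (h : Rep Ω p F f) {J : Jet} (hJ : J.trunc m ∈ Ω) :
    pdX f J = fderiv ℂ F (J.trunc p) (dirX p) :=
  (h.hasDerivAt hΩ (γ := fun s => ⟨s, J.t, J.v⟩) (fun p => hasDerivAt_trunc_x J p J.x) hJ).deriv

theorem Rep.pdT_eq (hΩ : IsOpen Ω) (h : Rep Ω p F f) {J : Jet} (hJ : J.trunc m ∈ Ω) :
    pdT f J = fderiv ℂ F (J.trunc p) (dirT p) :=
  (h.hasDerivAt hΩ (γ := fun s => ⟨J.x, s, J.v⟩) (fun p => hasDerivAt_trunc_t J p J.t) hJ).deriv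

theorem Rep.pdV_of_lt (hΩ : IsOpen Ω) (h : Rep Ω p F f) {j : ℕ} (hj : p < j) {J : Jet}
    (hJ : J.trunc m ∈ Ω) : pdV j f J = 0 := by
  rw [h.pdV_eq hΩ j hJ, dirV_of_lt hj, map_zero]

theorem Rep.finsum_pdV (hΩ : IsOpen Ω) (h : Rep Ω p F f) {J : Jet} (hJ : J.trunc m ∈ Ω)
    (c : ℕ → ℂ) : ∑ᶠ j : ℕ, c j * pdV j f J = ∑ j ∈ Finset.range (p + 1), c j * pdV j f J := by
  refine finsum_eq_sum_of_support_subset _ fun j hj => ?_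
  rw [Finset.coe_range, Set.mem_Iio]
  by_contra hle
  refine hj ?_
  change c j * _ = 0
  rw [h.pdV_of_lt hΩ (by omega) hJ, mul_zero]

theorem Rep.fderiv_apply (hΩ : IsOpen Ω) (h : Rep Ω p F f) {J : Jet} (hJ : J.trunc m ∈ Ω)
    (a b : ℂ) (c : ℕ → ℂ) : fderiv ℂ F (J.trunc p) (a, b, fun i => c i) =
      a * pdX f J + b * pdT f J + ∑ᶠ j : ℕ, c j * pdV j f J := by
  rw [h.finsum_pdV hΩ hJ, jet_eq_sum, map_add, map_add, map_sum, map_smul, map_smul,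
    ← h.pdX_eq hΩ hJ, ← h.pdT_eq hΩ hJ, Finset.sum_range]
  simp only [map_smul, smul_eq_mul, ← h.pdV_eq hΩ _ hJ]

theorem Rep.totalDx_eq (hΩ : IsOpen Ω) (h : Rep Ω p F f) {J : Jet} (hJ : J.trunc m ∈ Ω) :
    totalDx f J = fderiv ℂ F (J.trunc p) (dirX p + jetShift p (J.trunc (p + 1))) := by
  have h1 := h.fderiv_apply hΩ hJ 1 0 fun i => J.v (i + 1)
  rw [one_mul, zero_mul, add_zero] at h1
  rw [totalDx, ← h1]
  congr 1
  refine Prod.ext ?_ (Prod.ext ?_ (funext fun i => ?_)) <;>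
    simp [dirX, jetShift_trunc]

theorem Rep.mono {p' : ℕ} (h : Rep Ω p F f) (hp : p ≤ p') : Rep Ω p' (fun z => F (jetRes hp z)) f :=
  ⟨fun J hJ => AnalyticAt.comp (g := F) (f := jetRes hp) (h.analytic J hJ)
    ((jetRes hp).analyticAt _), h.eq⟩

theorem analyticAt_clm_apply {E E' : Type*} [NormedAddCommGroup E] [NormedSpace ℂ E]
    [NormedAddCommGroup E'] [NormedSpace ℂ E'] {G : E → E' →L[ℂ] ℂ} {g : E → E'} {z : E}
    (hG : AnalyticAt ℂ G z) (hg : AnalyticAt ℂ g z) : AnalyticAt ℂ (fun z => G z (g z)) z :=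
  ((ContinuousLinearMap.apply ℂ ℂ : E' →L[ℂ] (E' →L[ℂ] ℂ) →L[ℂ] ℂ).analyticAt_bilinear
    (g z, G z)).comp (f := fun z => (g z, G z)) (hg.prod hG)

theorem analyticAt_fderiv_apply {E : Type*} [NormedAddCommGroup E] [NormedSpace ℂ E] {F : E → ℂ}
    {z : E} (h : AnalyticAt ℂ F z) (y : E) : AnalyticAt ℂ (fun z => fderiv ℂ F z y) z :=
  analyticAt_clm_apply h.fderiv analyticAt_const

theorem Rep.pdV (hΩ : IsOpen Ω) (h : Rep Ω p F f) (j : ℕ) :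
    Rep Ω p (fun z => fderiv ℂ F z (dirV p j)) (pdV j f) :=
  ⟨fun J hJ => analyticAt_fderiv_apply (h.analytic J hJ) _, fun _ hJ => h.pdV_eq hΩ j hJ⟩

theorem Rep.pdX (hΩ : IsOpen Ω) (h : Rep Ω p F f) :
    Rep Ω p (fun z => fderiv ℂ F z (dirX p)) (pdX f) :=
  ⟨fun J hJ => analyticAt_fderiv_apply (h.analytic J hJ) _, fun _ hJ => h.pdX_eq hΩ hJ⟩

theorem Rep.pdT (hΩ : IsOpen Ω) (h : Rep Ω p F f) :
    Rep Ω p (fun z => fderiv ℂ F z (dirT p)) (pdT f) :=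
  ⟨fun J hJ => analyticAt_fderiv_apply (h.analytic J hJ) _, fun _ hJ => h.pdT_eq hΩ hJ⟩

theorem Rep.totalDx (hΩ : IsOpen Ω) (h : Rep Ω p F f) :
    Rep Ω (p + 1) (fun z => fderiv ℂ F (jetRes p.le_succ z) (dirX p + jetShift p z))
      (totalDx f) := by
  refine ⟨fun J hJ => ?_, fun J hJ => h.totalDx_eq hΩ hJ⟩
  have h1 : AnalyticAt ℂ (fun z => fderiv ℂ F (jetRes p.le_succ z)) (J.trunc (p + 1)) :=
    AnalyticAt.comp (g := fderiv ℂ F) (f := jetRes p.le_succ) (h.analytic J hJ).fderiv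
      ((jetRes p.le_succ).analyticAt _)
  exact analyticAt_clm_apply h1 (analyticAt_const.add ((jetShift p).analyticAt _))

/-- Mixed derivatives of an analytic function. -/
theorem fderiv_fderiv_apply {E : Type*} [NormedAddCommGroup E] [NormedSpace ℂ E] {F : E → ℂ} {z : E}
    (h : AnalyticAt ℂ F z) (a b : E) :
    fderiv ℂ (fun z => fderiv ℂ F z a) z b = fderiv ℂ (fderiv ℂ F) z b a := by
  rw [fderiv_clm_apply h.fderiv.differentiableAt (differentiableAt_const a)]
  simp

theorem fderiv_fderiv_symm {E : Type*} [NormedAddCommGroup E] [NormedSpace ℂ E] {F : E → ℂ} {z : E}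
    (h : AnalyticAt ℂ F z) (a b : E) :
    fderiv ℂ (fderiv ℂ F) z a b = fderiv ℂ (fderiv ℂ F) z b a :=
  (h.contDiffAt (n := 2)).isSymmSndFDerivAt (by simp) _ _

theorem Rep.pdV_pdV_comm (hΩ : IsOpen Ω) (h : Rep Ω p F f) (i j : ℕ) {J : Jet}
    (hJ : J.trunc m ∈ Ω) : Miura.pdV i (Miura.pdV j f) J = Miura.pdV j (Miura.pdV i f) J := by
  rw [(h.pdV hΩ j).pdV_eq hΩ i hJ, (h.pdV hΩ i).pdV_eq hΩ j hJ,
    fderiv_fderiv_apply (h.analytic J hJ), fderiv_fderiv_apply (h.analytic J hJ),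
    fderiv_fderiv_symm (h.analytic J hJ)]

theorem Rep.pdV_pdT_comm (hΩ : IsOpen Ω) (h : Rep Ω p F f) (i : ℕ) {J : Jet}
    (hJ : J.trunc m ∈ Ω) : Miura.pdV i (Miura.pdT f) J = Miura.pdT (Miura.pdV i f) J := by
  rw [(h.pdT hΩ).pdV_eq hΩ i hJ, (h.pdV hΩ i).pdT_eq hΩ hJ,
    fderiv_fderiv_apply (h.analytic J hJ), fderiv_fderiv_apply (h.analytic J hJ),
    fderiv_fderiv_symm (h.analytic J hJ)]

/-- The commutator of `∂/∂v_{i+1}` with the total derivative is `∂/∂v_i`. -/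
theorem Rep.pdV_totalDx (hΩ : IsOpen Ω) (h : Rep Ω p F f) (i : ℕ) {J : Jet}
    (hJ : J.trunc m ∈ Ω) : Miura.pdV (i + 1) (Miura.totalDx f) J =
      Miura.totalDx (Miura.pdV (i + 1) f) J + Miura.pdV i f J := by
  have hF := h.analytic J hJ
  have h1 : HasFDerivAt (fun z => fderiv ℂ F (jetRes p.le_succ z))
      ((fderiv ℂ (fderiv ℂ F) (J.trunc p)).comp (jetRes p.le_succ)) (J.trunc (p + 1)) :=
    HasFDerivAt.comp (g := fderiv ℂ F) (f := jetRes p.le_succ) _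
      hF.fderiv.differentiableAt.hasFDerivAt (jetRes p.le_succ).hasFDerivAt
  have h2 := h1.clm_apply ((jetShift p).hasFDerivAt.const_add (dirX p))
  rw [(h.totalDx hΩ).pdV_eq hΩ _ hJ, h2.fderiv, (h.pdV hΩ (i + 1)).totalDx_eq hΩ hJ,
    h.pdV_eq hΩ i hJ, fderiv_fderiv_apply hF, fderiv_fderiv_symm hF]
  simp only [add_apply, ContinuousLinearMap.comp_apply,
    ContinuousLinearMap.flip_apply, jetShift_dirV_succ, jetRes_dirV, jetRes_trunc]
  exact add_comm _ _

end JetCalculus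

/-! ### Analytic functions of jets of finite order -/

section JetFunctions

variable {m : ℕ} {Ω : Set (JetSpace m)} {p : ℕ} {f g : Jet → ℂ}

/-- Over the open set `Ω` of jets of order `m`, the function `f` is an analytic function of jets of
order `p`. -/
def IsJetFun (Ω : Set (JetSpace m)) (p : ℕ) (f : Jet → ℂ) : Prop := ∃ F, Rep Ω p F f

theorem trunc_surjective (m : ℕ) : Function.Surjective (Jet.trunc m) := fun z =>
  ⟨⟨z.1, z.2.1, fun k => if h : k < m + 1 then z.2.2 ⟨k, h⟩ else 0⟩,
    Prod.ext rfl (Prod.ext rfl (funext fun i => dif_pos i.2))⟩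

theorem isJetFun_iff : IsJetFun Ω m f ↔ IsDiffFun m Ω f := by
  constructor
  · rintro ⟨F, hF⟩
    refine ⟨F, fun z hz => ?_, hF.eq⟩
    obtain ⟨J, rfl⟩ := trunc_surjective m z
    exact hF.analytic J hz
  · rintro ⟨F, hF, hf⟩
    exact ⟨F, fun J hJ => hF _ hJ, hf⟩

theorem IsJetFun.mono {p' : ℕ} (h : IsJetFun Ω p f) (hp : p ≤ p') : IsJetFun Ω p' f :=
  let ⟨_, hF⟩ := h; ⟨_, hF.mono hp⟩

theorem IsJetFun.congr (h : IsJetFun Ω p f) (hfg : ∀ J : Jet, J.trunc m ∈ Ω → f J = g J) :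
    IsJetFun Ω p g :=
  let ⟨_, hF⟩ := h; ⟨_, hF.congr hfg⟩

theorem isJetFun_const (c : ℂ) : IsJetFun Ω p fun _ => c :=
  ⟨fun _ => c, fun _ _ => analyticAt_const, fun _ _ => rfl⟩

theorem isJetFun_v {j : ℕ} (hj : j ≤ p) : IsJetFun Ω p fun J => J.v j := by
  refine ⟨fun z => z.2.2 ⟨j, Nat.lt_succ_of_le hj⟩, fun J _ => ?_, fun _ _ => rfl⟩
  exact (((ContinuousLinearMap.proj (R := ℂ) (φ := fun _ : Fin (p + 1) => ℂ)
    ⟨j, Nat.lt_succ_of_le hj⟩).comp ((ContinuousLinearMap.snd ℂ ℂ _).comp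
      (ContinuousLinearMap.snd ℂ ℂ _))).analyticAt _)

theorem IsJetFun.add (hf : IsJetFun Ω p f) (hg : IsJetFun Ω p g) :
    IsJetFun Ω p fun J => f J + g J := by
  obtain ⟨F, hF⟩ := hf
  obtain ⟨G, hG⟩ := hg
  exact ⟨fun z => F z + G z, fun J hJ => (hF.analytic J hJ).add (hG.analytic J hJ), fun J hJ => by
    rw [hF.eq J hJ, hG.eq J hJ]⟩

theorem IsJetFun.sum {ι : Type*} {s : Finset ι} {f : ι → Jet → ℂ}
    (hf : ∀ i ∈ s, IsJetFun Ω p (f i)) : IsJetFun Ω p fun J => ∑ i ∈ s, f i J := by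
  classical
  induction s using Finset.induction_on with
  | empty => simpa using isJetFun_const 0
  | insert a s ha ih =>
    simp only [Finset.sum_insert ha]
    exact (hf a (Finset.mem_insert_self a s)).add
      (ih fun i hi => hf i (Finset.mem_insert_of_mem hi))

theorem IsJetFun.sub (hf : IsJetFun Ω p f) (hg : IsJetFun Ω p g) :
    IsJetFun Ω p fun J => f J - g J := by
  obtain ⟨F, hF⟩ := hf
  obtain ⟨G, hG⟩ := hg
  exact ⟨fun z => F z - G z, fun J hJ => (hF.analytic J hJ).sub (hG.analytic J hJ), fun J hJ => by
    rw [hF.eq J hJ, hG.eq J hJ]⟩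

theorem IsJetFun.mul (hf : IsJetFun Ω p f) (hg : IsJetFun Ω p g) :
    IsJetFun Ω p fun J => f J * g J := by
  obtain ⟨F, hF⟩ := hf
  obtain ⟨G, hG⟩ := hg
  exact ⟨fun z => F z * G z, fun J hJ => (hF.analytic J hJ).mul (hG.analytic J hJ), fun J hJ => by
    rw [hF.eq J hJ, hG.eq J hJ]⟩

theorem IsJetFun.comp {φ : ℂ → ℂ} (hf : IsJetFun Ω p f)
    (hφ : ∀ J : Jet, J.trunc m ∈ Ω → AnalyticAt ℂ φ (f J)) : IsJetFun Ω p fun J => φ (f J) := by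
  obtain ⟨F, hF⟩ := hf
  refine ⟨fun z => φ (F z), fun J hJ => ?_, fun J hJ => by rw [hF.eq J hJ]⟩
  have h := hφ J hJ
  rw [hF.eq J hJ] at h
  exact AnalyticAt.comp (g := φ) h (hF.analytic J hJ)

theorem IsJetFun.pdV (hΩ : IsOpen Ω) (h : IsJetFun Ω p f) (j : ℕ) : IsJetFun Ω p (pdV j f) :=
  let ⟨_, hF⟩ := h; ⟨_, hF.pdV hΩ j⟩

theorem IsJetFun.pdT (hΩ : IsOpen Ω) (h : IsJetFun Ω p f) : IsJetFun Ω p (pdT f) :=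
  let ⟨_, hF⟩ := h; ⟨_, hF.pdT hΩ⟩

theorem IsJetFun.pdX (hΩ : IsOpen Ω) (h : IsJetFun Ω p f) : IsJetFun Ω p (pdX f) :=
  let ⟨_, hF⟩ := h; ⟨_, hF.pdX hΩ⟩

theorem IsJetFun.totalDx (hΩ : IsOpen Ω) (h : IsJetFun Ω p f) : IsJetFun Ω (p + 1) (totalDx f) :=
  let ⟨_, hF⟩ := h; ⟨_, hF.totalDx hΩ⟩

theorem IsJetFun.iterate (hΩ : IsOpen Ω) (h : IsJetFun Ω p f) (k : ℕ) :
    IsJetFun Ω (p + k) (Miura.totalDx^[k] f) := by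
  induction k with
  | zero => exact h
  | succ k ih => rw [Function.iterate_succ_apply']; exact ih.totalDx hΩ

theorem IsJetFun.hasDerivAt_v (hΩ : IsOpen Ω) (h : IsJetFun Ω p f) (j : ℕ) {J : Jet}
    (hJ : J.trunc m ∈ Ω) : HasDerivAt (fun s => f ⟨J.x, J.t, Function.update J.v j s⟩)
      (Miura.pdV j f J) (J.v j) := by
  obtain ⟨F, hF⟩ := h
  rw [hF.pdV_eq hΩ j hJ]
  exact hF.hasDerivAt_v hΩ j hJ

theorem IsJetFun.pdV_congr (hΩ : IsOpen Ω) (h : IsJetFun Ω p f)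
    (hfg : ∀ J : Jet, J.trunc m ∈ Ω → f J = g J) (j : ℕ) {J : Jet} (hJ : J.trunc m ∈ Ω) :
    Miura.pdV j f J = Miura.pdV j g J := by
  obtain ⟨F, hF⟩ := h
  rw [hF.pdV_eq hΩ j hJ, (hF.congr hfg).pdV_eq hΩ j hJ]

theorem IsJetFun.pdT_congr (hΩ : IsOpen Ω) (h : IsJetFun Ω p f)
    (hfg : ∀ J : Jet, J.trunc m ∈ Ω → f J = g J) {J : Jet} (hJ : J.trunc m ∈ Ω) :
    Miura.pdT f J = Miura.pdT g J := by
  obtain ⟨F, hF⟩ := h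
  rw [hF.pdT_eq hΩ hJ, (hF.congr hfg).pdT_eq hΩ hJ]

theorem IsJetFun.totalDx_congr (hΩ : IsOpen Ω) (h : IsJetFun Ω p f)
    (hfg : ∀ J : Jet, J.trunc m ∈ Ω → f J = g J) {J : Jet} (hJ : J.trunc m ∈ Ω) :
    Miura.totalDx f J = Miura.totalDx g J := by
  obtain ⟨F, hF⟩ := h
  rw [hF.totalDx_eq hΩ hJ, (hF.congr hfg).totalDx_eq hΩ hJ]

theorem pdV_mul (hΩ : IsOpen Ω) (hf : IsJetFun Ω p f) (hg : IsJetFun Ω p g) (j : ℕ) {J : Jet}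
    (hJ : J.trunc m ∈ Ω) :
    pdV j (fun J => f J * g J) J = pdV j f J * g J + f J * pdV j g J := by
  have h := (hf.hasDerivAt_v hΩ j hJ).mul (hg.hasDerivAt_v hΩ j hJ)
  simp only [Function.update_eq_self] at h
  exact h.deriv

theorem pdV_add (hΩ : IsOpen Ω) (hf : IsJetFun Ω p f) (hg : IsJetFun Ω p g) (j : ℕ) {J : Jet}
    (hJ : J.trunc m ∈ Ω) : pdV j (fun J => f J + g J) J = pdV j f J + pdV j g J :=
  ((hf.hasDerivAt_v hΩ j hJ).add (hg.hasDerivAt_v hΩ j hJ)).deriv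

theorem pdV_sum (hΩ : IsOpen Ω) {ι : Type*} {s : Finset ι} {f : ι → Jet → ℂ}
    (hf : ∀ i ∈ s, IsJetFun Ω p (f i)) (j : ℕ) {J : Jet} (hJ : J.trunc m ∈ Ω) :
    pdV j (fun J => ∑ i ∈ s, f i J) J = ∑ i ∈ s, pdV j (f i) J :=
  (HasDerivAt.fun_sum fun i hi => (hf i hi).hasDerivAt_v hΩ j hJ).deriv

theorem pdV_comp (hΩ : IsOpen Ω) {φ : ℂ → ℂ} (hf : IsJetFun Ω p f) (j : ℕ) {J : Jet}
    (hJ : J.trunc m ∈ Ω) (hφ : DifferentiableAt ℂ φ (f J)) :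
    pdV j (fun J => φ (f J)) J = deriv φ (f J) * pdV j f J := by
  have h1 := hf.hasDerivAt_v hΩ j hJ
  have h2 : HasDerivAt φ (deriv φ (f J)) (f ⟨J.x, J.t, Function.update J.v j (J.v j)⟩) := by
    rw [Function.update_eq_self]; exact hφ.hasDerivAt
  exact (h2.comp (J.v j) h1).deriv

theorem pdV_const (c : ℂ) (j : ℕ) (J : Jet) : pdV j (fun _ => c) J = 0 := deriv_const _ c

theorem totalDx_const (c : ℂ) (J : Jet) : totalDx (fun _ => c) J = 0 := by
  simp [totalDx, pdX, pdV]

theorem pdV_v (i j : ℕ) (J : Jet) : pdV i (fun J => J.v j) J = if i = j then 1 else 0 := by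
  rw [pdV]
  split_ifs with h
  · subst h; simp
  · simp [Function.update_of_ne (Ne.symm h)]

theorem totalDx_v (j : ℕ) (J : Jet) : totalDx (fun J => J.v j) J = J.v (j + 1) := by
  have h1 : pdX (fun J => J.v j) J = 0 := deriv_const _ _
  rw [totalDx, h1, zero_add, finsum_eq_single _ j]
  · simp [pdV_v]
  · intro i hi
    simp [pdV_v, hi]

theorem totalDx_mul (hΩ : IsOpen Ω) (hf : IsJetFun Ω p f) (hg : IsJetFun Ω p g) {J : Jet}
    (hJ : J.trunc m ∈ Ω) :
    totalDx (fun J => f J * g J) J = totalDx f J * g J + f J * totalDx g J := by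
  obtain ⟨F, hF⟩ := hf
  obtain ⟨G, hG⟩ := hg
  have hFG : Rep Ω p (fun z => F z * G z) fun J => f J * g J :=
    ⟨fun J hJ => (hF.analytic J hJ).mul (hG.analytic J hJ), fun J hJ => by
      rw [hF.eq J hJ, hG.eq J hJ]⟩
  rw [hFG.totalDx_eq hΩ hJ, hF.totalDx_eq hΩ hJ, hG.totalDx_eq hΩ hJ, hF.eq J hJ, hG.eq J hJ,
    fderiv_fun_mul (hF.analytic J hJ).differentiableAt (hG.analytic J hJ).differentiableAt]
  simp only [add_apply, smul_apply, smul_eq_mul]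
  ring

theorem totalDx_add (hΩ : IsOpen Ω) (hf : IsJetFun Ω p f) (hg : IsJetFun Ω p g) {J : Jet}
    (hJ : J.trunc m ∈ Ω) :
    totalDx (fun J => f J + g J) J = totalDx f J + totalDx g J := by
  obtain ⟨F, hF⟩ := hf
  obtain ⟨G, hG⟩ := hg
  have hFG : Rep Ω p (fun z => F z + G z) fun J => f J + g J :=
    ⟨fun J hJ => (hF.analytic J hJ).add (hG.analytic J hJ), fun J hJ => by
      rw [hF.eq J hJ, hG.eq J hJ]⟩
  rw [hFG.totalDx_eq hΩ hJ, hF.totalDx_eq hΩ hJ, hG.totalDx_eq hΩ hJ,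
    fderiv_fun_add (hF.analytic J hJ).differentiableAt (hG.analytic J hJ).differentiableAt]
  rfl

theorem IsJetFun.totalDx_eq_zero (hΩ : IsOpen Ω) (h : ∀ J : Jet, J.trunc m ∈ Ω → f J = 0)
    {J : Jet} (hJ : J.trunc m ∈ Ω) : Miura.totalDx f J = 0 := by
  rw [← (isJetFun_const (p := m) (Ω := Ω) 0).totalDx_congr hΩ (fun J hJ => (h J hJ).symm) hJ,
    totalDx_const]

theorem IsJetFun.totalDt_eq (hΩ : IsOpen Ω) (hf : IsJetFun Ω p f) (R : Jet → ℂ) {J : Jet}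
    (hJ : J.trunc m ∈ Ω) : totalDt R f J = Miura.pdT f J +
      ∑ j ∈ Finset.range (p + 1), (Miura.totalDx^[j] R) J * Miura.pdV j f J := by
  obtain ⟨F, hF⟩ := hf
  rw [totalDt, hF.finsum_pdV hΩ hJ]

/-- If `f` does not depend on `v_i`, `i > k`, then the leading term of `D^j f` is
`∂f/∂v_k · v_{k+j}`. -/
theorem IsJetFun.pdV_iterate (hΩ : IsOpen Ω) (hf : IsJetFun Ω p f) {k : ℕ}
    (h : ∀ i, k < i → ∀ J : Jet, J.trunc m ∈ Ω → Miura.pdV i f J = 0) (j : ℕ) :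
    (∀ i, k + j < i → ∀ J : Jet, J.trunc m ∈ Ω → Miura.pdV i (Miura.totalDx^[j] f) J = 0) ∧
      ∀ J : Jet, J.trunc m ∈ Ω → Miura.pdV (k + j) (Miura.totalDx^[j] f) J = Miura.pdV k f J := by
  induction j with
  | zero => exact ⟨h, fun _ _ => rfl⟩
  | succ j ih =>
    obtain ⟨F, hF⟩ := hf.iterate hΩ j
    constructor
    · intro i hi J hJ
      obtain ⟨i, rfl⟩ : ∃ i', i = i' + 1 := ⟨i - 1, by omega⟩
      rw [Function.iterate_succ_apply', hF.pdV_totalDx hΩ i hJ, ih.1 i (by omega) J hJ,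
        IsJetFun.totalDx_eq_zero hΩ (ih.1 (i + 1) (by omega)) hJ, add_zero]
    · intro J hJ
      rw [Function.iterate_succ_apply', ← add_assoc, hF.pdV_totalDx hΩ _ hJ, ih.2 J hJ,
        IsJetFun.totalDx_eq_zero hΩ (ih.1 (k + j + 1) (by omega)) hJ, zero_add]

/-- Analytic functions on a connected set have no zero divisors. -/
theorem IsJetFun.eq_zero_of_mul_eq_zero (hΩ : IsOpen Ω) (hc : IsConnected Ω) (hf : IsJetFun Ω m f)
    (hg : IsJetFun Ω m g) (h : ∀ J : Jet, J.trunc m ∈ Ω → f J * g J = 0) {J₀ : Jet}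
    (hJ₀ : J₀.trunc m ∈ Ω) (hg₀ : g J₀ ≠ 0) : ∀ J : Jet, J.trunc m ∈ Ω → f J = 0 := by
  obtain ⟨F, hF⟩ := hf
  obtain ⟨G, hG⟩ := hg
  have hF' : AnalyticOnNhd ℂ F Ω := fun z hz => by
    obtain ⟨J, rfl⟩ := trunc_surjective m z
    exact hF.analytic J hz
  have h1 : F =ᶠ[nhds (J₀.trunc m)] 0 := by
    have hG₀ : G (J₀.trunc m) ≠ 0 := by rwa [← hG.eq J₀ hJ₀]
    filter_upwards [hΩ.mem_nhds hJ₀,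
      (hG.analytic J₀ hJ₀).continuousAt.eventually_ne hG₀] with z hz hGz
    obtain ⟨J, rfl⟩ := trunc_surjective m z
    have h2 := h J hz
    rw [hF.eq J hz, hG.eq J hz] at h2
    exact (mul_eq_zero.1 h2).resolve_right hGz
  intro J hJ
  rw [hF.eq J hJ]
  exact hF'.eqOn_zero_of_preconnected_of_eventuallyEq_zero hc.isPreconnected hJ₀ h1 hJ

end JetFunctions

/-! ### The order of a Miura type transformation -/

section Order

variable {U : Set ℂ} {r : ℂ → ℂ} {m : ℕ} {Ω : Set (JetSpace m)} {R S : Jet → ℂ}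

/-- The leading term of `D_t S`, when `R` does not depend on `v_i`, `i > k`. -/
theorem pdV_totalDt (hΩ : IsOpen Ω) (hR : IsJetFun Ω m R) (hS : IsJetFun Ω m S) {n k : ℕ}
    (hk : 0 < k) (hSn : ∀ i, n < i → ∀ J : Jet, J.trunc m ∈ Ω → pdV i S J = 0)
    (hRk : ∀ i, k < i → ∀ J : Jet, J.trunc m ∈ Ω → pdV i R J = 0) (hn : n ≤ m) {J : Jet}
    (hJ : J.trunc m ∈ Ω) : pdV (n + k) (totalDt R S) J = pdV k R J * pdV n S J := by
  have hterm : ∀ j ∈ Finset.range (m + 1),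
      IsJetFun Ω (m + m) fun J => (totalDx^[j] R) J * pdV j S J := fun j hj =>
    ((hR.iterate hΩ j).mono (by have := Finset.mem_range.1 hj; omega)).mul
      ((hS.pdV hΩ j).mono (by omega))
  have hzero : IsJetFun Ω m fun _ => 0 := isJetFun_const 0
  have hz : ∀ j, pdV (n + k) (pdV j S) J = 0 := by
    intro j
    obtain ⟨F, hF⟩ := hS
    rw [hF.pdV_pdV_comm hΩ _ _ hJ,
      ← hzero.pdV_congr hΩ (fun J hJ => (hSn (n + k) (by omega) J hJ).symm) j hJ, pdV_const]
  have hzt : pdV (n + k) (pdT S) J = 0 := by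
    obtain ⟨F, hF⟩ := hS
    rw [hF.pdV_pdT_comm hΩ _ hJ,
      ← hzero.pdT_congr hΩ (fun J hJ => (hSn (n + k) (by omega) J hJ).symm) hJ]
    exact deriv_const _ _
  have hsum : IsJetFun Ω (m + m) fun J => ∑ j ∈ Finset.range (m + 1),
      (totalDx^[j] R) J * pdV j S J := IsJetFun.sum hterm
  rw [← (((hS.pdT hΩ).mono (Nat.le_add_right m m)).add hsum).pdV_congr hΩ
    (fun J hJ => (hS.totalDt_eq hΩ R hJ).symm) _ hJ,
    pdV_add hΩ ((hS.pdT hΩ).mono (Nat.le_add_right m m)) hsum _ hJ, hzt, zero_add,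
    pdV_sum hΩ hterm _ hJ, Finset.sum_eq_single_of_mem n (Finset.mem_range.2 (by omega))]
  · rw [pdV_mul hΩ (hR.iterate hΩ n) ((hS.pdV hΩ n).mono (Nat.le_add_right m n)) _ hJ, hz,
      mul_zero, add_zero, add_comm n k, (hR.pdV_iterate hΩ hRk n).2 J hJ]
  · intro j _ hj
    rw [pdV_mul hΩ (hR.iterate hΩ j) ((hS.pdV hΩ j).mono (Nat.le_add_right m j)) _ hJ, hz,
      mul_zero, add_zero]
    rcases lt_or_gt_of_ne hj with hj | hj
    · rw [(hR.pdV_iterate hΩ hRk j).1 (n + k) (by omega) J hJ, zero_mul]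
    · rw [hSn j hj J hJ, mul_zero]

/-- The leading term of the right-hand side of the equation. -/
theorem pdV_hdFlux_prolong (hr : AnalyticOnNhd ℂ r U) (hΩ : IsOpen Ω)
    (hS : IsJetFun Ω m S) (hSU : ∀ J : Jet, J.trunc m ∈ Ω → S J ∈ U) {n k : ℕ} (hk : 5 ≤ k)
    (hSn : ∀ i, n < i → ∀ J : Jet, J.trunc m ∈ Ω → pdV i S J = 0) {J : Jet}
    (hJ : J.trunc m ∈ Ω) : pdV (n + k) (fun J => hdFlux r (prolong S J)) J =
      if k = 5 then r (S J) ^ 5 * pdV n S J else 0 := by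
  have hφ : ∀ J : Jet, J.trunc m ∈ Ω → AnalyticAt ℂ (fun u => r u ^ 5) (S J) := fun J hJ =>
    (hr _ (hSU J hJ)).pow 5
  have h1 : IsJetFun Ω m fun J => r (S J) ^ 5 := hS.comp hφ
  change pdV (n + k) (fun J => r (S J) ^ 5 * (totalDx^[5] S) J) J = _
  rw [pdV_mul hΩ (h1.mono (Nat.le_add_right m 5)) (hS.iterate hΩ 5) _ hJ,
    pdV_comp (φ := fun u => r u ^ 5) hΩ hS _ hJ (hφ J hJ).differentiableAt,
    hSn (n + k) (by omega) J hJ, mul_zero, zero_mul, zero_add]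
  split_ifs with h
  · rw [h, (hS.pdV_iterate hΩ hSn 5).2 J hJ]
  · rw [(hS.pdV_iterate hΩ hSn 5).1 (n + k) (by omega) J hJ, mul_zero]

/-- If `S` had order `n > 5`, then the equation, compared at the highest derivatives, would give
`∂R/∂v₅ = S^{5/2}`, where `R` has order `5`, whereas the right-hand side depends on `v_n`. -/
theorem IsMiura.order_le_five (hU : IsOpen U) (hr : AnalyticOnNhd ℂ r U)
    (hsq : ∀ u ∈ U, r u ^ 2 = u) (h : IsMiura (hdFlux r) (valuesIn U) m Ω R S) {n : ℕ}
    (hn : HasOrder m Ω S n) : n ≤ 5 := by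
  by_contra hn5
  have hΩ := h.isOpen
  have hc := h.isConnected
  have hR : IsJetFun Ω m R := isJetFun_iff.2 h.diffR
  have hS : IsJetFun Ω m S := isJetFun_iff.2 h.diffS
  have hSU : ∀ J : Jet, J.trunc m ∈ Ω → S J ∈ U := h.maps
  have hSn : ∀ i, n < i → ∀ J : Jet, J.trunc m ∈ Ω → pdV i S J = 0 := fun i hi J hJ => by
    by_contra hne
    exact absurd (hn.2 ⟨J, hJ, hne⟩) (by omega)
  obtain ⟨J₀, hJ₀, hne⟩ := hn.1
  have hnm : n ≤ m := by
    by_contra hnm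
    obtain ⟨F, hF⟩ := hS
    exact hne (hF.pdV_of_lt hΩ (by omega) hJ₀)
  have hSp := hS.pdV hΩ n
  have hR5 : IsJetFun Ω m fun J => r (S J) ^ 5 :=
    hS.comp (φ := fun u => r u ^ 5) fun J hJ => (hr _ (hSU J hJ)).pow 5
  have hflux : IsJetFun Ω (m + 5) fun J => hdFlux r (prolong S J) :=
    (hR5.mono (Nat.le_add_right m 5)).mul (hS.iterate hΩ 5)
  have key : ∀ k, 5 ≤ k → (∀ i, k < i → ∀ J : Jet, J.trunc m ∈ Ω → pdV i R J = 0) →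
      ∀ J : Jet, J.trunc m ∈ Ω → pdV k R J * pdV n S J =
        if k = 5 then r (S J) ^ 5 * pdV n S J else 0 := by
    intro k hk hRk J hJ
    rw [← pdV_totalDt hΩ hR hS (by omega) hSn hRk hnm hJ,
      ← hflux.pdV_congr hΩ (fun J hJ => (h.eqn J hJ).symm) _ hJ,
      pdV_hdFlux_prolong hr hΩ hS hSU hk hSn hJ]
  have hRk : ∀ d k, 6 ≤ k → m < k + d → ∀ J : Jet, J.trunc m ∈ Ω → pdV k R J = 0 := by
    intro d
    induction d with
    | zero =>
      intro k _ hk J hJ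
      obtain ⟨F, hF⟩ := hR
      exact hF.pdV_of_lt hΩ (by omega) hJ
    | succ d ih =>
      intro k hk hkd
      have h1 := key k (by omega) fun i hi => ih i (by omega) (by omega)
      simp only [if_neg (show k ≠ 5 by omega)] at h1
      exact IsJetFun.eq_zero_of_mul_eq_zero hΩ hc (hR.pdV hΩ k) hSp h1 hJ₀ hne
  have h5 := key 5 le_rfl fun i hi => hRk (m + 1) i (by omega) (by omega)
  have hR5' := IsJetFun.eq_zero_of_mul_eq_zero hΩ hc ((hR.pdV hΩ 5).sub hR5) hSp
    (fun J hJ => by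
      have h1 := h5 J hJ
      rw [if_pos rfl] at h1
      rw [sub_mul, h1, sub_self]) hJ₀ hne
  have h6 : pdV n (fun J => r (S J) ^ 5) J₀ = 0 := by
    rw [hR5.pdV_congr hΩ (fun J hJ => (sub_eq_zero.1 (hR5' J hJ)).symm) n hJ₀]
    obtain ⟨F, hF⟩ := hR
    rw [hF.pdV_pdV_comm hΩ _ _ hJ₀, ← (isJetFun_const (p := m) (Ω := Ω) 0).pdV_congr hΩ
      (fun J hJ => (hRk (m + 1) n (by omega) (by omega) J hJ).symm) 5 hJ₀, pdV_const]
  have hd := (hr _ (hSU J₀ hJ₀)).differentiableAt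
  rw [pdV_comp (φ := fun u => r u ^ 5) hΩ hS n hJ₀ (hd.fun_pow 5),
    (hd.hasDerivAt.fun_pow 5).deriv] at h6
  have h7 := two_mul_mul_deriv_root hU hr hsq (hSU J₀ hJ₀)
  have h8 := root_ne_zero hU hr hsq (hSU J₀ hJ₀)
  have h9 : deriv r (S J₀) ≠ 0 := fun h => by simp [h] at h7
  exact mul_ne_zero (mul_ne_zero (mul_ne_zero (by norm_num) (pow_ne_zero _ h8)) h9) hne h6

end Order

/-! ### The transformation `u = (v / v₃)^{2/3}` -/

section Transformation

section Leibniz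

variable {m : ℕ} {Ω : Set (JetSpace m)} {p : ℕ} {f g h : Jet → ℂ}

/-- Iterated total derivatives of linear combinations of three functions. -/
theorem totalDx_iterate_lin (hΩ : IsOpen Ω) (hf : IsJetFun Ω p f) (hg : IsJetFun Ω p g)
    (hh : IsJetFun Ω p h) (a b c : ℂ) (k : ℕ) : ∀ J : Jet, J.trunc m ∈ Ω →
      (totalDx^[k] fun J => a * f J + b * g J + c * h J) J =
        a * (totalDx^[k] f) J + b * (totalDx^[k] g) J + c * (totalDx^[k] h) J := by
  have hmul : ∀ {f : Jet → ℂ} {p : ℕ} (_ : IsJetFun Ω p f) (a : ℂ),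
      IsJetFun Ω p fun J => a * f J := fun hf a => (isJetFun_const a).mul hf
  have Dmul : ∀ {f : Jet → ℂ} {p : ℕ} (_ : IsJetFun Ω p f) (a : ℂ) {J : Jet}, J.trunc m ∈ Ω →
      totalDx (fun J => a * f J) J = a * totalDx f J := fun hf a J hJ => by
    rw [totalDx_mul hΩ (isJetFun_const a) hf hJ, totalDx_const, zero_mul, zero_add]
  have hF := ((hmul hf a).add (hmul hg b)).add (hmul hh c)
  induction k with
  | zero => exact fun _ _ => rfl
  | succ k ih =>
    intro J hJ
    have hfk := hf.iterate hΩ k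
    have hgk := hg.iterate hΩ k
    have hhk := hh.iterate hΩ k
    simp only [Function.iterate_succ_apply']
    rw [(hF.iterate hΩ k).totalDx_congr hΩ ih hJ,
      totalDx_add hΩ ((hmul hfk a).add (hmul hgk b)) (hmul hhk c) hJ,
      totalDx_add hΩ (hmul hfk a) (hmul hgk b) hJ, Dmul hfk a hJ, Dmul hgk b hJ, Dmul hhk c hJ]

theorem totalDx_v_mul (hΩ : IsOpen Ω) (hg : IsJetFun Ω p g) {i : ℕ} (hi : i ≤ p) {J : Jet}
    (hJ : J.trunc m ∈ Ω) :
    totalDx (fun J => J.v i * g J) J = J.v (i + 1) * g J + J.v i * totalDx g J := by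
  rw [totalDx_mul hΩ (isJetFun_v hi) hg hJ, totalDx_v]

/-- The Leibniz formula for `D³ (v_i g)`. -/
theorem totalDx_three_v_mul (hΩ : IsOpen Ω) (hg : IsJetFun Ω p g) {i : ℕ} (hi : i + 2 ≤ p) {J : Jet}
    (hJ : J.trunc m ∈ Ω) : (totalDx^[3] fun J => J.v i * g J) J =
      J.v (i + 3) * g J + 3 * J.v (i + 2) * totalDx g J + 3 * J.v (i + 1) * (totalDx^[2] g) J +
        J.v i * (totalDx^[3] g) J := by
  have hg1 := hg.totalDx hΩ
  have hg2 := hg1.totalDx hΩ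
  have hv : ∀ j, j ≤ i + 2 → ∀ {q : ℕ}, p ≤ q → IsJetFun Ω q fun J => J.v j := fun j hj q hq =>
    isJetFun_v (by omega)
  have e1 : ∀ J : Jet, J.trunc m ∈ Ω → totalDx (fun J => J.v i * g J) J =
      J.v (i + 1) * g J + J.v i * totalDx g J := fun J hJ => totalDx_v_mul hΩ hg (by omega) hJ
  have h1 := ((hv i (by omega) le_rfl).mul hg).totalDx hΩ
  have e2 : ∀ J : Jet, J.trunc m ∈ Ω → totalDx (totalDx fun J => J.v i * g J) J =
      J.v (i + 2) * g J + 2 * (J.v (i + 1) * totalDx g J) + J.v i * totalDx (totalDx g) J := by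
    intro J hJ
    rw [h1.totalDx_congr hΩ e1 hJ, totalDx_add hΩ
      (((hv (i + 1) (by omega) le_rfl).mul hg).mono p.le_succ)
      ((hv i (by omega) p.le_succ).mul hg1) hJ, totalDx_v_mul hΩ hg (by omega) hJ,
      totalDx_v_mul hΩ hg1 (by omega) hJ]
    ring
  change totalDx (totalDx (totalDx fun J => J.v i * g J)) J = _
  have t1 := ((hv (i + 2) le_rfl le_rfl).mul hg).mono (show p ≤ p + 2 by omega)
  have t2 := ((hv (i + 1) (by omega) (Nat.le_succ p)).mul hg1).mono (show p + 1 ≤ p + 2 by omega)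
  have t3 := (hv i (by omega) (show p ≤ p + 2 by omega)).mul hg2
  have c2 := (isJetFun_const (Ω := Ω) (p := p + 2) 2).mul t2
  rw [(h1.totalDx hΩ).totalDx_congr hΩ e2 hJ, totalDx_add hΩ (t1.add c2) t3 hJ,
    totalDx_add hΩ t1 c2 hJ, totalDx_mul hΩ (isJetFun_const 2) t2 hJ, totalDx_const,
    totalDx_v_mul hΩ hg (by omega) hJ, totalDx_v_mul hΩ hg1 (by omega) hJ,
    totalDx_v_mul hΩ hg2 (by omega) hJ]
  change _ = _ + 3 * J.v (i + 2) * totalDx g J + 3 * J.v (i + 1) * totalDx (totalDx g) J +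
    J.v i * totalDx (totalDx (totalDx g)) J
  ring

/-- The total derivative does not raise the order if the highest derivative does not occur. -/
theorem IsJetFun.totalDx_of_pdV_eq_zero (hΩ : IsOpen Ω) (hf : IsJetFun Ω p f)
    (h : ∀ J : Jet, J.trunc m ∈ Ω → Miura.pdV p f J = 0) : IsJetFun Ω p (Miura.totalDx f) := by
  have h1 : IsJetFun Ω p fun J => Miura.pdX f J +
      ∑ j ∈ Finset.range p, J.v (j + 1) * Miura.pdV j f J :=
    (hf.pdX hΩ).add (IsJetFun.sum fun j hj =>
      (isJetFun_v (Finset.mem_range.1 hj)).mul (hf.pdV hΩ j))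
  refine h1.congr fun J hJ => ?_
  obtain ⟨F, hF⟩ := hf
  rw [Miura.totalDx, hF.finsum_pdV hΩ hJ fun j => J.v (j + 1), Finset.sum_range_succ, h J hJ,
    mul_zero, add_zero]

end Leibniz

variable {U : Set ℂ} {r : ℂ → ℂ} {Ω : Set (JetSpace 5)} {S : Jet → ℂ}

/-- The function `S` is a branch of `(v / v₃)^{2/3}` over `Ω`, such that `S^{3/2} = v / v₃` for the
given branch `r` of the square root. -/
def IsBranch (U : Set ℂ) (r : ℂ → ℂ) (Ω : Set (JetSpace 5)) (S : Jet → ℂ) : Prop :=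
  ∀ J : Jet, J.trunc 5 ∈ Ω → J.v 3 ≠ 0 ∧ S J ∈ U ∧ r (S J) ^ 3 = J.v 0 / J.v 3

theorem IsBranch.ne_zero (hU : IsOpen U) (hr : AnalyticOnNhd ℂ r U)
    (hsq : ∀ u ∈ U, r u ^ 2 = u) (h : IsBranch U r Ω S) {J : Jet} (hJ : J.trunc 5 ∈ Ω) :
    J.v 3 ≠ 0 ∧ J.v 0 ≠ 0 ∧ S J ≠ 0 ∧ S J ^ 3 * J.v 3 ^ 2 = J.v 0 ^ 2 ∧
      r (S J) ^ 5 * J.v 3 = S J * J.v 0 := by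
  obtain ⟨h3, hSU, heq⟩ := h J hJ
  have hr0 := root_ne_zero hU hr hsq hSU
  have hs := hsq _ hSU
  rw [eq_div_iff h3] at heq
  refine ⟨h3, ?_, ?_, ?_, ?_⟩
  · rw [← heq]; exact mul_ne_zero (pow_ne_zero 3 hr0) h3
  · rw [← hs]; exact pow_ne_zero 2 hr0
  · generalize r (S J) = q at *
    rw [← heq, ← hs]; ring
  · generalize r (S J) = q at *
    rw [← heq, ← hs]; ring

/-- The derivatives of `S` in all directions, from `S³ v₃² = v²`. -/
theorem IsBranch.fderiv_apply (hU : IsOpen U) (hr : AnalyticOnNhd ℂ r U)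
    (hsq : ∀ u ∈ U, r u ^ 2 = u) (hΩ : IsOpen Ω) (h : IsBranch U r Ω S) {F : JetSpace 5 → ℂ}
    (hF : Rep Ω 5 F S) {J : Jet} (hJ : J.trunc 5 ∈ Ω) (e : JetSpace 5) :
    3 * J.v 0 * J.v 3 * fderiv ℂ F (J.trunc 5) e =
      2 * S J * (e.2.2 0 * J.v 3 - J.v 0 * e.2.2 3) := by
  let c : Fin 6 → JetSpace 5 →L[ℂ] ℂ := fun i =>
    (ContinuousLinearMap.proj (R := ℂ) (φ := fun _ : Fin 6 => ℂ) i).comp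
      ((ContinuousLinearMap.snd ℂ ℂ _).comp (ContinuousLinearMap.snd ℂ ℂ _))
  have h1 := ((hF.analytic J hJ).differentiableAt.hasFDerivAt.pow 3).mul
    ((c 3).hasFDerivAt (x := J.trunc 5) |>.pow 2)
  have h2 : HasFDerivAt (fun z => F z ^ 3 * c 3 z ^ 2) _ (J.trunc 5) :=
    ((c 0).hasFDerivAt (x := J.trunc 5) |>.pow 2).congr_of_eventuallyEq (by
      filter_upwards [hΩ.mem_nhds hJ] with z hz
      obtain ⟨K, rfl⟩ := trunc_surjective 5 z
      have h3 := (h.ne_zero hU hr hsq hz).2.2.2.1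
      rw [hF.eq K hz] at h3
      exact h3)
  have h4 := congr_arg (fun L : JetSpace 5 →L[ℂ] ℂ => L e) (h1.unique h2)
  obtain ⟨h3, h0, hS0, hS, -⟩ := h.ne_zero hU hr hsq hJ
  have c3 : c 3 (J.trunc 5) = J.v 3 := rfl
  have c0 : c 0 (J.trunc 5) = J.v 0 := rfl
  have e3 : c 3 e = e.2.2 3 := rfl
  have e0 : c 0 e = e.2.2 0 := rfl
  simp only [add_apply, smul_apply, smul_eq_mul,
    nsmul_eq_mul, c3, c0, e3, e0, ← hF.eq J hJ] at h4
  norm_num at h4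
  refine mul_left_cancel₀ (mul_ne_zero (pow_ne_zero 2 hS0) h3) ?_
  linear_combination J.v 0 * h4 + (-2 * e.2.2 0) * hS

theorem IsBranch.pdV (hU : IsOpen U) (hr : AnalyticOnNhd ℂ r U)
    (hsq : ∀ u ∈ U, r u ^ 2 = u) (hΩ : IsOpen Ω) (h : IsBranch U r Ω S) (hS : IsJetFun Ω 5 S)
    (j : ℕ) {J : Jet} (hJ : J.trunc 5 ∈ Ω) : 3 * J.v 0 * J.v 3 * Miura.pdV j S J =
      2 * S J * ((if j = 0 then 1 else 0) * J.v 3 - J.v 0 * (if j = 3 then 1 else 0)) := by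
  obtain ⟨F, hF⟩ := hS
  rw [hF.pdV_eq hΩ j hJ, h.fderiv_apply hU hr hsq hΩ hF hJ]
  simp [dirV, eq_comm]

theorem IsBranch.pdV_eq_zero (hU : IsOpen U) (hr : AnalyticOnNhd ℂ r U)
    (hsq : ∀ u ∈ U, r u ^ 2 = u) (hΩ : IsOpen Ω) (h : IsBranch U r Ω S) (hS : IsJetFun Ω 5 S)
    {j : ℕ} (hj0 : j ≠ 0) (hj3 : j ≠ 3) {J : Jet} (hJ : J.trunc 5 ∈ Ω) : Miura.pdV j S J = 0 := by
  have h1 := h.pdV hU hr hsq hΩ hS j hJ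
  obtain ⟨h3, h0, -⟩ := h.ne_zero hU hr hsq hJ
  rw [if_neg hj0, if_neg hj3] at h1
  simpa [h3, h0] using h1

theorem IsBranch.pdT (hU : IsOpen U) (hr : AnalyticOnNhd ℂ r U)
    (hsq : ∀ u ∈ U, r u ^ 2 = u) (hΩ : IsOpen Ω) (h : IsBranch U r Ω S) (hS : IsJetFun Ω 5 S)
    {J : Jet} (hJ : J.trunc 5 ∈ Ω) : Miura.pdT S J = 0 := by
  obtain ⟨F, hF⟩ := hS
  have h1 := h.fderiv_apply hU hr hsq hΩ hF hJ (dirT 5)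
  obtain ⟨h3, h0, -⟩ := h.ne_zero hU hr hsq hJ
  rw [hF.pdT_eq hΩ hJ]
  simpa [dirT, h3, h0] using h1

theorem IsBranch.totalDx (hU : IsOpen U) (hr : AnalyticOnNhd ℂ r U)
    (hsq : ∀ u ∈ U, r u ^ 2 = u) (hΩ : IsOpen Ω) (h : IsBranch U r Ω S) (hS : IsJetFun Ω 5 S)
    {J : Jet} (hJ : J.trunc 5 ∈ Ω) : 3 * (J.v 0 * (J.v 3 * Miura.totalDx S J)) =
      2 * (S J * (J.v 1 * J.v 3)) + -2 * (S J * (J.v 0 * J.v 4)) := by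
  obtain ⟨F, hF⟩ := hS
  have h1 := h.fderiv_apply hU hr hsq hΩ hF hJ (dirX 5 + jetShift 5 (J.trunc 6))
  rw [← hF.totalDx_eq hΩ hJ] at h1
  rw [jetShift_trunc] at h1
  have e0 : (dirX 5 + ((0, 0, fun i => J.v (i + 1)) : JetSpace 5)).2.2 0 = J.v 1 := by simp [dirX]
  have e3 : (dirX 5 + ((0, 0, fun i => J.v (i + 1)) : JetSpace 5)).2.2 3 = J.v 4 := by
    simp [dirX]
  rw [e0, e3] at h1
  linear_combination h1

theorem IsBranch.totalDx_two (hU : IsOpen U) (hr : AnalyticOnNhd ℂ r U)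
    (hsq : ∀ u ∈ U, r u ^ 2 = u) (hΩ : IsOpen Ω) (h : IsBranch U r Ω S) (hS : IsJetFun Ω 5 S)
    {J : Jet} (hJ : J.trunc 5 ∈ Ω) : 3 * J.v 0 * J.v 3 * (Miura.totalDx^[2] S) J =
      -(J.v 1 * J.v 3 + 5 * J.v 0 * J.v 4) * Miura.totalDx S J +
        2 * S J * (J.v 2 * J.v 3 - J.v 0 * J.v 5) := by
  have hS' := hS.mono (show 5 ≤ 6 by norm_num)
  have hS1 := hS.totalDx hΩ
  have hv : ∀ j, j ≤ 6 → IsJetFun Ω 6 fun J => J.v j := fun j hj => isJetFun_v hj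
  have hc : ∀ c : ℂ, IsJetFun Ω 6 fun _ => c := fun c => isJetFun_const c
  have a1 := (hv 3 (by norm_num)).mul hS1
  have a0 := (hv 0 (by norm_num)).mul a1
  have b1 := (hv 1 (by norm_num)).mul (hv 3 (by norm_num))
  have b2 := (hv 0 (by norm_num)).mul (hv 4 (by norm_num))
  have b1' := hS'.mul b1
  have b2' := hS'.mul b2
  have h1 := ((hc 3).mul a0).totalDx_congr hΩ (fun J hJ => h.totalDx hU hr hsq hΩ hS hJ) hJ
  rw [totalDx_mul hΩ (hc 3) a0 hJ, totalDx_v_mul hΩ a1 (by norm_num) hJ,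
    totalDx_v_mul hΩ hS1 (by norm_num) hJ, totalDx_add hΩ ((hc 2).mul b1') ((hc (-2)).mul b2') hJ,
    totalDx_mul hΩ (hc 2) b1' hJ, totalDx_mul hΩ (hc (-2)) b2' hJ, totalDx_mul hΩ hS' b1 hJ,
    totalDx_mul hΩ hS' b2 hJ, totalDx_v_mul hΩ (hv 3 (by norm_num)) (by norm_num) hJ,
    totalDx_v_mul hΩ (hv 4 (by norm_num)) (by norm_num) hJ, totalDx_v, totalDx_v, totalDx_const,
    totalDx_const, totalDx_const] at h1
  change 3 * J.v 0 * J.v 3 * Miura.totalDx (Miura.totalDx S) J = _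
  linear_combination h1

/-- In `D³ R` the terms with `D³ S` and with `D⁴ S` cancel. -/
theorem totalDx_three_modFlux (hΩ : IsOpen Ω) (hS : IsJetFun Ω 5 S) {J : Jet}
    (hJ : J.trunc 5 ∈ Ω) : (Miura.totalDx^[3] (modFlux S)) J =
      -(3 / 2) * J.v 0 * (Miura.totalDx^[5] S) J - 15 * J.v 3 * (Miura.totalDx^[2] S) J -
        45 / 2 * J.v 4 * Miura.totalDx S J - 9 * J.v 5 * S J := by
  have h0 := hS.mono (show 5 ≤ 7 by norm_num)
  have h1 := (hS.totalDx hΩ).mono (show 6 ≤ 7 by norm_num)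
  have h2 := hS.iterate hΩ 2
  have hv : ∀ j, j ≤ 7 → IsJetFun Ω 7 fun J => J.v j := fun j hj => isJetFun_v hj
  have e : modFlux S = fun J => -(3 / 2) * (J.v 0 * (Miura.totalDx^[2] S) J) +
      9 / 2 * (J.v 1 * Miura.totalDx S J) + -9 * (J.v 2 * S J) := by
    funext J
    rw [modFlux]
    ring
  rw [e, totalDx_iterate_lin hΩ ((hv 0 (by norm_num)).mul h2) ((hv 1 (by norm_num)).mul h1)
    ((hv 2 (by norm_num)).mul h0) _ _ _ 3 J hJ, totalDx_three_v_mul hΩ h2 (by norm_num) hJ,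
    totalDx_three_v_mul hΩ h1 (by norm_num) hJ, totalDx_three_v_mul hΩ h0 (by norm_num) hJ]
  simp only [Function.iterate_succ_apply, Function.iterate_zero_apply]
  ring

/-- As `S` depends on `v` and `v₃` only, `D_t S = S_v R + S_{v₃} D³ R`. The term with `D⁵ S` has the
coefficient `-(3/2) v S_{v₃} = S v / v₃ = S^{5/2}`; the other terms cancel in view of
the formulas for `D S` and `D² S`. -/
theorem IsBranch.isMiura (hU : IsOpen U) (hr : AnalyticOnNhd ℂ r U)
    (hsq : ∀ u ∈ U, r u ^ 2 = u) (hΩ : IsOpen Ω) (hc : IsConnected Ω) (h : IsBranch U r Ω S)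
    (hS : IsJetFun Ω 5 S) : IsMiura (hdFlux r) (valuesIn U) 5 Ω (modFlux S) S := by
  have z4 : ∀ J : Jet, J.trunc 5 ∈ Ω → Miura.pdV 4 S J = 0 := fun J hJ =>
    h.pdV_eq_zero hU hr hsq hΩ hS (by norm_num) (by norm_num) hJ
  have z5 : ∀ J : Jet, J.trunc 5 ∈ Ω → Miura.pdV 5 S J = 0 := fun J hJ =>
    h.pdV_eq_zero hU hr hsq hΩ hS (by norm_num) (by norm_num) hJ
  have hS1 : IsJetFun Ω 5 (Miura.totalDx S) := hS.totalDx_of_pdV_eq_zero hΩ z5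
  have hS2 : IsJetFun Ω 5 (Miura.totalDx^[2] S) := by
    refine hS1.totalDx_of_pdV_eq_zero hΩ fun J hJ => ?_
    obtain ⟨F, hF⟩ := hS
    rw [hF.pdV_totalDx hΩ 4 hJ, z4 J hJ, IsJetFun.totalDx_eq_zero hΩ z5 hJ, add_zero]
  have hv : ∀ j, j ≤ 5 → IsJetFun Ω 5 fun J => J.v j := fun j hj => isJetFun_v hj
  have hcst : ∀ c : ℂ, IsJetFun Ω 5 fun _ => c := fun c => isJetFun_const c
  refine ⟨hΩ, hc, isJetFun_iff.1 ?_, isJetFun_iff.1 hS, fun J hJ => (h J hJ).2.1, fun J hJ => ?_⟩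
  · exact ((((hcst _).mul (hv 0 (by norm_num))).mul hS2).add
      (((hcst _).mul (hv 1 (by norm_num))).mul hS1)).sub
        (((hcst _).mul (hv 2 (by norm_num))).mul hS)
  · have z : ∀ j, j ≠ 0 → j ≠ 3 → Miura.pdV j S J = 0 := fun j h0 h3 =>
      h.pdV_eq_zero hU hr hsq hΩ hS h0 h3 hJ
    have d0 := h.pdV hU hr hsq hΩ hS 0 hJ
    have d3 := h.pdV hU hr hsq hΩ hS 3 hJ
    norm_num at d0 d3
    obtain ⟨h3, h0, hS0, -, h5⟩ := h.ne_zero hU hr hsq hJ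
    have hD2 := h.totalDx_two hU hr hsq hΩ hS hJ
    rw [hS.totalDt_eq hΩ _ hJ, h.pdT hU hr hsq hΩ hS hJ]
    simp only [Finset.sum_range_succ, Finset.sum_range_zero, z 1 (by norm_num) (by norm_num),
      z 2 (by norm_num) (by norm_num), z 4 (by norm_num) (by norm_num),
      z 5 (by norm_num) (by norm_num), totalDx_three_modFlux hΩ hS hJ, Function.iterate_zero_apply]
    change _ = r (S J) ^ 5 * (Miura.totalDx^[5] S) J
    simp only [modFlux]
    -- multiplied by `3 v v₃`, the derivatives `S_v`, `S_{v₃}` become polynomial in `S` and the jet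
    refine mul_left_cancel₀ (mul_ne_zero (mul_ne_zero three_ne_zero h0) h3) ?_
    generalize (Miura.totalDx^[5] S) J = s5 at *
    generalize (Miura.totalDx^[2] S) J = s2 at *
    generalize Miura.totalDx S J = s1 at *
    linear_combination (-(3 / 2) * J.v 0 * s2 + 9 / 2 * J.v 1 * s1 - 9 * J.v 2 * S J) * d0 +
      (-(3 / 2) * J.v 0 * s5 - 15 * J.v 3 * s2 - 45 / 2 * J.v 4 * s1 - 9 * J.v 5 * S J) * d3 -
      3 * J.v 0 * s5 * h5 + 9 * S J * hD2

theorem IsBranch.hasOrder (hU : IsOpen U) (hr : AnalyticOnNhd ℂ r U)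
    (hsq : ∀ u ∈ U, r u ^ 2 = u) (hΩ : IsOpen Ω) (hc : IsConnected Ω) (h : IsBranch U r Ω S)
    (hS : IsJetFun Ω 5 S) : HasOrder 5 Ω S 3 := by
  constructor
  · obtain ⟨z, hz⟩ := hc.nonempty
    obtain ⟨J, rfl⟩ := trunc_surjective 5 z
    refine ⟨J, hz, fun h' => ?_⟩
    have d3 := h.pdV hU hr hsq hΩ hS 3 hz
    obtain ⟨h3, h0, hS0, -⟩ := h.ne_zero hU hr hsq hz
    rw [h'] at d3
    simp [h0, hS0] at d3
  · rintro k ⟨J, hJ, hk⟩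
    by_contra hk3
    exact hk (h.pdV_eq_zero hU hr hsq hΩ hS (by omega) (by omega) hJ)

end Transformation

/-! ### Solutions of the modified equation -/

section Solutions

variable {m : ℕ} {Ω : Set (JetSpace m)} {D : Set (ℂ × ℂ)} {v : ℂ × ℂ → ℂ} {R S f : Jet → ℂ}

/-- The derivative `∂ᵏv/∂xᵏ` as a function of two variables. -/
def xDeriv (v : ℂ × ℂ → ℂ) (k : ℕ) (q : ℂ × ℂ) : ℂ := iteratedDeriv k (fun s => v (s, q.2)) q.1

theorem AnalyticAt.hasDerivAt_fst {w : ℂ × ℂ → ℂ} {q : ℂ × ℂ} (h : AnalyticAt ℂ w q) :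
    HasDerivAt (fun s => w (s, q.2)) (fderiv ℂ w q (1, 0)) q.1 :=
  h.differentiableAt.hasFDerivAt.comp_hasDerivAt (f := fun s => (s, q.2)) q.1
    ((hasDerivAt_id q.1).prodMk (hasDerivAt_const q.1 q.2))

theorem AnalyticAt.hasDerivAt_snd {w : ℂ × ℂ → ℂ} {q : ℂ × ℂ} (h : AnalyticAt ℂ w q) :
    HasDerivAt (fun s => w (q.1, s)) (fderiv ℂ w q (0, 1)) q.2 :=
  h.differentiableAt.hasFDerivAt.comp_hasDerivAt (f := fun s => (q.1, s)) q.2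
    ((hasDerivAt_const q.2 q.1).prodMk (hasDerivAt_id q.2))

theorem xDeriv_succ (v : ℂ × ℂ → ℂ) (k : ℕ) (q : ℂ × ℂ) :
    xDeriv v (k + 1) q = deriv (fun s => xDeriv v k (s, q.2)) q.1 := by
  rw [xDeriv, iteratedDeriv_succ]
  rfl

theorem analyticOnNhd_xDeriv (hD : IsOpen D) (hv : AnalyticOnNhd ℂ v D) (k : ℕ) :
    AnalyticOnNhd ℂ (xDeriv v k) D ∧
      ∀ q ∈ D, xDeriv v (k + 1) q = fderiv ℂ (xDeriv v k) q (1, 0) := by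
  have h : ∀ k, AnalyticOnNhd ℂ (xDeriv v k) D →
      ∀ q ∈ D, xDeriv v (k + 1) q = fderiv ℂ (xDeriv v k) q (1, 0) := fun k hk q hq => by
    rw [xDeriv_succ]
    exact (AnalyticAt.hasDerivAt_fst (hk q hq)).deriv
  induction k with
  | zero =>
    have h0 : xDeriv v 0 = v := by funext q; simp [xDeriv]
    exact ⟨by rwa [h0], h 0 (by rwa [h0])⟩
  | succ k ih =>
    have h1 : AnalyticOnNhd ℂ (xDeriv v (k + 1)) D := by
      have h2 : AnalyticOnNhd ℂ (fun q => fderiv ℂ (xDeriv v k) q (1, 0)) D := fun q hq =>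
        analyticAt_fderiv_apply (ih.1 q hq) _
      exact h2.congr hD fun q hq => (ih.2 q hq).symm
    exact ⟨h1, h _ h1⟩

theorem analyticAt_trunc_jetOf (hD : IsOpen D) (hv : AnalyticOnNhd ℂ v D) (p : ℕ) {q : ℂ × ℂ}
    (hq : q ∈ D) : AnalyticAt ℂ (fun q => (jetOf v q).trunc p) q :=
  analyticAt_fst.prod (analyticAt_snd.prod
    (AnalyticAt.pi fun i : Fin (p + 1) => (analyticOnNhd_xDeriv hD hv i).1 q hq))

theorem Rep.analyticAt_comp_jetOf {p : ℕ} {F : JetSpace p → ℂ} (hF : Rep Ω p F f) (hD : IsOpen D)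
    (hv : AnalyticOnNhd ℂ v D) (hvΩ : ∀ q ∈ D, (jetOf v q).trunc m ∈ Ω) {q : ℂ × ℂ} (hq : q ∈ D) :
    AnalyticAt ℂ (fun q => f (jetOf v q)) q := by
  have h1 : AnalyticAt ℂ (fun q => F ((jetOf v q).trunc p)) q :=
    AnalyticAt.comp (g := F) (f := fun q => (jetOf v q).trunc p) (hF.analytic _ (hvΩ q hq))
      (analyticAt_trunc_jetOf hD hv p hq)
  refine h1.congr ?_
  filter_upwards [hD.mem_nhds hq] with q hq
  exact (hF.eq _ (hvΩ q hq)).symm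

/-- The total derivative is the derivative along jets of functions. -/
theorem IsJetFun.hasDerivAt_jetOf {p : ℕ} (hΩ : IsOpen Ω) (hf : IsJetFun Ω p f) (hD : IsOpen D)
    (hv : AnalyticOnNhd ℂ v D) (hvΩ : ∀ q ∈ D, (jetOf v q).trunc m ∈ Ω) {q : ℂ × ℂ} (hq : q ∈ D) :
    HasDerivAt (fun s => f (jetOf v (s, q.2))) (Miura.totalDx f (jetOf v q)) q.1 := by
  obtain ⟨F, hF⟩ := hf
  have hγ : ∀ p, HasDerivAt (fun s => (jetOf v (s, q.2)).trunc p)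
      ((1, 0, fun i : Fin (p + 1) => xDeriv v (i + 1) q) : JetSpace p) q.1 := fun p =>
    (hasDerivAt_id q.1).prodMk ((hasDerivAt_const q.1 q.2).prodMk (hasDerivAt_pi.2 fun i => by
      have h1 := analyticOnNhd_xDeriv hD hv i
      rw [h1.2 q hq]
      exact AnalyticAt.hasDerivAt_fst (h1.1 q hq)))
  refine (hF.hasDerivAt hΩ (γ := fun s => jetOf v (s, q.2)) hγ (hvΩ q hq)).congr_deriv ?_
  rw [hF.totalDx_eq hΩ (hvΩ q hq), jetShift_trunc]
  congr 1
  refine Prod.ext ?_ (Prod.ext ?_ (funext fun i => ?_)) <;> simp [dirX, xDeriv, jetOf]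

theorem IsJetFun.xDeriv_jetOf {p : ℕ} (hΩ : IsOpen Ω) (hf : IsJetFun Ω p f) (hD : IsOpen D)
    (hv : AnalyticOnNhd ℂ v D) (hvΩ : ∀ q ∈ D, (jetOf v q).trunc m ∈ Ω) (k : ℕ) :
    ∀ q ∈ D, xDeriv (fun q => f (jetOf v q)) k q = (Miura.totalDx^[k] f) (jetOf v q) := by
  induction k with
  | zero => intro q _; simp [xDeriv]
  | succ k ih =>
    intro q hq
    rw [xDeriv_succ, Function.iterate_succ_apply',
      ← ((hf.iterate hΩ k).hasDerivAt_jetOf hΩ hD hv hvΩ hq).deriv]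
    refine Filter.EventuallyEq.deriv_eq ?_
    have hc : ContinuousAt (fun s => (s, q.2)) q.1 := by fun_prop
    filter_upwards [hc.preimage_mem_nhds (hD.mem_nhds hq)] with s hs
    exact ih (s, q.2) hs

/-- Differential consequences of `v_t = R`. -/
theorem IsSolution.fderiv_xDeriv (hΩ : IsOpen Ω) (hR : IsJetFun Ω m R)
    (h : IsSolution R {J | J.trunc m ∈ Ω} D v) (k : ℕ) :
    ∀ q ∈ D, fderiv ℂ (xDeriv v k) q (0, 1) = (totalDx^[k] R) (jetOf v q) := by
  have hD := h.isOpen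
  have an := analyticOnNhd_xDeriv hD h.analytic
  induction k with
  | zero =>
    intro q hq
    rw [Function.iterate_zero_apply, ← h.eqn q hq]
    have h0 : xDeriv v 0 = v := by funext q; simp [xDeriv]
    rw [h0]
    exact (AnalyticAt.hasDerivAt_snd (h.analytic q hq)).deriv.symm
  | succ k ih =>
    intro q hq
    have e1 : xDeriv v (k + 1) =ᶠ[nhds q] fun q => fderiv ℂ (xDeriv v k) q (1, 0) := by
      filter_upwards [hD.mem_nhds hq] with q hq
      exact (an k).2 q hq
    have e2 : (fun q => fderiv ℂ (xDeriv v k) q (0, 1)) =ᶠ[nhds q]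
        fun q => (totalDx^[k] R) (jetOf v q) := by
      filter_upwards [hD.mem_nhds hq] with q hq
      exact ih q hq
    have hRk := hR.iterate hΩ k
    obtain ⟨F, hF⟩ := hRk
    rw [e1.fderiv_eq, fderiv_fderiv_apply ((an k).1 q hq), fderiv_fderiv_symm ((an k).1 q hq),
      ← fderiv_fderiv_apply ((an k).1 q hq), e2.fderiv_eq, Function.iterate_succ_apply']
    exact (AnalyticAt.hasDerivAt_fst (hF.analyticAt_comp_jetOf hD h.analytic h.jet_mem hq)).unique
      (IsJetFun.hasDerivAt_jetOf hΩ ⟨F, hF⟩ hD h.analytic h.jet_mem hq)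

/-- A Miura type transformation takes solutions to solutions. -/
theorem IsMiura.isSolution {P : Jet → ℂ} {Δ : Set Jet} (h : IsMiura P Δ m Ω R S)
    (hv : IsSolution R {J | J.trunc m ∈ Ω} D v) :
    IsSolution P Δ D fun q => S (jetOf v q) := by
  have hΩ := h.isOpen
  have hD := hv.isOpen
  have hS : IsJetFun Ω m S := isJetFun_iff.2 h.diffS
  have hR : IsJetFun Ω m R := isJetFun_iff.2 h.diffR
  have hjet : ∀ q ∈ D, jetOf (fun q => S (jetOf v q)) q = prolong S (jetOf v q) := by
    intro q hq
    refine Jet.ext rfl rfl (funext fun k => ?_)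
    exact hS.xDeriv_jetOf hΩ hD hv.analytic hv.jet_mem k q hq
  obtain ⟨F, hF⟩ := hS
  refine ⟨hD, fun q hq => hF.analyticAt_comp_jetOf hD hv.analytic hv.jet_mem hq, fun q hq => ?_,
    fun q hq => ?_⟩
  · rw [hjet q hq]
    exact h.maps _ (hv.jet_mem q hq)
  · rw [hjet q hq, ← h.eqn _ (hv.jet_mem q hq)]
    have hγ : ∀ p, HasDerivAt (fun s => (jetOf v (q.1, s)).trunc p)
        ((0, 1, fun i : Fin (p + 1) => (totalDx^[i] R) (jetOf v q)) : JetSpace p) q.2 := fun p =>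
      (hasDerivAt_const q.2 q.1).prodMk ((hasDerivAt_id q.2).prodMk (hasDerivAt_pi.2 fun i => by
        rw [← hv.fderiv_xDeriv hΩ hR i q hq]
        exact AnalyticAt.hasDerivAt_snd ((analyticOnNhd_xDeriv hD hv.analytic i).1 q hq)))
    rw [(hF.hasDerivAt hΩ (γ := fun s => jetOf v (q.1, s)) hγ (hv.jet_mem q hq)).deriv]
    refine (hF.fderiv_apply hΩ (hv.jet_mem q hq) 0 1 fun i => (totalDx^[i] R) (jetOf v q)).trans ?_
    rw [zero_mul, zero_add, one_mul, totalDt]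

end Solutions

/-! ### Existence of branches of `(v / v₃)^{2/3}` -/

section Existence

variable {U : Set ℂ} {r : ℂ → ℂ}

/-- The function `S = q²`, where `q = u₀^{1/2} ((v / v₃) / u₀^{3/2})^{1/3}` with the principal
branch of the cubic root near `1`. -/
theorem exists_isBranch (hU : IsOpen U) (hr : AnalyticOnNhd ℂ r U) (hsq : ∀ u ∈ U, r u ^ 2 = u)
    (J₀ : Jet) (u₀ : ℂ) (hu₀ : u₀ ∈ U) (h3 : J₀.v 3 ≠ 0) (h0 : r u₀ ^ 3 = J₀.v 0 / J₀.v 3) :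
    ∃ (Ω : Set (JetSpace 5)) (S : Jet → ℂ), IsOpen Ω ∧ IsConnected Ω ∧ J₀.trunc 5 ∈ Ω ∧
      S J₀ = u₀ ∧ IsDiffFun 5 Ω S ∧ IsBranch U r Ω S := by
  set a := r u₀ with ha
  have ha0 : a ≠ 0 := root_ne_zero hU hr hsq hu₀
  have ha2 : a ^ 2 = u₀ := hsq u₀ hu₀
  let c : Fin 6 → JetSpace 5 →L[ℂ] ℂ := fun i =>
    (ContinuousLinearMap.proj (R := ℂ) (φ := fun _ : Fin 6 => ℂ) i).comp
      ((ContinuousLinearMap.snd ℂ ℂ _).comp (ContinuousLinearMap.snd ℂ ℂ _))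
  let ρ : JetSpace 5 → ℂ := fun z => c 0 z / c 3 z / a ^ 3
  let q : JetSpace 5 → ℂ := fun z => a * ρ z ^ ((3 : ℕ) : ℂ)⁻¹
  set z₀ := J₀.trunc 5
  have c3 : c 3 z₀ ≠ 0 := h3
  have hρ₀ : ρ z₀ = 1 := by
    change J₀.v 0 / J₀.v 3 / a ^ 3 = 1
    rw [← h0, div_self (pow_ne_zero 3 ha0)]
  have hq₀ : q z₀ = a := by
    change a * ρ z₀ ^ _ = a
    rw [hρ₀, Complex.one_cpow, mul_one]
  have anρ : AnalyticAt ℂ ρ z₀ :=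
    (((c 0).analyticAt _).div ((c 3).analyticAt _) c3).div analyticAt_const (pow_ne_zero 3 ha0)
  have anq : AnalyticAt ℂ q z₀ := analyticAt_const.mul
    (anρ.cpow analyticAt_const (by rw [hρ₀]; exact Complex.one_mem_slitPlane))
  have anS : AnalyticAt ℂ (fun z => q z ^ 2) z₀ := anq.pow 2
  have hS₀ : q z₀ ^ 2 = u₀ := by rw [hq₀, ha2]
  -- near `z₀`, the root `r (q²) = ± q` is `q`
  have e1 : ∀ᶠ z in nhds z₀, q z ^ 2 ∈ U :=
    anS.continuousAt.eventually_mem (hU.mem_nhds (by rw [hS₀]; exact hu₀))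
  have e2 : ∀ᶠ z in nhds z₀, r (q z ^ 2) + q z ≠ 0 := by
    have h1 : ContinuousAt r (q z₀ ^ 2) := by rw [hS₀]; exact (hr u₀ hu₀).continuousAt
    have h2 : ContinuousAt (fun z => r (q z ^ 2)) z₀ :=
      ContinuousAt.comp (g := r) h1 anS.continuousAt
    refine (h2.add anq.continuousAt).eventually_ne ?_
    change r (q z₀ ^ 2) + q z₀ ≠ 0
    rw [hS₀, hq₀, ← ha, ← two_mul]
    exact mul_ne_zero two_ne_zero ha0
  have e3 : ∀ᶠ z in nhds z₀, c 3 z ≠ 0 := (c 3).continuous.continuousAt.eventually_ne c3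
  obtain ⟨ε, hε, hball⟩ := Metric.nhds_basis_ball.eventually_iff.1
    (((e1.and e2).and e3).and anS.eventually_analyticAt)
  refine ⟨Metric.ball z₀ ε, fun J => q (J.trunc 5) ^ 2, Metric.isOpen_ball,
    ⟨⟨z₀, Metric.mem_ball_self hε⟩, (convex_ball z₀ ε).isPreconnected⟩, Metric.mem_ball_self hε,
    hS₀, ⟨fun z => q z ^ 2, fun z hz => (hball hz).2, fun _ _ => rfl⟩, fun J hJ => ?_⟩
  obtain ⟨⟨⟨hSU, hne⟩, hv3⟩, -⟩ := hball hJ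
  refine ⟨hv3, hSU, ?_⟩
  change r (q (J.trunc 5) ^ 2) ^ 3 = _
  have h1 : r (q (J.trunc 5) ^ 2) = q (J.trunc 5) := by
    have h2 := hsq _ hSU
    have h4 : (r (q (J.trunc 5) ^ 2) + q (J.trunc 5)) *
        (r (q (J.trunc 5) ^ 2) - q (J.trunc 5)) = 0 := by
      linear_combination h2
    exact sub_eq_zero.1 ((mul_eq_zero.1 h4).resolve_left hne)
  rw [h1]
  change (a * ρ (J.trunc 5) ^ ((3 : ℕ) : ℂ)⁻¹) ^ 3 = _
  rw [mul_pow, Complex.cpow_nat_inv_pow _ three_ne_zero]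
  change a ^ 3 * (J.v 0 / J.v 3 / a ^ 3) = _
  rw [mul_div_cancel₀ _ (pow_ne_zero 3 ha0)]

end Existence

end Miura

end

theorem mainTheorem8 (U : Set ℂ) (hU : IsOpen U) (hUc : IsConnected U) (r : ℂ → ℂ)
    (hr : AnalyticOnNhd ℂ r U) (hsq : ∀ u ∈ U, r u ^ 2 = u) :
    -- the Wahlquist-Estabrook algebra exists, is `ℂ² ⊕ 𝔤`, and its chain stabilizes at the 5th step
    (∀ Ω : Set (Fin 5 → ℂ), IsOpen Ω → IsConnected Ω → (∀ z ∈ Ω, z 0 ∈ U) →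
      ∃ W : Miura.WEData.{w} 5 Ω (Miura.hdFlux r),
        (∃ e : W.Algebra ≃ₗ⁅ℂ⁆ (ℂ × ℂ) × Miura.gAlg, ∀ z ∈ Ω,
          e (W.A (z 0)) = (((r (z 0))⁻¹, 0), ((r (z 0))⁻¹ ^ 3) • Miura.x₁ + Miura.x₂)) ∧
        (Miura.chain (fun z : Ω => W.A (z.1 0)) 5 : Set W.Algebra) =
          ⋃ k, (Miura.chain (fun z : Ω => W.A (z.1 0)) k : Set W.Algebra)) ∧
    -- `𝔤` is the positive part of the affine algebra `A₂⁽²⁾`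
    (∃ e : Miura.posA22 ≃ₗ⁅ℂ⁆ Miura.gAlg,
      e (Miura.posE 0) = Miura.x₁ ∧ e (Miura.posE 1) = Miura.x₂) ∧
    -- every Miura type transformation has order at most 5
    (∀ (m : ℕ) (Ω : Set (Miura.JetSpace m)) (R S : Miura.Jet → ℂ),
      Miura.IsMiura (Miura.hdFlux r) (Miura.valuesIn U) m Ω R S →
      ∀ n, Miura.HasOrder m Ω S n → n ≤ 5) ∧
    -- each branch of `u = (v / v₃)^{2/3}` is a Miura type transformation of order 3
    (∀ (Ω : Set (Miura.JetSpace 5)) (S : Miura.Jet → ℂ), IsOpen Ω → IsConnected Ω →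
      Miura.IsDiffFun 5 Ω S →
      (∀ J : Miura.Jet, J.trunc 5 ∈ Ω → J.v 3 ≠ 0 ∧ S J ∈ U ∧ r (S J) ^ 3 = J.v 0 / J.v 3) →
      Miura.IsMiura (Miura.hdFlux r) (Miura.valuesIn U) 5 Ω (Miura.modFlux S) S ∧
      Miura.HasOrder 5 Ω S 3 ∧
      ∀ (D : Set (ℂ × ℂ)) (v : ℂ × ℂ → ℂ),
        Miura.IsSolution (Miura.modFlux S) {J | J.trunc 5 ∈ Ω} D v →
        Miura.IsSolution (Miura.hdFlux r) (Miura.valuesIn U) D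
          (fun q => S (Miura.jetOf v q))) ∧
    -- such branches exist near every jet with `v / v₃ = u₀^{3/2}`, `u₀ ∈ U`
    (∀ (J₀ : Miura.Jet) (u₀ : ℂ), u₀ ∈ U → J₀.v 3 ≠ 0 → r u₀ ^ 3 = J₀.v 0 / J₀.v 3 →
      ∃ (Ω : Set (Miura.JetSpace 5)) (S : Miura.Jet → ℂ), IsOpen Ω ∧ IsConnected Ω ∧
        J₀.trunc 5 ∈ Ω ∧ S J₀ = u₀ ∧ Miura.IsDiffFun 5 Ω S ∧
        ∀ J : Miura.Jet, J.trunc 5 ∈ Ω →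
          J.v 3 ≠ 0 ∧ S J ∈ U ∧ r (S J) ^ 3 = J.v 0 / J.v 3) := by
  refine ⟨fun Ω hΩ hc hΩU => Miura.exists_weData hU hr hsq hΩ hc hΩU,
    Miura.exists_posA22_equiv, ?_, ?_, ?_⟩
  · exact fun m Ω R S h n hn => h.order_le_five hU hr hsq hn
  · intro Ω S hΩ hc hS h
    have hS' := Miura.isJetFun_iff.2 hS
    have hb : Miura.IsBranch U r Ω S := h
    have hM := hb.isMiura hU hr hsq hΩ hc hS'
    exact ⟨hM, hb.hasOrder hU hr hsq hΩ hc hS', fun D v hv => hM.isSolution hv⟩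
  · exact fun J₀ u₀ hu₀ h3 h0 => Miura.exists_isBranch hU hr hsq J₀ u₀ hu₀ h3 h0
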